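/- Let $n\ge 1$ be an integer and $-\frac1n<\alpha<0$. For $\varphi:\mathbb{R}^n\to\mathbb{R}\cup\{+\infty\}$ write $\mathrm{dom}\,\varphi=\{x:\varphi(x)<+\infty\}$, $D_\varphi=\overline{\mathrm{dom}\,\varphi}$, and $\varphi^*(y)=\sup_{x\in\mathbb{R}^n}\{\langle x,y\rangle-\varphi(x)\}$ for the Legendre transform. Let $\mathrm{Conv}(\mathbb{R}^n)$ be the set of lower semicontinuous convex functions $\varphi:\mathbb{R}^n\to\mathbb{R}\cup\{+\infty\}$ with $\mathrm{dom}\,\varphi\ne\emptyset$. Let $f=(1-\alpha\varphi)^{1/\alpha}$ (with $f(x)=0$ where $\varphi(x)=+\infty$), where $\varphi\in\mathrm{Conv}(\mathbb{R}^n)$ is nonnegative and coercive, i.e. $\liminf_{|x|\to+\infty}\varphi(x)/|x|>0$. Let $K_f=\mathrm{Supp}(f)=D_\varphi$ and assume that the origin $o$ lies in $\mathrm{int}(K_f)$. Let $\psi\in\mathrm{Conv}(\mathbb{R}^n)$ and assume that there are constants $\beta_1>0$ and $\beta_2\in\mathbb{R}$ with $$-\infty<\inf\psi^*\le\psi^*\le\beta_1\varphi^*+\beta_2\quad\text{on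 }\mathbb{R}^n .$$ For $t>0$ small enough put $$f_t=\big(1-\alpha(\varphi^*+t\psi^*)^*\big)^{1/\alpha}$$ (with value $0$ where $(\varphi^*+t\psi^*)^*=+\infty$). Then $f$ is integrable; for all sufficiently small $t>0$ one has $(\varphi^*+t\psi^*)^*>\frac1\alpha$ on $\mathbb{R}^n$, so that $f_t$ is well defined, and $f_t$ is integrable; and $$\lim_{t\to0^+}\int_{\mathbb{R}^n}\frac{f_t(x)-f(x)}{t}\,dx=\int_{\mathbb{R}^n}\psi^*(\nabla\varphi(x))\,f(x)^{1-\alpha}\,dx+\int_{\partial K_f}h_{D_\psi}(\nu_{K_f}(x))\,f(x)\,d\mathcal{H}^{n-1}(x).$$ Here $h_{D_\psi}(u)=\sup_{y\in D_\psi}\langle u,y\rangle$ is the support function, $\nu_{K_f}$ is the Gauss map (outer unit normal) of the closed convex set $K_f$, and $\mathcal{H}^{n-1}$ is the $(n-1)$-dimensional Hausdorff measure. The integrands on the right are well defined and finite almost everywhere: almost every $x\in\mathrm{dom}\,\varphi$ is an interior point at which $\varphi$ is differentiable with $\psi^*(\nabla\varphi(x))<+\infty$, and $\mathcal{H}^{n-1}$-almost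 every $x\in\partial K_f$ has exactly one outer unit normal, with $h_{D_\psi}(\nu_{K_f}(x))<+\infty$. Outside $\mathrm{dom}\,\varphi$, where $f=0$, the first integrand is taken to be $0$. Both integrals on the right converge absolutely. -/

import Mathlib

open MeasureTheory Filter Topology

noncomputable section

namespace AlphaConcave

/-- Euclidean space `ℝⁿ`. -/
abbrev Euc (n : ℕ) : Type := EuclideanSpace ℝ (Fin n)

/-- The effective domain `{x : φ x < +∞}`. -/
def effDom {n : ℕ} (φ : Euc n → EReal) : Set (Euc n) := {x | φ x < ⊤}

/-- `φ ∈ Conv(ℝⁿ)`: a proper, convex, lower semicontinuous function `ℝⁿ → ℝ ∪ {+∞}`. -/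
structure IsConv {n : ℕ} (φ : Euc n → EReal) : Prop where
  ne_bot : ∀ x, φ x ≠ ⊥
  convex : ∀ (x y : Euc n) (l : ℝ), 0 ≤ l → l ≤ 1 →
    φ (l • x + (1 - l) • y) ≤ (l : EReal) * φ x + ((1 - l : ℝ) : EReal) * φ y
  lsc : LowerSemicontinuous φ
  proper : (effDom φ).Nonempty

/-- Coercivity: `liminf_{|x| → ∞} φ(x) / |x| > 0`. -/
def Coercive {n : ℕ} (φ : Euc n → EReal) : Prop :=
  0 < liminf (fun x : Euc n => φ x / ((‖x‖ : ℝ) : EReal)) (Bornology.cobounded (Euc n))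

/-- The Legendre transform `φ*(y) = sup_x (⟨x, y⟩ - φ x)`. -/
def legendre {n : ℕ} (φ : Euc n → EReal) (y : Euc n) : EReal :=
  ⨆ x : Euc n, (((inner ℝ x y : ℝ) : EReal) - φ x)

open Classical in
/-- The generator `Ψ_α(s) = (1 - α s)^(1/α)` for `s ∈ (1/α, +∞)`, with `Ψ_α(+∞) = 0`. Its values at
`s ≤ 1/α` carry no meaning. -/
def generator (α : ℝ) (s : EReal) : ℝ :=
  if s = ⊤ then 0 else (1 - α * s.toReal) ^ (1 / α)

/-- `f` belongs to the class `C_α⁺(ℝⁿ)` and `φ` is its base function: `f = (1 - α φ)^(1/α)` with `φ`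
proper, convex, lower semicontinuous, nonnegative and coercive. -/
structure IsCPlusWithBase {n : ℕ} (α : ℝ) (f : Euc n → ℝ) (φ : Euc n → EReal) : Prop where
  eq_generator : ∀ x, f x = generator α (φ x)
  conv : IsConv φ
  nonneg : ∀ x, 0 ≤ φ x
  coercive : Coercive φ

/-- The base function `(φ* + t ψ*)*` of the perturbed function `f_t`. -/
def pertBase {n : ℕ} (φ ψ : Euc n → EReal) (t : ℝ) : Euc n → EReal :=
  legendre (fun y => legendre φ y + (t : EReal) * legendre ψ y)

/-- The perturbed function `f_t = (1 - α (φ* + t ψ*)*)^(1/α)`. -/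
def pert {n : ℕ} (α : ℝ) (φ ψ : Euc n → EReal) (t : ℝ) (x : Euc n) : ℝ :=
  generator α (pertBase φ ψ t x)

/-- The gradient of `φ`, meaningful at interior points of the domain where `φ` is differentiable. -/
def grad {n : ℕ} (φ : Euc n → EReal) (x : Euc n) : Euc n :=
  gradient (fun z => (φ z).toReal) x

/-- The support function `h_A(u) = sup_{y ∈ A} ⟨u, y⟩`. -/
def supportFun {n : ℕ} (A : Set (Euc n)) (u : Euc n) : EReal :=
  ⨆ y ∈ A, ((inner ℝ u y : ℝ) : EReal)

/-- `u` is an outer unit normal vector of the convex set `K` at the point `x`. -/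
def IsOuterUnitNormal {n : ℕ} (K : Set (Euc n)) (x u : Euc n) : Prop :=
  ‖u‖ = 1 ∧ ∀ y ∈ K, inner ℝ u (y - x) ≤ 0

open Classical in
/-- The Gauss map `ν_K`: the outer unit normal vector at the points where there is exactly one
(almost all boundary points), and `0` elsewhere. -/
def gaussMap {n : ℕ} (K : Set (Euc n)) (x : Euc n) : Euc n :=
  if h : ∃! u, IsOuterUnitNormal K x u then h.choose else 0

end AlphaConcave

end

/-! Write `g` for the gauge of `dom φ`, so that `{g < 1}` is the interior of the domain and `{g =
1}` its boundary, a null set. The quotient `(f_t - f)/t` is integrated separately over `{g < 1}` and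
`{g > 1}`. The first region yields the gradient term. On the second region `f = 0`, and it yields
the boundary term.

All estimates on `(φ* + tψ*)*` come from two elementary inequalities, so no biconjugation theorem is
needed. A single slope `p` in the supremum gives the lower bound `⟨p, x⟩ - φ*(p) - tψ*(p)`
(`le_pertBase`). The infimal convolution `φ(x - ty) + tψ(y)` is an upper bound (`pertBase_le`).
Taking for `p` a subgradient of `φ` at `x/(1 + tβ₁)` and using `ψ* ≤ β₁φ* + β₂` leads to `f_t(x) ≤
(1 + αtβ₂)^(1/α) f(x/(1 + tβ₁))` (`PertData.pert_le`). The lower bound of `ψ*` leads to `f_t ≥ (1 -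
tm) f` (`PertData.le_pert`).

Interior. Where `φ` is differentiable, Fenchel equality at `p = ∇φ(x)` bounds the derivative of
`f_t(x)` above by `ψ*(p) f^(1-α)`, and near-maximizers of `ψ*(p)` in the infimal convolution bound
it below (`PertData.tendsto_interior`). The dominating functions are quotients of dilations of `f`,
which depend on `t`, so a dominated convergence theorem with convergent dominating integrals is
used. That convergence on `{g < 1}` follows by integrating the radial derivative along rays,
applying Fubini, and using right continuity in the dilation factor
(`PertData.tendsto_setIntegral_dilation`). The radial derivative is integrable by Fatou, since
scaling controls the integrals of the dilations.

Exterior. Put `ρ(θ) = 1/g(θ)` and use coordinates `(1 + tκ)ρ(θ)θ` outside the domain. If `N` is the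
gradient of `g` at the boundary point `x = ρ(θ)θ`, then `f_t((1 + tκ)x)` tends to `f(x)` for `0 < κ
< h(N)` and vanishes for `κ > h(N)`, where `h` is the support function of `D_ψ`. The decay `f ≤ C(1
+ |x|)^(1/α)` with `1/α ≤ -n` offsets the factor `ρ^n` and provides domination. The limit is the
integral of `f h(N)` against the cone measure of `dom φ`. By `coneMeasure_eq` this measure has
density `1/|N|` with respect to surface measure, and `h` is positively homogeneous, so the integrand
becomes `f h(N/|N|)`, with `N/|N|` the Gauss map.

The density formula is proved by cutting the boundary into countably many pieces on which the
normals are nearly constant. Each piece, and the cone over it, is mapped by a near-isometry onto a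
flat piece and its cone, whose volume is computed by slicing. -/

open MeasureTheory Filter Topology

noncomputable section

namespace AlphaConcave

/-! ### Subgradients and almost everywhere differentiability of convex functions. -/

section Subgradient

variable {E : Type*} [NormedAddCommGroup E] [InnerProductSpace ℝ E]

/-- `p` is a subgradient at `x` of the function `k` on the set `D`. -/
def IsSubgradientOn (k : E → ℝ) (D : Set E) (x p : E) : Prop :=
  ∀ y ∈ D, k x + inner ℝ p (y - x) ≤ k y

/-- Hahn-Banach separates `(x, k x)` from the strict epigraph over the interior of `D`, which is
open because a convex function is continuous there. The separating functional has negative vertical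
component `c`, and dividing by `-c` gives the slope. -/
theorem exists_isSubgradientOn [FiniteDimensional ℝ E] {k : E → ℝ} {D : Set E}
    (hk : ConvexOn ℝ D k) {x : E} (hx : x ∈ interior D) : ∃ p, IsSubgradientOn k D x p := by
  have hki : ConvexOn ℝ (interior D) k := hk.subset interior_subset hk.1.interior
  have hcont : ContinuousOn k (interior D) := hki.continuousOn isOpen_interior
  have hopen : IsOpen {z : E × ℝ | z.1 ∈ interior D ∧ k z.1 < z.2} := by
    have h1 : IsOpen ((interior D) ×ˢ (Set.univ : Set ℝ)) := isOpen_interior.prod isOpen_univ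
    have h2 : ContinuousOn (fun z : E × ℝ => z.2 - k z.1) ((interior D) ×ˢ (Set.univ : Set ℝ)) :=
      continuousOn_snd.sub (hcont.comp continuousOn_fst fun z hz => hz.1)
    have := h2.isOpen_inter_preimage h1 isOpen_Ioi (t := Set.Ioi (0 : ℝ))
    convert this using 1
    ext z
    simp [sub_pos]
  obtain ⟨L, hL⟩ := geometric_hahn_banach_open_point hki.convex_strict_epigraph hopen
    (x := (x, k x)) (by simp)
  set c := L (0, 1) with hc
  have hsplit : ∀ (y : E) (s : ℝ), L (y, s) = L (y, 0) + s * c := fun y s => by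
    have : (y, s) = (y, (0 : ℝ)) + s • ((0 : E), (1 : ℝ)) := by simp
    rw [this, map_add, map_smul, smul_eq_mul]
  have hcneg : c < 0 := by
    have := hL (x, k x + 1) ⟨hx, by simp⟩
    rw [hsplit, hsplit x (k x)] at this
    linarith
  set ℓ : StrongDual ℝ E := L.comp (ContinuousLinearMap.inl ℝ E ℝ) with hℓ
  have hℓa : ∀ y, ℓ y = L (y, 0) := fun y => rfl
  have key : ∀ y ∈ interior D, ℓ y + k y * c ≤ ℓ x + k x * c := by
    intro y hy
    have h1 : ∀ s, k y < s → ℓ y + s * c < ℓ x + k x * c := fun s hs => by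
      have := hL (y, s) ⟨hy, hs⟩
      rwa [hsplit, hsplit x (k x)] at this
    have h2 : Tendsto (fun s => ℓ y + s * c) (𝓝[>] (k y)) (𝓝 (ℓ y + k y * c)) :=
      Tendsto.mono_left (Continuous.tendsto (by fun_prop) _) nhdsWithin_le_nhds
    exact le_of_tendsto h2 (eventually_nhdsWithin_of_forall fun s hs => (h1 s hs).le)
  set p : E := (InnerProductSpace.toDual ℝ E).symm ((-c)⁻¹ • ℓ) with hp
  have hpi : ∀ z, inner ℝ p z = (-c)⁻¹ * ℓ z := fun z => by
    rw [hp, InnerProductSpace.toDual_symm_apply]; rfl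
  have key2 : ∀ y ∈ interior D, k x + inner ℝ p (y - x) ≤ k y := by
    intro y hy
    have := key y hy
    rw [hpi, map_sub]
    have h3 : (-c)⁻¹ * (ℓ y - ℓ x) ≤ k y - k x := by
      rw [inv_mul_le_iff₀ (by linarith)]
      linarith
    linarith
  refine ⟨p, fun y hy => ?_⟩
  -- A point `y` of `D` need not be interior, but the midpoint of `x` and `y` is. The inequality
  -- there and convexity along the segment give it at `y`.
  have h4 : ∀ s ∈ Set.Ioc (0 : ℝ) 1, (1 - s) • x + s • y ∈ D ∧
      (s < 1 → (1 - s) • x + s • y ∈ interior D) := fun s hs =>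
    ⟨hk.1 (interior_subset hx) hy (by linarith [hs.2]) hs.1.le (by ring), fun h =>
      hk.1.combo_interior_self_mem_interior hx hy (by linarith) hs.1.le (by ring)⟩
  have h5 := key2 _ ((h4 (1 / 2) (by norm_num)).2 (by norm_num))
  have h6 : k ((1 / 2 : ℝ) • x + (1 / 2 : ℝ) • y) ≤ (1 / 2 : ℝ) • k x + (1 / 2 : ℝ) • k y :=
    hk.2 (interior_subset hx) hy (by norm_num) (by norm_num) (by norm_num)
  have h7 : ((1 - 1 / 2 : ℝ) • x + (1 / 2 : ℝ) • y) - x = (1 / 2 : ℝ) • (y - x) := by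
    module
  rw [h7, inner_smul_right] at h5
  norm_num at h5 h6
  linarith

theorem _root_.HasGradientAt.isSubgradientOn [CompleteSpace E] {k : E → ℝ} {D : Set E}
    (hk : ConvexOn ℝ D k) {x p : E} (hx : x ∈ D) (h : HasGradientAt k p x) :
    IsSubgradientOn k D x p := by
  intro y hy
  have h1 : HasDerivAt (fun s : ℝ => k (x + s • (y - x))) (inner ℝ p (y - x)) 0 := by
    have h2 : HasDerivAt (fun s : ℝ => x + s • (y - x)) (y - x) 0 := by
      simpa using ((hasDerivAt_id (0 : ℝ)).smul_const (y - x)).const_add x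
    have h3 : HasFDerivAt k (InnerProductSpace.toDual ℝ E p) (x + (0 : ℝ) • (y - x)) := by
      simpa using h.hasFDerivAt
    have h4 := h3.comp_hasDerivAt (0 : ℝ) h2
    rwa [InnerProductSpace.toDual_apply_apply] at h4
  have h4 := h1.tendsto_slope_zero_right
  have h5 : ∀ᶠ s in 𝓝[>] (0 : ℝ), s⁻¹ • (k (x + (0 + s) • (y - x)) - k (x + (0 : ℝ) • (y - x)))
      ≤ k y - k x := by
    filter_upwards [Ioo_mem_nhdsGT (zero_lt_one' ℝ)] with s hs
    have h6 : k ((1 - s) • x + s • y) ≤ (1 - s) • k x + s • k y :=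
      hk.2 hx hy (by linarith [hs.2]) hs.1.le (by ring)
    have h7 : (1 - s) • x + s • y = x + s • (y - x) := by module
    rw [h7] at h6
    simp only [zero_add, zero_smul, add_zero, smul_eq_mul] at h6 ⊢
    rw [inv_mul_le_iff₀ hs.1]
    linarith
  linarith [le_of_tendsto h4 h5]

/-- The function `k - ⟨p, ·⟩` has a local minimum at `x`, so its derivative vanishes there. This is
what makes the outer normal unique. -/
theorem IsSubgradientOn.eq_of_hasGradientAt [CompleteSpace E] {k : E → ℝ} {D : Set E} {x p q : E}
    (hp : IsSubgradientOn k D x p) (hD : D ∈ 𝓝 x) (hq : HasGradientAt k q x) : p = q := by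
  have h1 : IsLocalMin (fun y => k y - inner ℝ p y) x := by
    filter_upwards [hD] with y hy
    have := hp y hy
    rw [inner_sub_right] at this
    linarith
  have h2 : HasFDerivAt (fun y => k y - inner ℝ p y)
      (InnerProductSpace.toDual ℝ E q - InnerProductSpace.toDual ℝ E p) x :=
    hq.hasFDerivAt.sub (InnerProductSpace.toDual ℝ E p).hasFDerivAt
  have h3 := h1.hasFDerivAt_eq_zero h2
  rw [← map_sub, map_eq_zero_iff _ (InnerProductSpace.toDual ℝ E).injective] at h3
  exact (sub_eq_zero.1 h3).symm

/-- Convex functions are locally Lipschitz in the interior, so Rademacher's theorem applies locally;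
a countable subcover makes the statement global. -/
theorem _root_.ConvexOn.ae_differentiableAt [FiniteDimensional ℝ E] [MeasurableSpace E]
    [BorelSpace E] {k : E → ℝ} {D : Set E} (hk : ConvexOn ℝ D k) (μ : Measure E)
    [μ.IsAddHaarMeasure] :
    ∀ᵐ x ∂μ, x ∈ interior D → DifferentiableAt ℝ k x := by
  have hll := hk.locallyLipschitzOn_interior
  have h1 : ∀ x ∈ interior D, ∃ u ∈ 𝓝[interior D] x,
      ∀ᵐ y ∂μ, y ∈ u → DifferentiableAt ℝ k y := by
    intro x hx
    obtain ⟨C, u, hu, hC⟩ := hll hx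
    rw [isOpen_interior.nhdsWithin_eq hx] at hu ⊢
    refine ⟨interior u, interior_mem_nhds.2 hu, ?_⟩
    filter_upwards [(hC.mono interior_subset).ae_differentiableWithinAt_of_mem (μ := μ)]
      with y hy hyu
    exact (hy hyu).differentiableAt (isOpen_interior.mem_nhds hyu)
  obtain ⟨t, ht, hc, hcov⟩ : ∃ t : Set (Set E), (∀ u ∈ t, ∀ᵐ y ∂μ, y ∈ u →
      DifferentiableAt ℝ k y) ∧ t.Countable ∧ interior D ⊆ ⋃ u ∈ t, u := by
    choose! u hu hu2 using h1
    obtain ⟨s, hs, hsc, hcov⟩ := TopologicalSpace.countable_cover_nhdsWithin hu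
    refine ⟨u '' s, ?_, hsc.image _, by simpa using hcov⟩
    rintro _ ⟨x, hx, rfl⟩
    exact hu2 x (hs hx)
  filter_upwards [(ae_ball_iff hc).2 ht] with y hy hyD
  obtain ⟨u, hu, hyu⟩ := Set.mem_iUnion₂.1 (hcov hyD)
  exact hy u hu hyu

end Subgradient

/-! ### Hausdorff measure under maps close to the identity. -/

section Comparison

variable {E : Type*} [NormedAddCommGroup E] [MeasurableSpace E] [BorelSpace E]

theorem euclideanHausdorffMeasure_image_le {X Y : Type*} [EMetricSpace X] [MeasurableSpace X]
    [BorelSpace X] [EMetricSpace Y] [MeasurableSpace Y] [BorelSpace Y] {C : NNReal} {F : X → Y}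
    {S : Set X} (h : LipschitzOnWith C F S) (m : ℕ) :
    μHE[m] (F '' S) ≤ (C : ENNReal) ^ m * μHE[m] S := by
  have h1 := h.hausdorffMeasure_image_le (d := (m : ℝ)) (by positivity)
  rw [ENNReal.rpow_natCast] at h1
  rw [Measure.euclideanHausdorffMeasure_def, Measure.euclideanHausdorffMeasure_def,
    Measure.smul_apply, Measure.smul_apply, ENNReal.smul_def, ENNReal.smul_def, smul_eq_mul,
    smul_eq_mul, mul_left_comm]
  gcongr

/-- A map which is close to the identity at the level of differences changes Hausdorff measures by
a factor close to one. -/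
theorem euclideanHausdorffMeasure_image_near_id {F : E → E} {S : Set E} {η : ℝ} (h0 : 0 ≤ η)
    (h1 : η < 1) (h : ∀ z ∈ S, ∀ w ∈ S, ‖(F z - F w) - (z - w)‖ ≤ η * ‖z - w‖) (m : ℕ) :
    μHE[m] (F '' S) ≤ ENNReal.ofReal (1 + η) ^ m * μHE[m] S ∧
      ENNReal.ofReal (1 - η) ^ m * μHE[m] S ≤ μHE[m] (F '' S) ∧ Set.InjOn F S := by
  have hlow : ∀ z ∈ S, ∀ w ∈ S, (1 - η) * ‖z - w‖ ≤ ‖F z - F w‖ := fun z hz w hw => by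
    have h2 := h z hz w hw
    have h3 : ‖z - w‖ ≤ ‖F z - F w‖ + ‖(F z - F w) - (z - w)‖ := by
      have := norm_sub_le (F z - F w) ((F z - F w) - (z - w))
      rwa [sub_sub_cancel] at this
    linarith
  have hinj : Set.InjOn F S := fun z hz w hw hzw => by
    have := hlow z hz w hw
    rw [hzw, sub_self, norm_zero] at this
    have h4 : ‖z - w‖ ≤ 0 := by
      by_contra! h5
      have := mul_pos (sub_pos.2 h1) h5
      linarith
    exact sub_eq_zero.1 (norm_le_zero_iff.1 h4)
  have hinvS : Function.invFunOn F S '' (F '' S) = S := by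
    rw [hinj.invFunOn_image subset_rfl]
  refine ⟨?_, ?_, hinj⟩
  · have : LipschitzOnWith (Real.toNNReal (1 + η)) F S :=
      LipschitzOnWith.of_dist_le_mul fun z hz w hw => by
        rw [dist_eq_norm, dist_eq_norm, Real.coe_toNNReal _ (by linarith)]
        have h2 := h z hz w hw
        have h3 : ‖F z - F w‖ ≤ ‖z - w‖ + ‖(F z - F w) - (z - w)‖ := by
          have := norm_add_le (z - w) ((F z - F w) - (z - w))
          rwa [add_sub_cancel] at this
        linarith
    exact euclideanHausdorffMeasure_image_le this m
  -- The lower bound is the Lipschitz bound for the inverse map on the image.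
  · have : LipschitzOnWith (Real.toNNReal (1 - η)⁻¹) (Function.invFunOn F S) (F '' S) :=
      LipschitzOnWith.of_dist_le_mul fun z' hz' w' hw' => by
        obtain ⟨z, hz, rfl⟩ := hz'
        obtain ⟨w, hw, rfl⟩ := hw'
        rw [dist_eq_norm, dist_eq_norm, Real.coe_toNNReal _ (by rw [inv_nonneg]; linarith),
          hinj.leftInvOn_invFunOn hz, hinj.leftInvOn_invFunOn hw, ← div_eq_inv_mul,
          le_div_iff₀ (by linarith), mul_comm]
        exact hlow z hz w hw
    have h5 := euclideanHausdorffMeasure_image_le this m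
    rw [hinvS] at h5
    calc ENNReal.ofReal (1 - η) ^ m * μHE[m] S
        ≤ ENNReal.ofReal (1 - η) ^ m * (ENNReal.ofReal (1 - η)⁻¹ ^ m * μHE[m] (F '' S)) := by
          gcongr; exact h5
      _ = μHE[m] (F '' S) := by
          rw [← mul_assoc, ← mul_pow, ← ENNReal.ofReal_mul (by linarith),
            mul_inv_cancel₀ (by linarith), ENNReal.ofReal_one, one_pow, one_mul]

end Comparison

/-! ### Cones over subsets of a hyperplane. -/

section Flat

open scoped Pointwise

variable {E : Type*} [NormedAddCommGroup E] [InnerProductSpace ℝ E] [FiniteDimensional ℝ E]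
  [MeasurableSpace E] [BorelSpace E]

theorem measurableSet_cone {g : E → ℝ} (hg : Measurable g) {B : Set E} (hB : MeasurableSet B) :
    MeasurableSet {z | g z ∈ Set.Ioo (0 : ℝ) 1 ∧ (g z)⁻¹ • z ∈ B} :=
  (hg measurableSet_Ioo).inter ((hg.inv.smul measurable_id) hB)

omit [FiniteDimensional ℝ E] [MeasurableSpace E] [BorelSpace E] in
theorem smul_eq_cone {g : E → ℝ} (hg : ∀ s : ℝ, 0 ≤ s → ∀ x, g (s • x) = s * g x) {B : Set E}
    (hB : ∀ x ∈ B, g x = 1) :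
    Set.Ioo (0 : ℝ) 1 • B = {z | g z ∈ Set.Ioo (0 : ℝ) 1 ∧ (g z)⁻¹ • z ∈ B} := by
  ext z
  simp only [Set.mem_smul, Set.mem_ofPred_eq]
  constructor
  · rintro ⟨s, hs, x, hx, rfl⟩
    rw [hg s hs.1.le, hB x hx, mul_one]
    exact ⟨hs, by rwa [inv_smul_smul₀ hs.1.ne']⟩
  · rintro ⟨h1, h2⟩
    exact ⟨g z, h1, _, h2, smul_inv_smul₀ h1.1.ne' z⟩

/-- The volume of the cone with apex `0` over a subset of a hyperplane. -/
theorem volume_flat_cone {p : E} (hp : p ≠ 0) {B : Set E} (hB : MeasurableSet B)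
    (hBp : ∀ x ∈ B, inner ℝ p x = (1 : ℝ)) :
    (Module.finrank ℝ E : ENNReal) * volume (Set.Ioo (0 : ℝ) 1 • B) =
      ENNReal.ofReal ‖p‖⁻¹ * μHE[Module.finrank ℝ E - 1] B := by
  set d := Module.finrank ℝ E with hd
  have hd1 : 0 < d := by
    have : Nontrivial E := ⟨p, 0, hp⟩
    exact Module.finrank_pos
  have hpn : 0 < ‖p‖ := norm_pos_iff.2 hp
  have hcone := smul_eq_cone (g := fun z : E => inner ℝ p z)
    (fun s _ x => inner_smul_right p x s) hBp
  have hmeas : MeasurableSet (Set.Ioo (0 : ℝ) 1 • B) := by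
    rw [hcone]
    exact measurableSet_cone (by fun_prop) hB
  have h1 := EuclideanGeometry.euclideanHausdorffMeasure_eq_lintegral (0 : E) hp hmeas
  rw [InnerProductSpace.euclideanHausdorffMeasure_eq_volume, ← hd] at h1
  -- The slice orthogonal to `p` through `x • p` is `B` scaled by `x‖p‖²` when that factor lies in
  -- `(0, 1)`, and is empty otherwise. Integrating the scaling factor over `x` then gives `‖p‖⁻²/d`.
  have hslice : ∀ x : ℝ, (μHE[d - 1] ((Set.Ioo (0 : ℝ) 1 • B) ∩
      (AffineSubspace.mk' (x • p +ᵥ (0 : E)) (Submodule.span ℝ {p})ᗮ : Set E))) =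
      (Set.Ioo (0 : ℝ) (‖p‖ ^ 2)⁻¹).indicator
        (fun x => ENNReal.ofReal ((x * ‖p‖ ^ 2) ^ (d - 1)) * μHE[d - 1] B) x := by
    intro x
    have hmem : ∀ y : E, y ∈ (AffineSubspace.mk' (x • p +ᵥ (0 : E)) (Submodule.span ℝ {p})ᗮ : Set E)
        ↔ inner ℝ p y = x * ‖p‖ ^ 2 := fun y => by
      rw [SetLike.mem_coe, AffineSubspace.mem_mk', Submodule.mem_orthogonal_singleton_iff_inner_right]
      simp only [vadd_eq_add, add_zero, vsub_eq_sub, inner_sub_right, inner_smul_right,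
        real_inner_self_eq_norm_sq, sub_eq_zero]
    by_cases hx : x ∈ Set.Ioo (0 : ℝ) (‖p‖ ^ 2)⁻¹
    · rw [Set.indicator_of_mem hx]
      have hs0 : 0 < x * ‖p‖ ^ 2 := mul_pos hx.1 (by positivity)
      have hs1 : x * ‖p‖ ^ 2 < 1 := by
        have := hx.2
        rwa [lt_inv_comm₀ hx.1 (by positivity), ← one_div, lt_div_iff₀ hx.1, mul_comm] at this
      have hset : (Set.Ioo (0 : ℝ) 1 • B) ∩
          (AffineSubspace.mk' (x • p +ᵥ (0 : E)) (Submodule.span ℝ {p})ᗮ : Set E) =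
          (x * ‖p‖ ^ 2) • B := by
        ext z
        rw [Set.mem_inter_iff, hmem, hcone]
        simp only [Set.mem_ofPred_eq]
        constructor
        · rintro ⟨⟨-, h3⟩, h4⟩
          rw [h4] at h3
          exact ⟨_, h3, smul_inv_smul₀ hs0.ne' z⟩
        · rintro ⟨y, hy, rfl⟩
          simp only [inner_smul_right, hBp y hy, mul_one]
          exact ⟨⟨⟨hs0, hs1⟩, by rwa [inv_smul_smul₀ hs0.ne']⟩, trivial⟩
      rw [hset, Measure.euclideanHausdorffMeasure_smul₀ _ hs0.ne', ENNReal.smul_def, smul_eq_mul]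
      congr 1
      rw [ENNReal.ofReal, Real.toNNReal_pow hs0.le]
      congr 2
      rw [← Real.toNNReal_eq_nnnorm_of_nonneg hs0.le]
    · rw [Set.indicator_of_notMem hx]
      have : (Set.Ioo (0 : ℝ) 1 • B) ∩
          (AffineSubspace.mk' (x • p +ᵥ (0 : E)) (Submodule.span ℝ {p})ᗮ : Set E) = ∅ := by
        ext z
        rw [Set.mem_inter_iff, hmem, hcone]
        simp only [Set.mem_ofPred_eq, Set.mem_empty_iff_false, iff_false, not_and]
        rintro ⟨h3, -⟩ h4
        rw [h4] at h3
        refine hx ⟨pos_of_mul_pos_left h3.1 (by positivity), ?_⟩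
        rw [← one_div, lt_div_iff₀ (by positivity)]
        exact h3.2
      rw [this, measure_empty]
  rw [lintegral_congr hslice, lintegral_indicator measurableSet_Ioo,
    lintegral_mul_const _ (by fun_prop)] at h1
  have h2 : ∫⁻ x in Set.Ioo (0 : ℝ) (‖p‖ ^ 2)⁻¹, ENNReal.ofReal ((x * ‖p‖ ^ 2) ^ (d - 1)) =
      ENNReal.ofReal ((‖p‖ ^ 2)⁻¹ / d) := by
    rw [restrict_Ioo_eq_restrict_Ioc, ← ofReal_integral_eq_lintegral_ofReal, ← intervalIntegral.integral_of_le (by positivity)]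
    · congr 1
      rw [intervalIntegral.integral_comp_mul_right (fun x => x ^ (d - 1)) (by positivity), integral_pow,
        inv_mul_cancel₀ (by positivity)]
      have : ((d - 1 : ℕ) : ℝ) + 1 = d := by
        rw [Nat.cast_sub hd1]; simp
      rw [this, Nat.sub_add_cancel hd1]
      simp [hd1.ne', div_eq_mul_inv]
    · exact (Continuous.integrableOn_Ioc (by fun_prop))
    · filter_upwards [ae_restrict_mem measurableSet_Ioc] with x hx
      have := hx.1
      positivity
  rw [h1, h2, ← mul_assoc, ← mul_assoc]
  congr 1
  rw [← ofReal_norm, ← ENNReal.ofReal_natCast, ← ENNReal.ofReal_mul (by positivity), ← ENNReal.ofReal_mul (by positivity)]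
  congr 1
  have : (d : ℝ) ≠ 0 := by positivity
  field_simp

end Flat

/-! ### Subgradients of a gauge, and flattening along a direction. -/

section Gauge

variable {E : Type*} [NormedAddCommGroup E] [InnerProductSpace ℝ E] {K : Set E}

theorem convexOn_gauge (hK : Convex ℝ K) (h0 : K ∈ 𝓝 0) : ConvexOn ℝ Set.univ (gauge K) :=
  ⟨convex_univ, fun x _ y _ a b ha hb _ => by
    have := gauge_add_le hK (absorbent_nhds_zero h0) (a • x) (b • y)
    rwa [gauge_smul_of_nonneg ha, gauge_smul_of_nonneg hb] at this⟩

/-- Positive homogeneity: testing the subgradient inequality at `2x` and at `0` gives Euler's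
identity, and the rest is a rearrangement. -/
theorem isSubgradientOn_gauge_iff {x p : E} :
    IsSubgradientOn (gauge K) Set.univ x p ↔
      inner ℝ p x = gauge K x ∧ ∀ y, inner ℝ p y ≤ gauge K y := by
  constructor
  · intro h
    have h1 := h ((2 : ℝ) • x) trivial
    have h2 := h ((0 : ℝ) • x) trivial
    rw [gauge_smul_of_nonneg (by norm_num)] at h1 h2
    have e1 : (2 : ℝ) • x - x = x := by module
    have e2 : (0 : ℝ) • x - x = -x := by module
    rw [e1] at h1
    rw [e2, inner_neg_right] at h2
    simp only [smul_eq_mul, zero_mul] at h1 h2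
    have h3 : inner ℝ p x = gauge K x := by linarith
    refine ⟨h3, fun y => ?_⟩
    have := h y trivial
    rw [inner_sub_right] at this
    linarith
  · rintro ⟨h1, h2⟩ y -
    rw [inner_sub_right, h1]
    linarith [h2 y]

theorem IsSubgradientOn.gauge_smul {x p : E} (h : IsSubgradientOn (gauge K) Set.univ x p) {s : ℝ}
    (hs : 0 ≤ s) : IsSubgradientOn (gauge K) Set.univ (s • x) p := by
  rw [isSubgradientOn_gauge_iff] at h ⊢
  exact ⟨by rw [gauge_smul_of_nonneg hs, inner_smul_right, h.1, smul_eq_mul], h.2⟩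

/-- Projects along `p` so that the gauge of the image of `z` is read off by `⟪p, ·⟫`. -/
def flatten (K : Set E) (p z : E) : E := z + ((gauge K z - inner ℝ p z) / ‖p‖ ^ 2) • p

theorem inner_flatten {p : E} (hp : p ≠ 0) (z : E) : inner ℝ p (flatten K p z) = gauge K z := by
  have : ‖p‖ ≠ 0 := norm_ne_zero_iff.2 hp
  rw [flatten, inner_add_right, inner_smul_right, real_inner_self_eq_norm_sq]
  field_simp
  ring

theorem flatten_smul {p : E} {s : ℝ} (hs : 0 ≤ s) (z : E) :
    flatten K p (s • z) = s • flatten K p z := by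
  rw [flatten, flatten, gauge_smul_of_nonneg hs, inner_smul_right, smul_add, smul_smul]
  congr 2
  rw [smul_eq_mul]
  ring

/-- Flattening moves a point along `p` by an amount governed by `gauge K - ⟨p, ·⟩`. Subgradients
within `η‖p‖` of `p` at both end points bound the increments of this function from both sides. -/
theorem norm_flatten_sub_le {p : E} {η : ℝ} (hp : p ≠ 0) {S : Set E}
    (hS : ∀ z ∈ S, ∃ q, IsSubgradientOn (gauge K) Set.univ z q ∧ ‖q - p‖ ≤ η * ‖p‖) :
    ∀ z ∈ S, ∀ w ∈ S,
      ‖(flatten K p z - flatten K p w) - (z - w)‖ ≤ η * ‖z - w‖ := by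
  intro z hz w hw
  have hpn : 0 < ‖p‖ := norm_pos_iff.2 hp
  have key : ∀ z ∈ S, ∀ w ∈ S, gauge K z - gauge K w - inner ℝ p (z - w) ≤ η * ‖p‖ * ‖z - w‖ := by
    intro z hz w hw
    obtain ⟨q, hq, hqp⟩ := hS z hz
    have h1 := hq w trivial
    have h2 : inner ℝ (q - p) (z - w) ≤ η * ‖p‖ * ‖z - w‖ :=
      (real_inner_le_norm _ _).trans (by gcongr)
    rw [inner_sub_left] at h2
    rw [← neg_sub z w, inner_neg_right] at h1
    linarith
  have e : (flatten K p z - flatten K p w) - (z - w) =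
      ((gauge K z - gauge K w - inner ℝ p (z - w)) / ‖p‖ ^ 2) • p := by
    rw [flatten, flatten, inner_sub_right]
    module
  rw [e, norm_smul, norm_div, norm_pow, norm_norm, div_mul_eq_mul_div, div_le_iff₀ (by positivity)]
  have h3 : ‖gauge K z - gauge K w - inner ℝ p (z - w)‖ ≤ η * ‖p‖ * ‖z - w‖ := by
    rw [Real.norm_eq_abs, abs_le]
    refine ⟨?_, key z hz w hw⟩
    have := key w hw z hz
    rw [← neg_sub z w, inner_neg_right, norm_neg] at this
    linarith
  nlinarith

theorem _root_.DifferentiableAt.isSubgradientOn_gauge [CompleteSpace E] (hK : Convex ℝ K)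
    (h0 : K ∈ 𝓝 0) {x : E} (h : DifferentiableAt ℝ (gauge K) x) :
    IsSubgradientOn (gauge K) Set.univ x (gradient (gauge K) x) :=
  h.hasGradientAt.isSubgradientOn (convexOn_gauge hK h0) trivial

theorem differentiableAt_gauge_of_smul {x : E} {s : ℝ} (hs : 0 < s)
    (h : DifferentiableAt ℝ (gauge K) (s • x)) : DifferentiableAt ℝ (gauge K) x := by
  have h1 : DifferentiableAt ℝ (fun y => s⁻¹ * gauge K (s • y)) x := by
    refine (DifferentiableAt.comp x (g := gauge K) (f := fun y => s • y) h ?_).const_mul _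
    fun_prop
  refine h1.congr_of_eventuallyEq (Eventually.of_forall fun y => ?_)
  change gauge K y = s⁻¹ * gauge K (s • y)
  rw [gauge_smul_of_nonneg hs.le, smul_eq_mul, inv_mul_cancel_left₀ hs.ne']

end Gauge

/-! ### Comparing surface measure with cone volume on small boundary pieces. -/

section Piece

open scoped Pointwise

variable {E : Type*} [NormedAddCommGroup E] [InnerProductSpace ℝ E] [FiniteDimensional ℝ E]
  [MeasurableSpace E] [BorelSpace E] {K : Set E}

/-- On a piece of the boundary where the normals are nearly constant, the volume of the cone and
the surface measure are nearly proportional. -/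
theorem cone_piece (hK : Convex ℝ K) (h0 : K ∈ 𝓝 0) {p : E} {η : ℝ} (hp : p ≠ 0) (hη0 : 0 ≤ η)
    (hη1 : η < 1) {A : Set E} (hA : MeasurableSet A) (hA1 : ∀ x ∈ A, gauge K x = 1)
    (hAp : ∀ x ∈ A, ∃ q, IsSubgradientOn (gauge K) Set.univ x q ∧ ‖q - p‖ ≤ η * ‖p‖) :
    ENNReal.ofReal (1 - η) ^ Module.finrank ℝ E *
        (Module.finrank ℝ E * volume (Set.Ioo (0 : ℝ) 1 • A)) ≤
      ENNReal.ofReal (1 + η) ^ (Module.finrank ℝ E - 1) *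
        (ENNReal.ofReal ‖p‖⁻¹ * μHE[Module.finrank ℝ E - 1] A) ∧
    ENNReal.ofReal (1 - η) ^ (Module.finrank ℝ E - 1) *
        (ENNReal.ofReal ‖p‖⁻¹ * μHE[Module.finrank ℝ E - 1] A) ≤
      ENNReal.ofReal (1 + η) ^ Module.finrank ℝ E *
        (Module.finrank ℝ E * volume (Set.Ioo (0 : ℝ) 1 • A)) := by
  set d := Module.finrank ℝ E with hd
  obtain ⟨a1, a2, a3⟩ := euclideanHausdorffMeasure_image_near_id hη0 hη1
    (norm_flatten_sub_le hp hAp) (d - 1)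
  have hcone : ∀ z ∈ Set.Ioo (0 : ℝ) 1 • A,
      ∃ q, IsSubgradientOn (gauge K) Set.univ z q ∧ ‖q - p‖ ≤ η * ‖p‖ := by
    rintro _ ⟨s, hs, x, hx, rfl⟩
    obtain ⟨q, hq, hqp⟩ := hAp x hx
    exact ⟨q, hq.gauge_smul hs.1.le, hqp⟩
  obtain ⟨c1, c2, -⟩ := euclideanHausdorffMeasure_image_near_id hη0 hη1
    (norm_flatten_sub_le hp hcone) d
  rw [hd, InnerProductSpace.euclideanHausdorffMeasure_eq_volume, ← hd] at c1 c2
  -- Flattening commutes with dilations, so it carries the cone over `A` to the cone over a subset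
  -- of the hyperplane `⟨p, ·⟩ = 1`, where the exact volume formula applies.
  have himg : flatten K p '' (Set.Ioo (0 : ℝ) 1 • A) = Set.Ioo (0 : ℝ) 1 • (flatten K p '' A) := by
    ext z
    constructor
    · rintro ⟨_, ⟨s, hs, x, hx, rfl⟩, rfl⟩
      exact ⟨s, hs, _, ⟨x, hx, rfl⟩, (flatten_smul hs.1.le x).symm⟩
    · rintro ⟨s, hs, _, ⟨x, hx, rfl⟩, rfl⟩
      exact ⟨_, ⟨s, hs, x, hx, rfl⟩, flatten_smul hs.1.le x⟩
  have hflatc : Continuous (flatten K p) := by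
    have := continuous_gauge hK h0
    unfold flatten
    fun_prop
  have hmeas : MeasurableSet (flatten K p '' A) :=
    hA.image_of_continuousOn_injOn hflatc.continuousOn a3
  have hflat := volume_flat_cone hp hmeas (by
    rintro _ ⟨x, hx, rfl⟩
    rw [inner_flatten hp, hA1 x hx])
  rw [← hd] at hflat
  rw [himg] at c1 c2
  constructor
  · calc _ = (d : ENNReal) * (ENNReal.ofReal (1 - η) ^ d * volume (Set.Ioo (0 : ℝ) 1 • A)) := by ring
      _ ≤ (d : ENNReal) * volume (Set.Ioo (0 : ℝ) 1 • (flatten K p '' A)) := by gcongr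
      _ = ENNReal.ofReal ‖p‖⁻¹ * μHE[d - 1] (flatten K p '' A) := hflat
      _ ≤ ENNReal.ofReal ‖p‖⁻¹ * (ENNReal.ofReal (1 + η) ^ (d - 1) * μHE[d - 1] A) := by gcongr
      _ = _ := by ring
  · calc _ = ENNReal.ofReal ‖p‖⁻¹ * (ENNReal.ofReal (1 - η) ^ (d - 1) * μHE[d - 1] A) := by ring
      _ ≤ ENNReal.ofReal ‖p‖⁻¹ * μHE[d - 1] (flatten K p '' A) := by gcongr
      _ = (d : ENNReal) * volume (Set.Ioo (0 : ℝ) 1 • (flatten K p '' A)) := hflat.symm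
      _ ≤ (d : ENNReal) * (ENNReal.ofReal (1 + η) ^ d * volume (Set.Ioo (0 : ℝ) 1 • A)) := by gcongr
      _ = _ := by ring

omit [MeasurableSpace E] [BorelSpace E] in
/-- The points of the boundary with a subgradient of the gauge in a given closed ball. -/
theorem isClosed_setOf_subgradient_mem_closedBall (hK : Convex ℝ K) (h0 : K ∈ 𝓝 0) (p : E)
    (r : ℝ) :
    IsClosed {x | ∃ q, IsSubgradientOn (gauge K) Set.univ x q ∧ q ∈ Metric.closedBall p r} := by
  have hc := continuous_gauge hK h0
  have : CompactSpace (Metric.closedBall p r) :=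
    isCompact_iff_compactSpace.1 (isCompact_closedBall p r)
  have h1 : IsClosed {z : E × Metric.closedBall p r |
      IsSubgradientOn (gauge K) Set.univ z.1 z.2} := by
    have : {z : E × Metric.closedBall p r | IsSubgradientOn (gauge K) Set.univ z.1 z.2} =
        ⋂ y : E, {z | gauge K z.1 + inner ℝ (z.2 : E) (y - z.1) ≤ gauge K y} := by
      ext z
      simp [IsSubgradientOn]
    rw [this]
    exact isClosed_iInter fun y => isClosed_le (by fun_prop) (by fun_prop)
  have h2 := isClosedMap_fst_of_compactSpace (X := E) (Y := Metric.closedBall p r) _ h1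
  convert h2 using 1
  ext x
  simp [and_comm]

/-- The cone over the boundary points where the gauge is not differentiable is a null set. -/
theorem volume_cone_not_differentiableAt_gauge (hK : Convex ℝ K) (h0 : K ∈ 𝓝 0) :
    volume (Set.Ioo (0 : ℝ) 1 • {x | gauge K x = 1 ∧ ¬ DifferentiableAt ℝ (gauge K) x}) = 0 := by
  have hdiff : ∀ᵐ x, DifferentiableAt ℝ (gauge K) x := by
    obtain ⟨C, hC⟩ := hK.lipschitz_gauge h0
    exact hC.ae_differentiableAt
  refine measure_mono_null ?_ hdiff
  rintro _ ⟨s, hs, x, hx, rfl⟩ hsx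
  exact hx.2 (differentiableAt_gauge_of_smul hs.1 hsx)

open Classical in
/-- Almost every point of the boundary is a differentiability point of the gauge. -/
theorem euclideanHausdorffMeasure_not_differentiableAt_gauge (hK : Convex ℝ K) (h0 : K ∈ 𝓝 0) :
    μHE[Module.finrank ℝ E - 1] {x | gauge K x = 1 ∧ ¬ DifferentiableAt ℝ (gauge K) x} = 0 := by
  have hconenull := volume_cone_not_differentiableAt_gauge hK h0
  set N := {x | gauge K x = 1 ∧ ¬ DifferentiableAt ℝ (gauge K) x} with hN
  have hNm : MeasurableSet N :=
    ((continuous_gauge hK h0).measurable (measurableSet_singleton 1)).inter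
      (measurableSet_of_differentiableAt ℝ (gauge K)).compl
  set Q := TopologicalSpace.denseSeq E
  -- At a bad point there is no gradient to sort by, but some subgradient exists, and it lies within
  -- half the length of a member of a countable dense set. On each such piece the comparison with `η
  -- = 1/2` transfers nullity from the cone to the boundary.
  have hcov : N ⊆ ⋃ i : ℕ, if Q i = 0 then ∅ else N ∩ {x | ∃ q, IsSubgradientOn (gauge K) Set.univ x q ∧
      q ∈ Metric.closedBall (Q i) (1 / 2 * ‖Q i‖)} := by
    intro x hx
    obtain ⟨q, hq⟩ := exists_isSubgradientOn (convexOn_gauge hK h0) (x := x) (by simp)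
    have hq0 : 0 < ‖q‖ := by
      rw [norm_pos_iff]
      rintro rfl
      have := (isSubgradientOn_gauge_iff.1 hq).1
      rw [hx.1] at this
      simp at this
    obtain ⟨i, hi⟩ := (TopologicalSpace.denseRange_denseSeq E).exists_dist_lt q
      (ε := ‖q‖ / 3) (by positivity)
    rw [dist_eq_norm] at hi
    have h1 : ‖q‖ ≤ ‖Q i‖ + ‖q - Q i‖ := by
      simpa using norm_add_le (Q i) (q - Q i)
    have hQi : Q i ≠ 0 := by
      rw [← norm_pos_iff]; linarith
    refine Set.mem_iUnion.2 ⟨i, ?_⟩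
    rw [if_neg hQi]
    refine ⟨hx, q, hq, ?_⟩
    rw [Metric.mem_closedBall, dist_eq_norm]
    linarith
  refine measure_mono_null hcov (measure_iUnion_null fun i => ?_)
  split_ifs with hQi
  · simp
  set A := N ∩ {x | ∃ q, IsSubgradientOn (gauge K) Set.univ x q ∧
      q ∈ Metric.closedBall (Q i) (1 / 2 * ‖Q i‖)} with hAdef
  have hA : MeasurableSet A :=
    hNm.inter (isClosed_setOf_subgradient_mem_closedBall hK h0 _ _).measurableSet
  have h2 := (cone_piece hK h0 hQi (η := 1 / 2) (by norm_num) (by norm_num) hA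
    (fun x hx => hx.1.1) (fun x hx => by
      obtain ⟨q, hq, hqb⟩ := hx.2
      exact ⟨q, hq, by rwa [Metric.mem_closedBall, dist_eq_norm] at hqb⟩)).2
  rw [measure_mono_null (Set.smul_subset_smul_left (s := Set.Ioo (0 : ℝ) 1)
    (Set.inter_subset_left : A ⊆ N)) hconenull, mul_zero, mul_zero, nonpos_iff_eq_zero] at h2
  rw [mul_eq_zero, mul_eq_zero] at h2
  rcases h2 with h2 | h2 | h2
  · exact absurd h2 (pow_ne_zero _ (by norm_num))
  · rw [ENNReal.ofReal_eq_zero] at h2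
    have := norm_pos_iff.2 hQi
    exact absurd h2 (not_le.2 (by positivity))
  · exact h2

end Piece

/-! ### The cone measure and its density with respect to surface measure. -/

section ConeMeasure

open scoped Pointwise

theorem measure_le_mul_of_countable_cover {X : Type*} [MeasurableSpace X] {ν₁ ν₂ : Measure X}
    {c₁ c₂ : ENNReal} {A : Set X} (hA : MeasurableSet A) {D : ℕ → Set X}
    (hD : ∀ i, MeasurableSet (D i)) (hcov : A ⊆ ⋃ i, D i)
    (h : ∀ i, ∀ B, MeasurableSet B → B ⊆ A → B ⊆ D i → c₁ * ν₁ B ≤ c₂ * ν₂ B) :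
    c₁ * ν₁ A ≤ c₂ * ν₂ A := by
  have hdec : A = ⋃ i, A ∩ disjointed D i := by
    rw [← Set.inter_iUnion, iUnion_disjointed, Set.inter_eq_left.2 hcov]
  have hm : ∀ i, MeasurableSet (A ∩ disjointed D i) := fun i =>
    hA.inter (MeasurableSet.disjointed hD i)
  have hdisj : Pairwise (Function.onFun Disjoint fun i => A ∩ disjointed D i) :=
    fun i j hij => ((disjoint_disjointed D) hij).mono Set.inter_subset_right Set.inter_subset_right
  rw [hdec, measure_iUnion hdisj hm, measure_iUnion hdisj hm, ← ENNReal.tsum_mul_left,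
    ← ENNReal.tsum_mul_left]
  exact ENNReal.tsum_le_tsum fun i => h i _ (hm i) Set.inter_subset_left
    (Set.inter_subset_right.trans (disjointed_subset D i))

theorem le_of_forall_pow_mul_le {a b : ENNReal} {d : ℕ}
    (h : ∀ η ∈ Set.Ioo (0 : ℝ) 1, ENNReal.ofReal (1 - η) ^ d * a ≤ ENNReal.ofReal (1 + η) ^ d * b) :
    a ≤ b := by
  have h1 : ∀ (s : ℝ) (c : ENNReal), Tendsto (fun η : ℝ => ENNReal.ofReal (1 + s * η) ^ d * c)
      (𝓝[>] 0) (𝓝 c) := by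
    intro s c
    have h2 : Tendsto (fun η : ℝ => ENNReal.ofReal (1 + s * η) ^ d) (𝓝[>] 0) (𝓝 1) := by
      have h3 : Continuous (fun η : ℝ => ENNReal.ofReal (1 + s * η) ^ d) :=
        (ENNReal.continuous_pow d).comp (ENNReal.continuous_ofReal.comp (by fun_prop))
      have := h3.tendsto 0
      simp only [mul_zero, add_zero, ENNReal.ofReal_one, one_pow] at this
      exact this.mono_left nhdsWithin_le_nhds
    simpa using ENNReal.Tendsto.mul_const h2 (Or.inl one_ne_zero)
  have ha := h1 (-1) a
  have hb := h1 1 b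
  simp only [neg_one_mul, one_mul, ← sub_eq_add_neg] at ha hb
  refine le_of_tendsto_of_tendsto ha hb ?_
  filter_upwards [Ioo_mem_nhdsGT (zero_lt_one' ℝ)] with η hη using h η hη

variable {E : Type*} [NormedAddCommGroup E] [InnerProductSpace ℝ E] [FiniteDimensional ℝ E]
  [MeasurableSpace E] [BorelSpace E] {K : Set E}

/-- The cone measure on the boundary of a convex set, normalized by the dimension. -/
def coneMeasure (K : Set E) : Measure E :=
  (Module.finrank ℝ E • (volume : Measure E).restrict {z | gauge K z ∈ Set.Ioo (0 : ℝ) 1}).map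
    fun z => (gauge K z)⁻¹ • z

theorem coneMeasure_apply (hK : Convex ℝ K) (h0 : K ∈ 𝓝 0) {A : Set E} (hA : MeasurableSet A)
    (hA1 : ∀ x ∈ A, gauge K x = 1) :
    coneMeasure K A = Module.finrank ℝ E * volume (Set.Ioo (0 : ℝ) 1 • A) := by
  have hg := (continuous_gauge hK h0).measurable
  have hg2 : Measurable fun z => (gauge K z)⁻¹ • z := hg.inv.smul measurable_id
  rw [coneMeasure, Measure.map_apply hg2 hA, Measure.smul_apply, Measure.restrict_apply (hg2 hA),
    smul_eq_cone (g := gauge K) (fun s hs x => by rw [gauge_smul_of_nonneg hs, smul_eq_mul]) hA1,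
    nsmul_eq_mul, Set.inter_comm]
  rfl

theorem coneMeasure_gauge_ne_one (hK : Convex ℝ K) (h0 : K ∈ 𝓝 0) :
    coneMeasure K {x | gauge K x = 1}ᶜ = 0 := by
  have hg := (continuous_gauge hK h0).measurable
  have hg2 : Measurable fun z => (gauge K z)⁻¹ • z := hg.inv.smul measurable_id
  have hm : MeasurableSet {x | gauge K x = 1}ᶜ := (hg (measurableSet_singleton 1)).compl
  rw [coneMeasure, Measure.map_apply hg2 hm, Measure.smul_apply, Measure.restrict_apply (hg2 hm)]
  convert smul_zero _
  convert measure_empty (μ := (volume : Measure E))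
  ext z
  simp only [Set.mem_inter_iff, Set.mem_preimage, Set.mem_compl_iff, Set.mem_ofPred_eq,
    Set.mem_empty_iff_false, iff_false, not_and]
  intro h1 h2
  rw [gauge_smul_of_nonneg (inv_nonneg.2 h2.1.le), smul_eq_mul, inv_mul_cancel₀ h2.1.ne'] at h1
  exact h1 rfl

theorem measurable_gradient (g : E → ℝ) : Measurable (gradient g) := by
  unfold gradient
  exact (InnerProductSpace.toDual ℝ E).symm.continuous.measurable.comp (measurable_fderiv ℝ g)

omit [MeasurableSpace E] [BorelSpace E] in
theorem gradient_gauge_ne_zero (hK : Convex ℝ K) (h0 : K ∈ 𝓝 0) {x : E} (hx : gauge K x = 1)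
    (h : DifferentiableAt ℝ (gauge K) x) : gradient (gauge K) x ≠ 0 := by
  intro h1
  have := (isSubgradientOn_gauge_iff.1 (h.isSubgradientOn_gauge hK h0)).1
  rw [h1, hx] at this
  simp at this

/-- The cone measure has density `⟪x, ν⟫ = ‖∇g‖⁻¹` with respect to the surface measure. -/
theorem coneMeasure_eq (hK : Convex ℝ K) (h0 : K ∈ 𝓝 0) :
    coneMeasure K = ((μHE[Module.finrank ℝ E - 1]).restrict {x | gauge K x = 1}).withDensity
      fun x => ENNReal.ofReal ‖gradient (gauge K) x‖⁻¹ := by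
  set d := Module.finrank ℝ E with hd
  set N := gradient (gauge K) with hN
  set ν := ((μHE[d - 1]).restrict {x | gauge K x = 1}).withDensity
      fun x => ENNReal.ofReal ‖N x‖⁻¹ with hν
  have hg := (continuous_gauge hK h0).measurable
  have hNm : Measurable N := measurable_gradient _
  have hSm : MeasurableSet {x | gauge K x = 1} := hg (measurableSet_singleton 1)
  set S' := {x | gauge K x = 1 ∧ DifferentiableAt ℝ (gauge K) x} with hS'
  have hS'm : MeasurableSet S' := hSm.inter (measurableSet_of_differentiableAt ℝ (gauge K))
  have hBm : MeasurableSet {x | gauge K x = 1 ∧ ¬ DifferentiableAt ℝ (gauge K) x} :=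
    hSm.inter (measurableSet_of_differentiableAt ℝ (gauge K)).compl
  have hcompl : S'ᶜ ⊆ {x | gauge K x = 1}ᶜ ∪
      {x | gauge K x = 1 ∧ ¬ DifferentiableAt ℝ (gauge K) x} := by
    intro x hx
    by_cases h : gauge K x = 1
    · exact Or.inr ⟨h, fun h2 => hx ⟨h, h2⟩⟩
    · exact Or.inl h
  have hnull1 : coneMeasure K S'ᶜ = 0 := by
    refine measure_mono_null hcompl (measure_union_null (coneMeasure_gauge_ne_one hK h0) ?_)
    rw [coneMeasure_apply hK h0 hBm (fun x hx => hx.1), volume_cone_not_differentiableAt_gauge hK h0,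
      mul_zero]
  have hnull2 : ν S'ᶜ = 0 := by
    refine measure_mono_null hcompl (measure_union_null ?_ ?_)
    · refine withDensity_absolutelyContinuous _ _ ?_
      rw [Measure.restrict_apply hSm.compl, Set.compl_inter_self, measure_empty]
    · refine withDensity_absolutelyContinuous _ _ ?_
      rw [Measure.restrict_apply hBm]
      exact measure_mono_null Set.inter_subset_left
        (euclideanHausdorffMeasure_not_differentiableAt_gauge hK h0)
  have main : ∀ A ⊆ S', MeasurableSet A → ∀ η ∈ Set.Ioo (0 : ℝ) 1,
      ENNReal.ofReal (1 - η) ^ d * coneMeasure K A ≤ ENNReal.ofReal (1 + η) ^ d * ν A ∧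
      ENNReal.ofReal (1 - η) ^ d * ν A ≤ ENNReal.ofReal (1 + η) ^ d * coneMeasure K A := by
    intro A hAS hA η hη
    set Q := TopologicalSpace.denseSeq E
    -- Countably many pieces, on each of which the gradient of the gauge is within relative error
    -- `η` of a fixed vector.
    set D : ℕ → Set E := fun i => {x | Q i ≠ 0 ∧ ‖N x - Q i‖ ≤ η * ‖Q i‖} with hD
    have hDm : ∀ i, MeasurableSet (D i) := fun i =>
      (MeasurableSet.const _).inter (measurableSet_le (hNm.sub_const _).norm measurable_const)
    have hcov : A ⊆ ⋃ i, D i := by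
      intro x hx
      have hq0 : 0 < ‖N x‖ :=
        norm_pos_iff.2 (gradient_gauge_ne_zero hK h0 (hAS hx).1 (hAS hx).2)
      obtain ⟨i, hi⟩ := (TopologicalSpace.denseRange_denseSeq E).exists_dist_lt (N x)
        (ε := η * ‖N x‖ / 2) (by have := hη.1; positivity)
      rw [dist_eq_norm] at hi
      have h1 : ‖N x‖ ≤ ‖Q i‖ + ‖N x - Q i‖ := by
        simpa using norm_add_le (Q i) (N x - Q i)
      have h2 : ‖N x‖ / 2 ≤ ‖Q i‖ := by nlinarith [hη.1, hη.2]
      refine Set.mem_iUnion.2 ⟨i, ?_, ?_⟩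
      · rw [← norm_pos_iff]; linarith
      · nlinarith [hη.1]
    have hpiece : ∀ i B, MeasurableSet B → B ⊆ A → B ⊆ D i →
        ENNReal.ofReal (1 - η) ^ d * coneMeasure K B ≤ ENNReal.ofReal (1 + η) ^ d * ν B ∧
        ENNReal.ofReal (1 - η) ^ d * ν B ≤ ENNReal.ofReal (1 + η) ^ d * coneMeasure K B := by
      intro i B hB hBA hBD
      rcases B.eq_empty_or_nonempty with rfl | ⟨x₀, hx₀⟩
      · simp
      have hQi : Q i ≠ 0 := (hBD hx₀).1
      have hQn : 0 < ‖Q i‖ := norm_pos_iff.2 hQi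
      have : Nontrivial E := ⟨Q i, 0, hQi⟩
      have hd1 : d - 1 + 1 = d := Nat.sub_add_cancel Module.finrank_pos
      obtain ⟨h1, h2⟩ := cone_piece hK h0 hQi hη.1.le hη.2 hB (fun x hx => (hAS (hBA hx)).1)
        (fun x hx => ⟨N x, (hAS (hBA hx)).2.isSubgradientOn_gauge hK h0, (hBD hx).2⟩)
      rw [← hd, ← coneMeasure_apply hK h0 hB (fun x hx => (hAS (hBA hx)).1)] at h1 h2
      have hνB : ν B = ∫⁻ x in B, ENNReal.ofReal ‖N x‖⁻¹ ∂μHE[d - 1] := by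
        rw [hν, withDensity_apply _ hB, Measure.restrict_restrict hB,
          Set.inter_eq_left.2 (show B ⊆ {x | gauge K x = 1} from fun x hx => (hAS (hBA hx)).1)]
      have hNx : ∀ x ∈ B, 0 < ‖N x‖ ∧ (1 - η) * ‖Q i‖ ≤ ‖N x‖ ∧ ‖N x‖ ≤ (1 + η) * ‖Q i‖ := by
        intro x hx
        have e1 := (hBD hx).2
        have e2 : ‖N x‖ ≤ ‖Q i‖ + ‖N x - Q i‖ := by simpa using norm_add_le (Q i) (N x - Q i)
        have e3 : ‖Q i‖ ≤ ‖N x‖ + ‖N x - Q i‖ := by simpa using norm_sub_le (N x) (N x - Q i)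
        refine ⟨?_, by linarith, by linarith⟩
        nlinarith [hη.2]
      -- Replacing the constant `‖Q i‖⁻¹` by the density costs one factor `1 ± η`, which raises the
      -- exponent `d - 1` in the piecewise comparison to `d`.
      have h3 : ENNReal.ofReal ‖Q i‖⁻¹ * μHE[d - 1] B ≤ ENNReal.ofReal (1 + η) * ν B := by
        rw [hνB, ← setLIntegral_const, ← lintegral_const_mul _ (by fun_prop)]
        refine setLIntegral_mono' hB fun x hx => ?_
        obtain ⟨n1, n2, n3⟩ := hNx x hx
        rw [← ENNReal.ofReal_mul (by linarith [hη.1])]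
        refine ENNReal.ofReal_le_ofReal ?_
        rw [← div_eq_mul_inv, le_div_iff₀ n1, inv_mul_le_iff₀ hQn]
        linarith
      have h4 : ENNReal.ofReal (1 - η) * ν B ≤ ENNReal.ofReal ‖Q i‖⁻¹ * μHE[d - 1] B := by
        rw [hνB, ← setLIntegral_const, ← lintegral_const_mul _ (by fun_prop)]
        refine setLIntegral_mono' hB fun x hx => ?_
        obtain ⟨n1, n2, n3⟩ := hNx x hx
        rw [← ENNReal.ofReal_mul (by linarith [hη.2])]
        refine ENNReal.ofReal_le_ofReal ?_
        rw [← div_eq_mul_inv, div_le_iff₀ n1, ← div_eq_inv_mul, le_div_iff₀ hQn]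
        linarith
      constructor
      · refine h1.trans ?_
        rw [← hd1, pow_succ, mul_assoc, hd1]
        gcongr
      · refine le_trans ?_ h2
        rw [← hd1, pow_succ, mul_assoc, hd1]
        gcongr
    exact ⟨measure_le_mul_of_countable_cover hA hDm hcov fun i B h1 h2 h3 => (hpiece i B h1 h2 h3).1,
      measure_le_mul_of_countable_cover hA hDm hcov fun i B h1 h2 h3 => (hpiece i B h1 h2 h3).2⟩
  ext A hA
  rw [← measure_inter_add_sdiff A hS'm, ← measure_inter_add_sdiff (μ := ν) A hS'm,
    measure_mono_null (show A \ S' ⊆ S'ᶜ from fun x hx => hx.2) hnull1,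
    measure_mono_null (show A \ S' ⊆ S'ᶜ from fun x hx => hx.2) hnull2, add_zero, add_zero]
  have h := main (A ∩ S') Set.inter_subset_right (hA.inter hS'm)
  exact le_antisymm (le_of_forall_pow_mul_le fun η hη => (h η hη).1)
    (le_of_forall_pow_mul_le fun η hη => (h η hη).2)

end ConeMeasure

/-! ### Polar coordinates and the cone measure on the sphere. -/

section Polar

variable {E : Type*} [NormedAddCommGroup E] [InnerProductSpace ℝ E] [FiniteDimensional ℝ E]
  [MeasurableSpace E] [BorelSpace E] {K : Set E}

theorem lintegral_polar [Nontrivial E] {F : E → ENNReal} (hF : Measurable F) :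
    ∫⁻ x, F x = ∫⁻ θ, (∫⁻ r in Set.Ioi (0 : ℝ), ENNReal.ofReal (r ^ (Module.finrank ℝ E - 1)) *
      F (r • (θ : E))) ∂(volume : Measure E).toSphere := by
  set d := Module.finrank ℝ E with hd
  have h1 : ∫⁻ x, F x = ∫⁻ x : ({0}ᶜ : Set E), F x ∂((volume : Measure E).comap (↑)) := by
    rw [lintegral_subtype_comap (measurableSet_singleton _).compl, restrict_compl_singleton]
  have h2 := (volume : Measure E).measurePreserving_homeomorphUnitSphereProd
  have h3 : ∫⁻ x : ({0}ᶜ : Set E), F x ∂((volume : Measure E).comap (↑)) =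
      ∫⁻ z : Metric.sphere (0 : E) 1 × Set.Ioi (0 : ℝ), F ((z.2 : ℝ) • (z.1 : E))
        ∂((volume : Measure E).toSphere.prod (Measure.volumeIoiPow (d - 1))) := by
    rw [← h2.map_eq, (Homeomorph.measurableEmbedding _).lintegral_map]
    refine lintegral_congr fun x => ?_
    congr 1
    have hx : ‖(x : E)‖ ≠ 0 := norm_ne_zero_iff.2 x.2
    simp [smul_smul, hx]
  have hm : Measurable fun z : Metric.sphere (0 : E) 1 × Set.Ioi (0 : ℝ) =>
      F ((z.2 : ℝ) • (z.1 : E)) := hF.comp (by fun_prop)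
  rw [h1, h3, lintegral_prod _ hm.aemeasurable]
  refine lintegral_congr fun θ => ?_
  have hm2 : Measurable fun r : Set.Ioi (0 : ℝ) => F ((r : ℝ) • (θ : E)) := hF.comp (by fun_prop)
  rw [Measure.volumeIoiPow, lintegral_withDensity_eq_lintegral_mul _ (by fun_prop) hm2]
  exact lintegral_subtype_comap (μ := volume) measurableSet_Ioi
    (fun r : ℝ => ENNReal.ofReal (r ^ (d - 1)) * F (r • (θ : E)))

/-- By polar coordinates almost every ray meets the exceptional set in a null set, so it contains a
point `r • θ` with the property, and the hypothesis brings the property back to `θ`. -/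
theorem ae_toSphere_of_ae [Nontrivial E] {P : E → Prop} (h : ∀ᵐ x : E, P x)
    (hP : ∀ (x : E) (s : ℝ), 0 < s → P (s • x) → P x) :
    ∀ᵐ θ : Metric.sphere (0 : E) 1 ∂(volume : Measure E).toSphere, P θ := by
  set Z := toMeasurable (volume : Measure E) {x | ¬ P x} with hZ
  have hZm : MeasurableSet Z := measurableSet_toMeasurable _ _
  have hZ0 : volume Z = 0 := by rw [hZ, measure_toMeasurable]; exact h
  have h1 := lintegral_polar ((measurable_one (α := ENNReal)).indicator hZm)
  have hmeas : Measurable fun θ : Metric.sphere (0 : E) 1 => ∫⁻ r in Set.Ioi (0 : ℝ),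
      ENNReal.ofReal (r ^ (Module.finrank ℝ E - 1)) *
        Z.indicator (1 : E → ENNReal) (r • (θ : E)) := by
    refine Measurable.lintegral_prod_right' (f := fun z : Metric.sphere (0 : E) 1 × ℝ =>
      ENNReal.ofReal (z.2 ^ (Module.finrank ℝ E - 1)) *
        Z.indicator (1 : E → ENNReal) (z.2 • (z.1 : E))) ?_
    exact Measurable.mul (by fun_prop) ((measurable_one.indicator hZm).comp (by fun_prop))
  rw [lintegral_indicator_one hZm, hZ0, eq_comm, lintegral_eq_zero_iff hmeas] at h1
  filter_upwards [h1] with θ hθ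
  have hmeas2 : Measurable fun r : ℝ => ENNReal.ofReal (r ^ (Module.finrank ℝ E - 1)) *
      Z.indicator (1 : E → ENNReal) (r • (θ : E)) :=
    Measurable.mul (by fun_prop) ((measurable_one.indicator hZm).comp (by fun_prop))
  rw [Pi.zero_apply, lintegral_eq_zero_iff hmeas2] at hθ
  have h2 := hθ.and (ae_restrict_mem measurableSet_Ioi)
  have h3 : (ae (volume.restrict (Set.Ioi (0 : ℝ)))).NeBot := by
    rw [ae_neBot, Ne, Measure.restrict_eq_zero]
    simp
  obtain ⟨r, hr, hr0⟩ := h2.exists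
  have hr0' : 0 < r := hr0
  refine hP _ r hr0' ?_
  by_contra hPr
  have : r • (θ : E) ∈ Z := subset_toMeasurable _ _ hPr
  beta_reduce at hr
  rw [Set.indicator_of_mem this] at hr
  have hpos : 0 < r ^ (Module.finrank ℝ E - 1) := by positivity
  simp at hr
  linarith

theorem coneMeasure_eq_map_toSphere [Nontrivial E] (hK : Convex ℝ K) (h0 : K ∈ 𝓝 0) :
    coneMeasure K = ((volume : Measure E).toSphere.withDensity
      fun θ : Metric.sphere (0 : E) 1 => ENNReal.ofReal ((gauge K (θ : E))⁻¹ ^ Module.finrank ℝ E)).map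
        fun θ : Metric.sphere (0 : E) 1 => (gauge K (θ : E))⁻¹ • (θ : E) := by
  set d := Module.finrank ℝ E with hd
  have hd1 : 0 < d := Module.finrank_pos
  have hg := (continuous_gauge hK h0).measurable
  have hg2 : Measurable fun z => (gauge K z)⁻¹ • z := hg.inv.smul measurable_id
  have hg3 : Measurable fun θ : Metric.sphere (0 : E) 1 => (gauge K (θ : E))⁻¹ • (θ : E) :=
    hg2.comp measurable_subtype_coe
  ext A hA
  rw [coneMeasure, Measure.map_apply hg2 hA, Measure.map_apply hg3 hA, Measure.smul_apply,
    Measure.restrict_apply (hg2 hA), withDensity_apply _ (hg3 hA)]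
  set S := (fun z => (gauge K z)⁻¹ • z) ⁻¹' A ∩ {z | gauge K z ∈ Set.Ioo (0 : ℝ) 1} with hS
  have hSm : MeasurableSet S := (hg2 hA).inter (hg measurableSet_Ioo)
  rw [← lintegral_indicator_one hSm, lintegral_polar (measurable_one.indicator hSm),
    ← lintegral_indicator (hg3 hA), nsmul_eq_mul, ← lintegral_const_mul' _ _ (by simp)]
  refine lintegral_congr fun θ => ?_
  have hθ0 := gauge_nonneg (s := K) (θ : E)
  set c := gauge K (θ : E) with hc
  have hmem : ∀ r ∈ Set.Ioi (0 : ℝ), (r • (θ : E) ∈ S ↔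
      ((c⁻¹ • (θ : E) ∈ A ∧ 0 < c) ∧ r ∈ Set.Ioo 0 c⁻¹)) := by
    intro r hr
    have hr' : 0 < r := hr
    simp only [hS, Set.mem_inter_iff, Set.mem_preimage, Set.mem_ofPred_eq,
      gauge_smul_of_nonneg hr'.le, smul_eq_mul, ← hc, Set.mem_Ioo, hr', true_and]
    have e1 : 0 < r * c ↔ 0 < c := by simp [hr']
    rw [e1]
    by_cases hc0 : 0 < c
    · have e2 : (r * c)⁻¹ • r • (θ : E) = c⁻¹ • (θ : E) := by
        rw [smul_smul]; congr 1; field_simp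
      rw [e2, ← one_div, lt_div_iff₀ hc0]
      tauto
    · simp [hc0]
  by_cases hθ : c⁻¹ • (θ : E) ∈ A ∧ 0 < c
  · have e1 : ∫⁻ r in Set.Ioi (0 : ℝ), ENNReal.ofReal (r ^ (d - 1)) *
        S.indicator 1 (r • (θ : E)) = ∫⁻ r in Set.Ioo 0 c⁻¹, ENNReal.ofReal (r ^ (d - 1)) := by
      rw [← lintegral_indicator measurableSet_Ioi, ← lintegral_indicator measurableSet_Ioo]
      refine lintegral_congr fun r => ?_
      by_cases hr : r ∈ Set.Ioi (0 : ℝ)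
      · rw [Set.indicator_of_mem hr]
        by_cases hr2 : r ∈ Set.Ioo 0 c⁻¹
        · rw [Set.indicator_of_mem hr2, Set.indicator_of_mem ((hmem r hr).2 ⟨hθ, hr2⟩)]
          simp
        · rw [Set.indicator_of_notMem hr2, Set.indicator_of_notMem
            (fun h => hr2 ((hmem r hr).1 h).2), mul_zero]
      · rw [Set.indicator_of_notMem hr, Set.indicator_of_notMem (fun h => hr h.1)]
    have hcinv : 0 < c⁻¹ := inv_pos.2 hθ.2
    have e2 : ∫⁻ r in Set.Ioo 0 c⁻¹, ENNReal.ofReal (r ^ (d - 1)) =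
        ENNReal.ofReal (c⁻¹ ^ d / d) := by
      rw [restrict_Ioo_eq_restrict_Ioc, ← ofReal_integral_eq_lintegral_ofReal,
        ← intervalIntegral.integral_of_le hcinv.le]
      · congr 1
        rw [integral_pow, Nat.sub_add_cancel hd1, Nat.cast_sub hd1]
        simp [hd1.ne']
      · exact (Continuous.integrableOn_Ioc (by fun_prop))
      · filter_upwards [ae_restrict_mem measurableSet_Ioc] with x hx
        exact pow_nonneg hx.1.le _
    rw [e1, e2, Set.indicator_of_mem (show θ ∈ _ from hθ.1), ← ENNReal.ofReal_natCast,
      ← ENNReal.ofReal_mul (by positivity)]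
    congr 1
    have : (d : ℝ) ≠ 0 := by positivity
    field_simp
    rfl
  · have e1 : ∫⁻ r in Set.Ioi (0 : ℝ), ENNReal.ofReal (r ^ (d - 1)) *
        S.indicator 1 (r • (θ : E)) = 0 := by
      rw [setLIntegral_congr_fun (g := 0) measurableSet_Ioi fun r hr => by
        rw [Set.indicator_of_notMem (fun h => hθ ((hmem r hr).1 h).1), mul_zero]; rfl]
      simp
    rw [e1, mul_zero]
    symm
    rw [Set.indicator_apply_eq_zero]
    -- If the gauge vanishes at `θ`, the ray misses the cone, and the density is `0` as well because
    -- `0⁻¹ = 0` and the dimension is positive.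
    intro h
    have : c = 0 := by
      by_contra hne
      exact hθ ⟨h, lt_of_le_of_ne hθ0 (Ne.symm hne)⟩
    rw [← hc, this]
    simp [hd1.ne']

end Polar

/-! ### Multiplicative estimates for the generator. -/

section Generator

variable {α : ℝ}

/-- The generator as a function of a real variable. -/
def realGen (α s : ℝ) : ℝ := (1 - α * s) ^ (1 / α)

theorem generator_coe (α s : ℝ) : generator α (s : EReal) = realGen α s := by
  simp [generator, realGen]

theorem generator_top (α : ℝ) : generator α ⊤ = 0 := by
  simp [generator]

theorem one_le_of_nonneg (hα : α < 0) {s : ℝ} (hs : 0 ≤ s) : 1 ≤ 1 - α * s := by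
  nlinarith

theorem realGen_pos {s : ℝ} (hs : 0 < 1 - α * s) : 0 < realGen α s := Real.rpow_pos_of_pos hs _

theorem realGen_anti (hα : α < 0) {s₁ s₂ : ℝ} (h : s₁ ≤ s₂) (h1 : 0 < 1 - α * s₁) :
    realGen α s₂ ≤ realGen α s₁ :=
  Real.rpow_le_rpow_of_nonpos h1 (by nlinarith) (one_div_neg.2 hα).le

theorem realGen_le_one (hα : α < 0) {s : ℝ} (hs : 0 ≤ s) : realGen α s ≤ 1 := by
  have := realGen_anti hα hs (by simp)
  simpa [realGen] using this

/-- The product `(1 - αs)(1 + ατ)` falls short of `1 - α(s - τ)` by `α²sτ ≥ 0`, and the exponent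
`1/α` is negative. The additive shift thus costs a factor independent of `s`. -/
theorem realGen_sub_le (hα : α < 0) {s τ : ℝ} (hs : 0 ≤ s) (hτ : 0 ≤ τ) (h : 0 < 1 + α * τ) :
    realGen α (s - τ) ≤ (1 + α * τ) ^ (1 / α) * realGen α s := by
  have h1 := one_le_of_nonneg hα hs
  rw [realGen, realGen, ← Real.mul_rpow h.le (by linarith)]
  refine Real.rpow_le_rpow_of_nonpos (by positivity) ?_ (one_div_neg.2 hα).le
  nlinarith [mul_nonneg (mul_nonneg_of_nonpos_of_nonpos hα.le hα.le) (mul_nonneg hs hτ)]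

/-- Here `(1 - αs)(1 - ατ) ≥ 1 - α(s + τ)`, and `(1 - ατ)^(1/α) ≥ e^(-τ) ≥ 1 - τ`. -/
theorem le_realGen_add (hα : α < 0) {s τ : ℝ} (hs : 0 ≤ s) (hτ : 0 ≤ τ) :
    (1 - τ) * realGen α s ≤ realGen α (s + τ) := by
  have h1 := one_le_of_nonneg hα hs
  have h2 := one_le_of_nonneg hα hτ
  have h3 : (1 - α * τ) ^ (1 / α) * realGen α s ≤ realGen α (s + τ) := by
    rw [realGen, realGen, ← Real.mul_rpow (by linarith) (by linarith)]
    refine Real.rpow_le_rpow_of_nonpos ?_ ?_ (one_div_neg.2 hα).le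
    · have := one_le_of_nonneg hα (add_nonneg hs hτ)
      linarith
    · nlinarith [mul_nonneg (mul_nonneg_of_nonpos_of_nonpos hα.le hα.le) (mul_nonneg hs hτ)]
  refine le_trans ?_ h3
  gcongr
  · exact (realGen_pos (by linarith)).le
  · have h4 : 1 - α * τ ≤ Real.exp (-(α * τ)) := by
      have := Real.add_one_le_exp (-(α * τ))
      linarith
    calc 1 - τ ≤ Real.exp (-τ) := by
          have := Real.add_one_le_exp (-τ)
          linarith
      _ = Real.exp (-(α * τ)) ^ (1 / α) := by
          rw [← Real.exp_mul]
          congr 1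
          have := hα.ne
          field_simp
      _ ≤ _ := Real.rpow_le_rpow_of_nonpos (by linarith) h4 (one_div_neg.2 hα).le

theorem realGen_rpow (hα : α < 0) {s : ℝ} (hs : 0 ≤ 1 - α * s) :
    realGen α s ^ (1 - α) = (1 - α * s) ^ (1 / α - 1) := by
  rw [realGen, ← Real.rpow_mul hs]
  congr 1
  have := hα.ne
  field_simp

theorem hasDerivAt_realGen (hα : α < 0) {s : ℝ} (hs : 0 < 1 - α * s) :
    HasDerivAt (realGen α) (-(realGen α s ^ (1 - α))) s := by
  have h1 : HasDerivAt (fun s => 1 - α * s) (-α) s := by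
    simpa using ((hasDerivAt_id s).const_mul α).const_sub 1
  have h2 := h1.rpow_const (p := 1 / α) (Or.inl hs.ne')
  rw [realGen_rpow hα hs.le]
  have h3 : -α * (1 / α) = -1 := by
    have := hα.ne
    field_simp
  rw [h3, neg_one_mul] at h2
  exact h2

theorem generator_le_of_le (hα : α < 0) {s : ℝ} {e : EReal} (h : (s : EReal) ≤ e)
    (h1 : 0 < 1 - α * s) : generator α e ≤ realGen α s := by
  induction e with
  | bot => simp at h
  | top => rw [generator_top]; exact (realGen_pos h1).le
  | coe r => rw [generator_coe]; exact realGen_anti hα (EReal.coe_le_coe_iff.1 h) h1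

theorem le_generator_of_le (hα : α < 0) {s : ℝ} {e : EReal} (h : e ≤ (s : EReal))
    (h1 : ((1 / α : ℝ) : EReal) < e) : realGen α s ≤ generator α e := by
  induction e with
  | bot => simp at h1
  | top => simp at h
  | coe r =>
    rw [generator_coe]
    refine realGen_anti hα (EReal.coe_le_coe_iff.1 h) ?_
    have h2 := EReal.coe_lt_coe_iff.1 h1
    rw [div_lt_iff_of_neg hα] at h2
    linarith

theorem generator_nonneg (hα : α < 0) {e : EReal} (h1 : ((1 / α : ℝ) : EReal) < e) :
    0 ≤ generator α e := by
  induction e with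
  | bot => simp at h1
  | top => rw [generator_top]
  | coe r =>
    rw [generator_coe]
    have h2 := EReal.coe_lt_coe_iff.1 h1
    rw [div_lt_iff_of_neg hα] at h2
    exact (realGen_pos (by linarith)).le

theorem measurable_generator (α : ℝ) : Measurable (generator α) := by
  unfold generator
  refine Measurable.ite (measurableSet_singleton _) measurable_const ?_
  have := measurable_ereal_toReal
  fun_prop

theorem continuousAt_realGen (hα : α < 0) {s : ℝ} (hs : 0 < 1 - α * s) :
    ContinuousAt (realGen α) s := (hasDerivAt_realGen hα hs).continuousAt

theorem tendsto_realGen_atTop (hα : α < 0) : Tendsto (realGen α) atTop (𝓝 0) := by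
  have h1 : Tendsto (fun s => 1 - α * s) atTop atTop := by
    have := (tendsto_id (α := ℝ) (x := atTop)).const_mul_atTop (neg_pos.2 hα)
    refine (tendsto_atTop_add_const_left _ 1 this).congr fun s => ?_
    simp only [id]; ring
  have h2 := (tendsto_rpow_neg_atTop (y := -(1 / α)) (by rw [neg_pos]; exact one_div_neg.2 hα)).comp h1
  refine h2.congr fun s => ?_
  simp [realGen]

/-- The composition of the generator with a nonnegative lower semicontinuous function is upper
semicontinuous. -/
theorem upperSemicontinuousAt_generator (hα : α < 0) {X : Type*} [TopologicalSpace X]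
    {φ : X → EReal} {x : X} (hφ : LowerSemicontinuousAt φ x) (h0 : 0 ≤ φ x) :
    UpperSemicontinuousAt (fun y => generator α (φ y)) x := by
  intro c hc
  change generator α (φ x) < c at hc
  rcases eq_or_ne (φ x) ⊤ with htop | htop
  · rw [htop, generator_top] at hc
    obtain ⟨M, hM, hM0⟩ := (((tendsto_realGen_atTop hα).eventually (gt_mem_nhds hc)).and
      (eventually_ge_atTop 0)).exists
    filter_upwards [hφ M (show (M : EReal) < φ x by rw [htop]; exact EReal.coe_lt_top M)] with y hy
    exact (generator_le_of_le hα hy.le (by linarith [one_le_of_nonneg hα hM0])).trans_lt hM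
  · lift φ x to ℝ using ⟨htop, fun h => by rw [h] at h0; simp at h0⟩ with r hr
    have hr0 : 0 ≤ r := by exact_mod_cast h0
    rw [generator_coe] at hc
    have h1 : 0 < 1 - α * r := by linarith [one_le_of_nonneg hα hr0]
    have h2 : ∀ᶠ s in 𝓝 r, 0 < 1 - α * s :=
      (by fun_prop : ContinuousAt (fun s => 1 - α * s) r).eventually (lt_mem_nhds h1)
    obtain ⟨s, hs, hsr⟩ := ((((continuousAt_realGen hα h1).eventually (gt_mem_nhds hc)).and
      h2).filter_mono (nhdsWithin_le_nhds (s := Set.Iio r)) |>.and self_mem_nhdsWithin).exists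
    have hsr' : s < r := hsr
    filter_upwards [hφ s (show (s : EReal) < φ x by rw [← hr]; exact_mod_cast hsr')] with y hy
    exact (generator_le_of_le hα hy.le hs.2).trans_lt hs.1

end Generator

/-! ### Elementary bounds for Legendre transforms and for the perturbed base function. -/

section Legendre

variable {n : ℕ} {φ ψ : Euc n → EReal}

theorem IsConv.coe_toReal (hφ : IsConv φ) {x : Euc n} (hx : x ∈ effDom φ) :
    ((φ x).toReal : EReal) = φ x :=
  EReal.coe_toReal (ne_of_lt hx) (hφ.ne_bot x)

theorem IsConv.eq_top (_ : IsConv φ) {x : Euc n} (hx : x ∉ effDom φ) : φ x = ⊤ :=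
  not_lt_top_iff.1 hx

theorem IsConv.convexOn (hφ : IsConv φ) : ConvexOn ℝ (effDom φ) fun x => (φ x).toReal := by
  have key : ∀ x ∈ effDom φ, ∀ y ∈ effDom φ, ∀ a b : ℝ, 0 ≤ a → 0 ≤ b → a + b = 1 →
      φ (a • x + b • y) ≤ ((a * (φ x).toReal + b * (φ y).toReal : ℝ) : EReal) := by
    intro x hx y hy a b ha hb hab
    have h1 := hφ.convex x y a ha (by linarith)
    obtain rfl : b = 1 - a := by linarith
    rw [← hφ.coe_toReal hx, ← hφ.coe_toReal hy] at h1
    exact_mod_cast h1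
  refine ⟨fun x hx y hy a b ha hb hab => (key x hx y hy a b ha hb hab).trans_lt
    (EReal.coe_lt_top _), fun x hx y hy a b ha hb hab => ?_⟩
  have h1 := key x hx y hy a b ha hb hab
  have h2 : a • x + b • y ∈ effDom φ := h1.trans_lt (EReal.coe_lt_top _)
  rw [← hφ.coe_toReal h2] at h1
  exact_mod_cast h1

theorem IsConv.le_legendre (hφ : IsConv φ) {x : Euc n} (hx : x ∈ effDom φ) (y : Euc n) :
    ((inner ℝ x y - (φ x).toReal : ℝ) : EReal) ≤ legendre φ y := by
  refine le_trans (le_of_eq ?_) (le_iSup (fun x : Euc n => ((inner ℝ x y : ℝ) : EReal) - φ x) x)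
  conv_rhs => rw [← hφ.coe_toReal hx]
  rw [EReal.coe_sub]

theorem IsConv.legendre_le (hφ : IsConv φ) {y : Euc n} {c : ℝ}
    (h : ∀ x ∈ effDom φ, inner ℝ x y - (φ x).toReal ≤ c) : legendre φ y ≤ c := by
  refine iSup_le fun x => ?_
  by_cases hx : x ∈ effDom φ
  · rw [← hφ.coe_toReal hx]
    exact_mod_cast h x hx
  · rw [hφ.eq_top hx]
    simp

theorem IsConv.legendre_ne_bot (hφ : IsConv φ) (y : Euc n) : legendre φ y ≠ ⊥ := by
  obtain ⟨x, hx⟩ := hφ.proper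
  exact ne_bot_of_le_ne_bot (EReal.coe_ne_bot _) (hφ.le_legendre hx y)

theorem lowerSemicontinuous_legendre (χ : Euc n → EReal) :
    LowerSemicontinuous (legendre χ) := by
  refine lowerSemicontinuous_iSup fun x => ?_
  refine Continuous.lowerSemicontinuous ?_
  induction χ x with
  | bot => simpa using continuous_const
  | top => simpa using continuous_const
  | coe r =>
    have : (fun y : Euc n => ((inner ℝ x y : ℝ) : EReal) - (r : EReal)) =
        fun y => ((inner ℝ x y - r : ℝ) : EReal) := by
      funext y; rw [EReal.coe_sub]
    rw [this]
    exact continuous_coe_real_ereal.comp (by fun_prop)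

/-- `(φ* + t ψ*)*` is at most the infimal convolution. -/
theorem pertBase_le (hφ : IsConv φ) (hψ : IsConv ψ) {t : ℝ} (ht : 0 < t) {x y : Euc n}
    (hx : x - t • y ∈ effDom φ) (hy : y ∈ effDom ψ) :
    pertBase φ ψ t x ≤ (((φ (x - t • y)).toReal + t * (ψ y).toReal : ℝ) : EReal) := by
  refine iSup_le fun z => ?_
  have h1 := hφ.le_legendre hx z
  have h2 := hψ.le_legendre hy z
  have h3 : (t : EReal) * ((inner ℝ y z - (ψ y).toReal : ℝ) : EReal) ≤ (t : EReal) * legendre ψ z :=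
    mul_le_mul_of_nonneg_left h2 (by exact_mod_cast ht.le)
  refine (EReal.sub_le_sub le_rfl (add_le_add h1 h3)).trans (le_of_eq ?_)
  rw [← EReal.coe_mul, ← EReal.coe_add, ← EReal.coe_sub]
  congr 1
  rw [inner_sub_left, inner_smul_left, real_inner_comm x z]
  simp
  ring

theorem pertBase_le_add (hφ : IsConv φ) {m : ℝ} (hm : ∀ y, ((-m : ℝ) : EReal) ≤ legendre ψ y)
    {t : ℝ} (ht : 0 < t) {x : Euc n} (hx : x ∈ effDom φ) :
    pertBase φ ψ t x ≤ (((φ x).toReal + t * m : ℝ) : EReal) := by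
  refine iSup_le fun z => ?_
  have h1 := hφ.le_legendre hx z
  have h3 : (t : EReal) * ((-m : ℝ) : EReal) ≤ (t : EReal) * legendre ψ z :=
    mul_le_mul_of_nonneg_left (hm z) (by exact_mod_cast ht.le)
  refine (EReal.sub_le_sub le_rfl (add_le_add h1 h3)).trans (le_of_eq ?_)
  rw [← EReal.coe_mul, ← EReal.coe_add, ← EReal.coe_sub]
  congr 1
  rw [real_inner_comm x z]
  ring

/-- One term of the defining supremum. Every lower bound on the perturbed base function below is
this one for a suitable slope `p`. -/
theorem le_pertBase {t : ℝ} (ht : 0 < t) {p : Euc n} {a b : ℝ} (ha : legendre φ p ≤ a)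
    (hb : legendre ψ p ≤ b) (x : Euc n) :
    ((inner ℝ p x - (a + t * b) : ℝ) : EReal) ≤ pertBase φ ψ t x := by
  refine le_trans ?_ (le_iSup (fun z : Euc n => ((inner ℝ z x : ℝ) : EReal) -
    (legendre φ z + (t : EReal) * legendre ψ z)) p)
  have h3 : (t : EReal) * legendre ψ p ≤ (t : EReal) * (b : EReal) :=
    mul_le_mul_of_nonneg_left hb (by exact_mod_cast ht.le)
  refine le_trans (le_of_eq ?_) (EReal.sub_le_sub le_rfl (add_le_add ha h3))
  rw [← EReal.coe_mul, ← EReal.coe_add, ← EReal.coe_sub]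

end Legendre

/-- The standing assumptions of the variational formula, in normalized form. -/
structure PertData {n : ℕ} (α : ℝ) (f : Euc n → ℝ) (φ ψ : Euc n → EReal) (β₁ β₂ m : ℝ) :
    Prop where
  neg : α < 0
  eq_generator : ∀ x, f x = generator α (φ x)
  conv : IsConv φ
  nonneg : ∀ x, 0 ≤ φ x
  conv' : IsConv ψ
  mem_nhds : effDom φ ∈ 𝓝 0
  pos₁ : 0 < β₁
  nonneg₂ : 0 ≤ β₂
  nonneg_m : 0 ≤ m
  le : ∀ y, legendre ψ y ≤ (β₁ : EReal) * legendre φ y + (β₂ : EReal)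
  ge : ∀ y, ((-m : ℝ) : EReal) ≤ legendre ψ y

/-! ### Two-sided bounds for the perturbed function. -/

namespace PertData

variable {n : ℕ} {α : ℝ} {f : Euc n → ℝ} {φ ψ : Euc n → EReal} {β₁ β₂ m : ℝ}

section
variable (h : PertData α f φ ψ β₁ β₂ m)
include h

theorem toReal_nonneg (x : Euc n) : 0 ≤ (φ x).toReal := EReal.toReal_nonneg (h.nonneg x)

theorem convex : Convex ℝ (effDom φ) := h.conv.convexOn.1

theorem f_of_mem {x : Euc n} (hx : x ∈ effDom φ) : f x = realGen α (φ x).toReal := by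
  rw [h.eq_generator, ← generator_coe, h.conv.coe_toReal hx]

theorem f_of_notMem {x : Euc n} (hx : x ∉ effDom φ) : f x = 0 := by
  rw [h.eq_generator, h.conv.eq_top hx, generator_top]

theorem one_le (x : Euc n) : 1 ≤ 1 - α * (φ x).toReal := one_le_of_nonneg h.neg (h.toReal_nonneg x)

theorem f_nonneg (x : Euc n) : 0 ≤ f x := by
  by_cases hx : x ∈ effDom φ
  · rw [h.f_of_mem hx]
    exact (realGen_pos (by linarith [h.one_le x])).le
  · rw [h.f_of_notMem hx]

theorem measurable_f : Measurable f := by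
  rw [show f = fun x => generator α (φ x) from funext h.eq_generator]
  exact (measurable_generator α).comp h.conv.lsc.measurable

theorem upperSemicontinuousAt_f (x : Euc n) : UpperSemicontinuousAt f x := by
  rw [show f = fun x => generator α (φ x) from funext h.eq_generator]
  exact upperSemicontinuousAt_generator h.neg (h.conv.lsc x) (h.nonneg x)

omit h in
theorem measurable_pert (t : ℝ) : Measurable (pert α φ ψ t) :=
  (measurable_generator α).comp (lowerSemicontinuous_legendre _).measurable

theorem mem_interior_iff {x : Euc n} : x ∈ interior (effDom φ) ↔ gauge (effDom φ) x < 1 :=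
  (gauge_lt_one_iff_mem_interior h.convex h.mem_nhds).symm

omit h in
theorem gauge_le_one {x : Euc n} (hx : x ∈ effDom φ) : gauge (effDom φ) x ≤ 1 :=
  gauge_le_one_of_mem hx

theorem legendre_le_of_subgradient {x p : Euc n}
    (hp : IsSubgradientOn (fun z => (φ z).toReal) (effDom φ) x p) :
    legendre φ p ≤ ((inner ℝ p x - (φ x).toReal : ℝ) : EReal) := by
  refine h.conv.legendre_le fun y hy => ?_
  have := hp y hy
  rw [inner_sub_right] at this
  rw [real_inner_comm p y]
  linarith

theorem legendre_le' {p : Euc n} {a : ℝ} (ha : legendre φ p ≤ a) :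
    legendre ψ p ≤ ((β₁ * a + β₂ : ℝ) : EReal) := by
  refine (h.le p).trans ?_
  rw [EReal.coe_add, EReal.coe_mul]
  exact add_le_add (mul_le_mul_of_nonneg_left ha (by exact_mod_cast h.pos₁.le)) le_rfl

theorem legendre_zero_le : legendre φ 0 ≤ ((0 : ℝ) : EReal) :=
  h.conv.legendre_le fun x _ => by
    rw [inner_zero_right]
    linarith [h.toReal_nonneg x]

/-- Take the slope `0`: nonnegativity of `φ` gives `φ*(0) ≤ 0`, hence `ψ*(0) ≤ β₂`. -/
theorem neg_le_pertBase {t : ℝ} (ht : 0 < t) (x : Euc n) :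
    ((-(t * β₂) : ℝ) : EReal) ≤ pertBase φ ψ t x := by
  have := le_pertBase ht h.legendre_zero_le (h.legendre_le' h.legendre_zero_le) x
  simpa using this

theorem lt_pertBase {t : ℝ} (ht : 0 < t) (ht2 : 0 < 1 + α * (t * β₂)) (x : Euc n) :
    ((1 / α : ℝ) : EReal) < pertBase φ ψ t x := by
  refine lt_of_lt_of_le ?_ (h.neg_le_pertBase ht x)
  rw [EReal.coe_lt_coe_iff, div_lt_iff_of_neg h.neg]
  linarith

theorem pert_nonneg {t : ℝ} (ht : 0 < t) (ht2 : 0 < 1 + α * (t * β₂)) (x : Euc n) :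
    0 ≤ pert α φ ψ t x := generator_nonneg h.neg (h.lt_pertBase ht ht2 x)

/-- With `l = 1 + tβ₁` and `p` a subgradient at `x/l`, the bound on `ψ*` turns the test value into
`⟨p, x⟩ - lφ*(p) - tβ₂`, and Fenchel's relation at `x/l` evaluates it. -/
theorem pertBase_ge {t : ℝ} (ht : 0 < t) {x : Euc n} (hx : gauge (effDom φ) x < 1 + t * β₁) :
    (((1 + t * β₁) * (φ ((1 + t * β₁)⁻¹ • x)).toReal - t * β₂ : ℝ) : EReal) ≤
      pertBase φ ψ t x := by
  have hl : 0 < 1 + t * β₁ := by have := h.pos₁; positivity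
  set l := 1 + t * β₁ with hldef
  have hx' : l⁻¹ • x ∈ interior (effDom φ) := by
    rw [h.mem_interior_iff, gauge_smul_of_nonneg (by positivity), smul_eq_mul,
      inv_mul_lt_iff₀ hl, mul_one]
    exact hx
  obtain ⟨p, hp⟩ := exists_isSubgradientOn h.conv.convexOn hx'
  have ha := h.legendre_le_of_subgradient hp
  refine le_trans (le_of_eq ?_) (le_pertBase ht ha (h.legendre_le' ha) x)
  congr 1
  have : inner ℝ p x = l * inner ℝ p (l⁻¹ • x) := by
    rw [inner_smul_right, mul_inv_cancel_left₀ hl.ne']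
  rw [this, hldef]
  ring

theorem legendre_le_of_forall_inner_le {p : Euc n} (hp : ∀ y, inner ℝ p y ≤ gauge (effDom φ) y)
    {s : ℝ} (hs : 0 ≤ s) : legendre φ (s • p) ≤ (s : EReal) := by
  refine h.conv.legendre_le fun y hy => ?_
  rw [inner_smul_right, real_inner_comm]
  have h1 := (hp y).trans (gauge_le_one hy)
  nlinarith [h.toReal_nonneg y]

/-- Test with large multiples `s • p` of a gauge subgradient at `x`: since `φ*(s • p) ≤ s`, the
bound grows linearly in `s` with slope `gauge x - (1 + tβ₁) > 0`. -/
theorem pertBase_eq_top {t : ℝ} (ht : 0 < t) {x : Euc n}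
    (hx : 1 + t * β₁ < gauge (effDom φ) x) : pertBase φ ψ t x = ⊤ := by
  obtain ⟨p, hp⟩ := exists_isSubgradientOn (convexOn_gauge h.convex h.mem_nhds) (x := x) (by simp)
  rw [isSubgradientOn_gauge_iff] at hp
  rw [EReal.eq_top_iff_forall_lt]
  intro M
  obtain ⟨s, hs0, hs⟩ : ∃ s : ℝ, 0 ≤ s ∧ M < s * (gauge (effDom φ) x - (1 + t * β₁)) - t * β₂ := by
    refine ⟨(|M + t * β₂| + 1) / (gauge (effDom φ) x - (1 + t * β₁)), ?_, ?_⟩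
    · exact div_nonneg (by positivity) (by linarith)
    · rw [div_mul_cancel₀ _ (by linarith)]
      linarith [le_abs_self (M + t * β₂)]
  have ha := h.legendre_le_of_forall_inner_le hp.2 hs0
  refine lt_of_lt_of_le ?_ (le_pertBase ht ha (h.legendre_le' ha) x)
  rw [EReal.coe_lt_coe_iff, inner_smul_left, hp.1]
  simp only [conj_trivial]
  linarith

/-- The upper bound of `f_t` by a dilation of `f`. -/
theorem pert_le {t : ℝ} (ht : 0 < t) (ht2 : 0 < 1 + α * (t * β₂)) {x : Euc n}
    (hx : gauge (effDom φ) x ≠ 1 + t * β₁) :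
    pert α φ ψ t x ≤ (1 + α * (t * β₂)) ^ (1 / α) * f ((1 + t * β₁)⁻¹ • x) := by
  have hl : 1 < 1 + t * β₁ := by have := mul_pos ht h.pos₁; linarith
  have hC : 0 < (1 + α * (t * β₂)) ^ (1 / α) := Real.rpow_pos_of_pos ht2 _
  rcases lt_or_gt_of_ne hx with hx | hx
  · have hx' : (1 + t * β₁)⁻¹ • x ∈ interior (effDom φ) := by
      rw [h.mem_interior_iff, gauge_smul_of_nonneg (by positivity), smul_eq_mul,
        inv_mul_lt_iff₀ (by linarith), mul_one]
      exact hx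
    rw [h.f_of_mem (interior_subset hx')]
    set s := (φ ((1 + t * β₁)⁻¹ • x)).toReal with hs
    have hs0 : 0 ≤ s := h.toReal_nonneg _
    refine (generator_le_of_le h.neg (s := s - t * β₂) ?_ ?_).trans
      (realGen_sub_le h.neg hs0 (mul_nonneg ht.le h.nonneg₂) ht2)
    · refine le_trans ?_ (h.pertBase_ge ht hx)
      rw [EReal.coe_le_coe_iff]
      nlinarith
    · nlinarith [h.neg]
  · rw [pert, h.pertBase_eq_top ht hx, generator_top]
    exact mul_nonneg hC.le (h.f_nonneg _)

theorem le_pert {t : ℝ} (ht : 0 < t) (ht2 : 0 < 1 + α * (t * β₂)) (x : Euc n) :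
    (1 - t * m) * f x ≤ pert α φ ψ t x := by
  by_cases hx : x ∈ effDom φ
  · rw [h.f_of_mem hx]
    exact (le_realGen_add h.neg (h.toReal_nonneg x) (mul_nonneg ht.le h.nonneg_m)).trans
      (le_generator_of_le h.neg (pertBase_le_add h.conv h.ge ht hx) (h.lt_pertBase ht ht2 x))
  · rw [h.f_of_notMem hx, mul_zero]
    exact h.pert_nonneg ht ht2 x

omit h in
theorem eventually_pos (α c : ℝ) : ∀ᶠ t in 𝓝[>] (0 : ℝ), 0 < t ∧ 0 < 1 + α * (t * c) := by
  have h1 : ∀ᶠ t in 𝓝[>] (0 : ℝ), 0 < 1 + α * (t * c) := by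
    refine (Continuous.tendsto' (by fun_prop : Continuous fun t : ℝ => 1 + α * (t * c)) 0 1
      (by simp)).mono_left nhdsWithin_le_nhds |>.eventually (lt_mem_nhds zero_lt_one)
  filter_upwards [h1, self_mem_nhdsWithin] with t ht1 ht2 using ⟨ht2, ht1⟩

end

end PertData

/-! ### Pointwise limits inside the domain and in the outer layer. -/

namespace PertData

variable {n : ℕ} {α : ℝ} {f : Euc n → ℝ} {φ ψ : Euc n → EReal} {β₁ β₂ m : ℝ}

section
variable (h : PertData α f φ ψ β₁ β₂ m)
include h

theorem legendre_grad_ne_top {x : Euc n} (hx : x ∈ effDom φ)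
    (hd : DifferentiableAt ℝ (fun z => (φ z).toReal) x) : legendre ψ (grad φ x) ≠ ⊤ :=
  ne_top_of_le_ne_top (EReal.coe_ne_top _) (h.legendre_le'
    (h.legendre_le_of_subgradient (hd.hasGradientAt.isSubgradientOn h.conv.convexOn hx)))

/-- The derivative of `f_t` in `t` at interior points. -/
theorem tendsto_interior {x : Euc n} (hx : gauge (effDom φ) x < 1)
    (hd : DifferentiableAt ℝ (fun z => (φ z).toReal) x) :
    Tendsto (fun t => (pert α φ ψ t x - f x) / t) (𝓝[>] 0)
      (𝓝 ((legendre ψ (grad φ x)).toReal * f x ^ (1 - α))) := by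
  have hxi : x ∈ interior (effDom φ) := h.mem_interior_iff.2 hx
  have hxD : x ∈ effDom φ := interior_subset hxi
  set p := grad φ x with hp
  have hgr : HasGradientAt (fun z => (φ z).toReal) p x := hd.hasGradientAt
  have hsub := hgr.isSubgradientOn h.conv.convexOn hxD
  have hA := h.legendre_le_of_subgradient hsub
  set B := (legendre ψ p).toReal with hB
  have hBc : (B : EReal) = legendre ψ p :=
    EReal.coe_toReal (h.legendre_grad_ne_top hxD hd) (h.conv'.legendre_ne_bot p)
  set r := (φ x).toReal with hr
  have hr1 : 0 < 1 - α * r := by linarith [h.one_le x]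
  have hfx : f x = realGen α r := h.f_of_mem hxD
  have hw : 0 < f x ^ (1 - α) := Real.rpow_pos_of_pos (by rw [hfx]; exact realGen_pos hr1) _
  have hgen := hasDerivAt_realGen h.neg hr1
  -- The chain rule through the generator, shared by the two one-sided bounds: each compares the
  -- perturbed base function with a differentiable curve starting at `φ x`.
  have slope : ∀ (u : ℝ → ℝ) (u' : ℝ), HasDerivAt u u' 0 → u 0 = r →
      Tendsto (fun t => (realGen α (u t) - f x) / t) (𝓝[>] 0) (𝓝 (-u' * f x ^ (1 - α))) ∧
      ∀ᶠ t in 𝓝[>] (0 : ℝ), 0 < 1 - α * u t := by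
    intro u u' hu hu0
    have h1 : HasDerivAt (fun t => realGen α (u t)) (-u' * f x ^ (1 - α)) 0 := by
      have h2 : HasDerivAt (realGen α) (-(realGen α r ^ (1 - α))) (u 0) := by rw [hu0]; exact hgen
      have h3 := h2.comp (0 : ℝ) hu
      have e : -(realGen α r ^ (1 - α)) * u' = -u' * f x ^ (1 - α) := by rw [hfx]; ring
      rw [e] at h3
      exact h3
    constructor
    · have h3 := h1.tendsto_slope_zero_right
      refine h3.congr fun t => ?_
      rw [zero_add, hu0, ← hfx, smul_eq_mul, div_eq_inv_mul]
    · have h4 : Tendsto (fun t => 1 - α * u t) (𝓝 0) (𝓝 (1 - α * r)) := by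
        have := hu.continuousAt.tendsto
        rw [hu0] at this
        exact (this.const_mul α).const_sub 1
      exact (h4.mono_left nhdsWithin_le_nhds).eventually (lt_mem_nhds hr1)
  rw [tendsto_order]
  constructor
  · intro a ha
    have h1 : a / f x ^ (1 - α) < B := by rwa [div_lt_iff₀ hw]
    have h2 : ((a / f x ^ (1 - α) : ℝ) : EReal) < legendre ψ p := by
      rw [← hBc]; exact_mod_cast h1
    -- A near-maximizer of `ψ*(p)`; the curve `φ(x - ty) + tψ(y)` bounds the perturbed base function
    -- above.
    obtain ⟨y, hy⟩ := lt_iSup_iff.1 h2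
    have hyD : y ∈ effDom ψ := by
      by_contra hcon
      rw [h.conv'.eq_top hcon] at hy
      simp at hy
    rw [← h.conv'.coe_toReal hyD, ← EReal.coe_sub, EReal.coe_lt_coe_iff] at hy
    set c := (ψ y).toReal with hc
    have hu1 : HasDerivAt (fun t : ℝ => x - t • y) (-y) 0 := by
      simpa using ((hasDerivAt_id (0 : ℝ)).smul_const y).const_sub x
    have hu2 : HasDerivAt (fun t : ℝ => (φ (x - t • y)).toReal + t * c) (inner ℝ p (-y) + c) 0 := by
      have h3 : HasFDerivAt (fun z => (φ z).toReal) (InnerProductSpace.toDual ℝ (Euc n) p)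
          (x - (0 : ℝ) • y) := by
        simpa using hgr.hasFDerivAt
      have h4 := h3.comp_hasDerivAt (0 : ℝ) hu1
      rw [InnerProductSpace.toDual_apply_apply] at h4
      exact h4.add (by simpa using (hasDerivAt_id (0 : ℝ)).mul_const c)
    obtain ⟨s1, s2⟩ := slope _ _ hu2 (by simp [hr])
    have hlim : a < -(inner ℝ p (-y) + c) * f x ^ (1 - α) := by
      rw [div_lt_iff₀ hw] at hy
      rw [inner_neg_right, real_inner_comm]
      linarith
    have hmem : ∀ᶠ t in 𝓝[>] (0 : ℝ), x - t • y ∈ effDom φ := by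
      have : Tendsto (fun t : ℝ => x - t • y) (𝓝 0) (𝓝 x) := by
        simpa using hu1.continuousAt.tendsto
      exact (this.mono_left nhdsWithin_le_nhds).eventually (mem_interior_iff_mem_nhds.1 hxi)
    filter_upwards [s1.eventually (lt_mem_nhds hlim), s2, hmem, eventually_pos α β₂]
      with t t1 t2 t3 t4
    refine t1.trans_le ?_
    gcongr
    · exact t4.1.le
    · exact le_generator_of_le h.neg (pertBase_le h.conv h.conv' t4.1 t3 hyD)
        (h.lt_pertBase t4.1 t4.2 x)
  · intro a ha
    -- The slope `∇φ(x)` bounds the perturbed base function below by `φ x - tψ*(∇φ(x))`.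
    have hu : HasDerivAt (fun t : ℝ => r - t * B) (-B) 0 := by
      simpa using ((hasDerivAt_id (0 : ℝ)).mul_const B).const_sub r
    obtain ⟨s1, s2⟩ := slope _ _ hu (by simp)
    rw [neg_neg] at s1
    filter_upwards [s1.eventually (gt_mem_nhds ha), s2, self_mem_nhdsWithin] with t t1 t2 t3
    have t3' : 0 < t := t3
    refine lt_of_le_of_lt ?_ t1
    gcongr
    refine generator_le_of_le h.neg ?_ t2
    refine le_trans (le_of_eq ?_) (le_pertBase t3' hA hBc.symm.le x)
    congr 1
    ring

/-- The additive constant comes from `ψ*(0) ≤ β₂`, which means `ψ ≥ -β₂` on its domain. -/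
theorem legendre_smul_le {p : Euc n} {c s : ℝ} (hc : ∀ y ∈ effDom ψ, inner ℝ p y ≤ c)
    (hs : 0 ≤ s) : legendre ψ (s • p) ≤ ((s * c + β₂ : ℝ) : EReal) := by
  refine h.conv'.legendre_le fun y hy => ?_
  have h1 := (h.conv'.le_legendre hy 0).trans (h.legendre_le' h.legendre_zero_le)
  rw [inner_zero_right, EReal.coe_le_coe_iff] at h1
  rw [inner_smul_right, real_inner_comm]
  nlinarith [hc y hy]

/-- Compare `s⟨p, y⟩ - ψ(y) ≤ ψ*(s • p) ≤ β₁s + β₂` for large `s`: the growth assumption on `ψ*`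
bounds the size of `dom ψ` in terms of `dom φ`. -/
theorem inner_le_of_mem_closure {p : Euc n} (hp : ∀ y, inner ℝ p y ≤ gauge (effDom φ) y)
    {y : Euc n} (hy : y ∈ closure (effDom ψ)) : inner ℝ p y ≤ β₁ := by
  have hcl : IsClosed {y : Euc n | inner ℝ p y ≤ β₁} := isClosed_le (by fun_prop) continuous_const
  refine closure_minimal (fun y hy => ?_) hcl hy
  change inner ℝ p y ≤ β₁
  by_contra! hcon
  obtain ⟨s, hs0, hs⟩ : ∃ s : ℝ, 0 ≤ s ∧ β₂ + (ψ y).toReal < s * (inner ℝ p y - β₁) := by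
    refine ⟨(|β₂ + (ψ y).toReal| + 1) / (inner ℝ p y - β₁), ?_, ?_⟩
    · exact div_nonneg (by positivity) (by linarith)
    · rw [div_mul_cancel₀ _ (by linarith)]
      linarith [le_abs_self (β₂ + (ψ y).toReal)]
  have h1 := (h.conv'.le_legendre hy (s • p)).trans
    (h.legendre_le' (h.legendre_le_of_forall_inner_le hp hs0))
  rw [EReal.coe_le_coe_iff, inner_smul_right, real_inner_comm] at h1
  nlinarith

theorem supportFun_le {p : Euc n} (hp : ∀ y, inner ℝ p y ≤ gauge (effDom φ) y) :
    supportFun (closure (effDom ψ)) p ≤ (β₁ : EReal) :=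
  iSup₂_le fun _ hy => by exact_mod_cast h.inner_le_of_mem_closure hp hy

/-- A negative value would send `ψ*(s • p)` to `-∞` as `s` grows, contradicting the lower bound on
`ψ*`. Hence the layer swept outside the domain has nonnegative thickness. -/
theorem supportFun_nonneg (p : Euc n) : 0 ≤ supportFun (closure (effDom ψ)) p := by
  by_contra! hcon
  obtain ⟨c, hc1, hc2⟩ := EReal.lt_iff_exists_real_btwn.1 hcon
  have hc0 : c < 0 := by exact_mod_cast hc2
  have hle : ∀ y ∈ effDom ψ, inner ℝ p y ≤ c := fun y hy => by
    have h1 := (le_iSup₂ (f := fun (y : Euc n) (_ : y ∈ closure (effDom ψ)) =>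
      ((inner ℝ p y : ℝ) : EReal)) y (subset_closure hy)).trans hc1.le
    exact_mod_cast h1
  have hs0 : 0 ≤ (m + β₂ + 1) / (-c) :=
    div_nonneg (by linarith [h.nonneg_m, h.nonneg₂]) (by linarith)
  have h1 := (h.ge _).trans (h.legendre_smul_le hle hs0)
  rw [EReal.coe_le_coe_iff, div_mul_eq_mul_div, div_neg, mul_div_cancel_right₀ _ hc0.ne] at h1
  linarith

theorem coe_toReal_supportFun {p : Euc n} (hp : ∀ y, inner ℝ p y ≤ gauge (effDom φ) y) :
    ((supportFun (closure (effDom ψ)) p).toReal : EReal) = supportFun (closure (effDom ψ)) p :=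
  EReal.coe_toReal (ne_top_of_le_ne_top (EReal.coe_ne_top _) (h.supportFun_le hp))
    (ne_bot_of_le_ne_bot EReal.zero_ne_bot (h.supportFun_nonneg p))

theorem toReal_supportFun_mem {p : Euc n} (hp : ∀ y, inner ℝ p y ≤ gauge (effDom φ) y) :
    (supportFun (closure (effDom ψ)) p).toReal ∈ Set.Icc 0 β₁ := by
  have h1 := h.coe_toReal_supportFun hp
  constructor
  · exact EReal.toReal_nonneg (h.supportFun_nonneg p)
  · have := h.supportFun_le hp
    rw [← h1] at this
    exact_mod_cast this

/-- Outside the Minkowski sum of the domains `f_t` vanishes. -/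
theorem pert_eq_zero {x p : Euc n} (hp : ∀ y, inner ℝ p y ≤ gauge (effDom φ) y)
    (hx : inner ℝ p x = (1 : ℝ)) {κ t : ℝ} (ht : 0 < t)
    (hκ : (supportFun (closure (effDom ψ)) p).toReal < κ) :
    pert α φ ψ t ((1 + t * κ) • x) = 0 := by
  have hc := h.coe_toReal_supportFun hp
  set H := (supportFun (closure (effDom ψ)) p).toReal with hH
  have hle : ∀ y ∈ effDom ψ, inner ℝ p y ≤ H := fun y hy => by
    have h1 := (le_iSup₂ (f := fun (y : Euc n) (_ : y ∈ closure (effDom ψ)) =>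
      ((inner ℝ p y : ℝ) : EReal)) y (subset_closure hy)).trans hc.symm.le
    exact_mod_cast h1
  suffices pertBase φ ψ t ((1 + t * κ) • x) = ⊤ by rw [pert, this, generator_top]
  rw [EReal.eq_top_iff_forall_lt]
  intro M
  obtain ⟨s, hs0, hs⟩ : ∃ s : ℝ, 0 ≤ s ∧ M + t * β₂ < s * (t * (κ - H)) := by
    have hpos : 0 < t * (κ - H) := mul_pos ht (by linarith)
    refine ⟨(|M + t * β₂| + 1) / (t * (κ - H)), ?_, ?_⟩
    · positivity
    · rw [div_mul_cancel₀ _ hpos.ne']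
      linarith [le_abs_self (M + t * β₂)]
  refine lt_of_lt_of_le ?_ (le_pertBase ht (h.legendre_le_of_forall_inner_le hp hs0)
    (h.legendre_smul_le hle hs0) _)
  rw [EReal.coe_lt_coe_iff, inner_smul_left, inner_smul_right, hx]
  simp only [conj_trivial]
  linarith

/-- In the outer layer `f_t` converges to the boundary value of `f`. -/
theorem tendsto_exterior {x : Euc n} (hx : gauge (effDom φ) x = 1)
    (hd : DifferentiableAt ℝ (gauge (effDom φ)) x) {κ : ℝ} (hκ0 : 0 < κ)
    (hκ : κ < (supportFun (closure (effDom ψ)) (gradient (gauge (effDom φ)) x)).toReal) :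
    Tendsto (fun t => pert α φ ψ t ((1 + t * κ) • x)) (𝓝[>] 0) (𝓝 (f x)) := by
  set N := gradient (gauge (effDom φ)) x with hN
  have hsub := isSubgradientOn_gauge_iff.1 (hd.isSubgradientOn_gauge h.convex h.mem_nhds)
  rw [← hN, hx] at hsub
  have hκβ : κ < β₁ := hκ.trans_le (h.toReal_supportFun_mem hsub.2).2
  rw [tendsto_order]
  constructor
  · intro a ha
    by_cases hxD : x ∈ effDom φ
    swap
    · rw [h.f_of_notMem hxD] at ha
      filter_upwards [eventually_pos α β₂] with t ht
      exact ha.trans_le (h.pert_nonneg ht.1 ht.2 _)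
    have h1 : (κ : EReal) < supportFun (closure (effDom ψ)) N := by
      rw [← h.coe_toReal_supportFun hsub.2]; exact_mod_cast hκ
    obtain ⟨y, hy⟩ := lt_iSup_iff.1 h1
    obtain ⟨hyc, hy⟩ := lt_iSup_iff.1 hy
    rw [EReal.coe_lt_coe_iff] at hy
    obtain ⟨y, hyD, hy⟩ : ∃ y ∈ effDom ψ, κ < inner ℝ N y := by
      by_contra! hcon
      have hcl : IsClosed {y : Euc n | inner ℝ N y ≤ κ} :=
        isClosed_le (by fun_prop) continuous_const
      exact absurd (closure_minimal (fun z hz => hcon z hz) hcl hyc) (not_le.2 hy)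
    -- Since `⟨N, y⟩ > κ` and `⟨N, x⟩ = 1`, this direction points strictly into the domain at `x`,
    -- and `(1 + tκ)x - ty = x + tu`.
    set u := κ • x - y with hu
    have hNu : inner ℝ N u < 0 := by
      rw [hu, inner_sub_right, inner_smul_right, hsub.1]; linarith
    have hder : HasDerivAt (fun s : ℝ => gauge (effDom φ) (x + s • u)) (inner ℝ N u) 0 := by
      have h2 : HasDerivAt (fun s : ℝ => x + s • u) u 0 := by
        simpa using ((hasDerivAt_id (0 : ℝ)).smul_const u).const_add x
      have h3 : HasFDerivAt (gauge (effDom φ)) (InnerProductSpace.toDual ℝ (Euc n) N)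
          (x + (0 : ℝ) • u) := by
        rw [zero_smul, add_zero]
        exact hd.hasGradientAt.hasFDerivAt
      have h4 := h3.comp_hasDerivAt (0 : ℝ) h2
      rwa [InnerProductSpace.toDual_apply_apply] at h4
    have hin : ∀ᶠ s in 𝓝[>] (0 : ℝ), x + s • u ∈ effDom φ := by
      have h5 := hder.tendsto_slope_zero_right
      filter_upwards [h5.eventually (gt_mem_nhds hNu), self_mem_nhdsWithin] with s hs hs0
      have hs0' : 0 < s := hs0
      simp only [zero_add, zero_smul, add_zero, hx, smul_eq_mul] at hs
      refine interior_subset (h.mem_interior_iff.2 ?_)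
      by_contra! hcon
      have : 0 ≤ s⁻¹ * (gauge (effDom φ) (x + s • u) - 1) :=
        mul_nonneg (inv_nonneg.2 hs0'.le) (by linarith)
      linarith
    -- Because `φ` need not be continuous up to the boundary, `φ(x + tu)` is bounded by convex
    -- interpolation between `x` and the fixed point `x + t₀u`.
    obtain ⟨t₀, ht₀, ht₀pos⟩ := (hin.and self_mem_nhdsWithin).exists
    have ht₀' : 0 < t₀ := ht₀pos
    set r := (φ x).toReal with hr
    set r' := (φ (x + t₀ • u)).toReal with hr'
    set v : ℝ → ℝ := fun t => (1 - t / t₀) * r + t / t₀ * r' + t * (ψ y).toReal with hv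
    have hvc : Tendsto v (𝓝 0) (𝓝 r) := by
      have : Continuous v := by rw [hv]; fun_prop
      simpa [hv] using this.tendsto 0
    have hr1 : 0 < 1 - α * r := by linarith [h.one_le x]
    have hlim : Tendsto (fun t => realGen α (v t)) (𝓝[>] 0) (𝓝 (f x)) := by
      rw [h.f_of_mem hxD]
      exact ((continuousAt_realGen h.neg hr1).tendsto.comp hvc).mono_left nhdsWithin_le_nhds
    filter_upwards [hlim.eventually (lt_mem_nhds ha), eventually_pos α β₂, Ioo_mem_nhdsGT ht₀',
      hin] with t t1 t2 t3 t4
    refine t1.trans_le (le_generator_of_le h.neg ?_ (h.lt_pertBase t2.1 t2.2 _))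
    have e1 : (1 + t * κ) • x - t • y = x + t • u := by rw [hu]; module
    have h6 := pertBase_le h.conv h.conv' t2.1 (x := (1 + t * κ) • x) (y := y)
      (by rw [e1]; exact t4) hyD
    refine h6.trans ?_
    rw [EReal.coe_le_coe_iff, e1, hv]
    have hq0 : 0 ≤ t / t₀ := by have := t3.1; positivity
    have hq1 : t / t₀ ≤ 1 := (div_le_one ht₀').2 t3.2.le
    have h7 : (φ ((1 - t / t₀) • x + (t / t₀) • (x + t₀ • u))).toReal ≤
        (1 - t / t₀) • (φ x).toReal + (t / t₀) • (φ (x + t₀ • u)).toReal :=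
      h.conv.convexOn.2 hxD ht₀ (by linarith) hq0 (by ring)
    have e2 : (1 - t / t₀) • x + (t / t₀) • (x + t₀ • u) = x + t • u := by
      have : (t / t₀) • (t₀ • u) = t • u := by rw [smul_smul, div_mul_cancel₀ _ ht₀'.ne']
      rw [smul_add, this]; module
    rw [e2, smul_eq_mul, smul_eq_mul] at h7
    linarith
  · intro a ha
    -- The upper bound needs only upper semicontinuity of `f` at `x`, applied to the dilated
    -- argument in the bound on `f_t`.
    have h1 : Tendsto (fun t : ℝ => (1 + t * β₁)⁻¹ • ((1 + t * κ) • x)) (𝓝[>] 0) (𝓝 x) := by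
      have : ContinuousAt (fun t : ℝ => (1 + t * β₁)⁻¹ • ((1 + t * κ) • x)) 0 := by
        have h2 : ContinuousAt (fun t : ℝ => (1 + t * β₁)⁻¹) 0 :=
          ContinuousAt.inv₀ (by fun_prop) (by simp)
        exact h2.smul (by fun_prop)
      have := this.tendsto
      simp only [zero_mul, add_zero, inv_one, one_smul] at this
      exact this.mono_left nhdsWithin_le_nhds
    obtain ⟨b, hb1, hb2⟩ := exists_between ha
    have h2 := h1.eventually (h.upperSemicontinuousAt_f x b hb1)
    have h3 : Tendsto (fun t : ℝ => (1 + α * (t * β₂)) ^ (1 / α) * b) (𝓝[>] 0) (𝓝 b) := by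
      have : ContinuousAt (fun t : ℝ => (1 + α * (t * β₂)) ^ (1 / α) * b) 0 := by
        refine ContinuousAt.mul (ContinuousAt.rpow_const (by fun_prop) (by simp)) continuousAt_const
      have := this.tendsto
      simp only [zero_mul, mul_zero, add_zero, Real.one_rpow, one_mul] at this
      exact this.mono_left nhdsWithin_le_nhds
    filter_upwards [h2, h3.eventually (gt_mem_nhds hb2), eventually_pos α β₂] with t t1 t2 t3
    have hg : gauge (effDom φ) ((1 + t * κ) • x) = 1 + t * κ := by
      have := t3.1
      rw [gauge_smul_of_nonneg (by positivity), hx, smul_eq_mul, mul_one]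
    refine lt_of_le_of_lt (h.pert_le t3.1 t3.2 ?_) (lt_of_le_of_lt ?_ t2)
    · rw [hg]
      have := mul_lt_mul_of_pos_left hκβ t3.1
      intro hcon
      linarith
    · exact mul_le_mul_of_nonneg_left t1.le (Real.rpow_pos_of_pos t3.2 _).le

end

end PertData

/-! ### Convergence theorems for integrals. -/

section Convergence

variable {X : Type*} [MeasurableSpace X] {μ : Measure X}

/-- Fatou's lemma as an integrability criterion. -/
theorem integrable_of_tendsto_of_integral_le {F : ℕ → X → ℝ} {f : X → ℝ} {C : ℝ}
    (hF : ∀ k, Integrable (F k) μ) (h0 : ∀ k, 0 ≤ᵐ[μ] F k) (hC : ∀ k, ∫ x, F k x ∂μ ≤ C)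
    (hlim : ∀ᵐ x ∂μ, Tendsto (fun k => F k x) atTop (𝓝 (f x))) : Integrable f μ := by
  refine ⟨aestronglyMeasurable_of_tendsto_ae atTop (fun k => (hF k).1) hlim, ?_⟩
  have h1 : ∫⁻ x, ‖f x‖ₑ ∂μ ≤ liminf (fun k => ∫⁻ x, ‖F k x‖ₑ ∂μ) atTop :=
    lintegral_congr_ae (by filter_upwards [hlim] with x hx using hx.enorm.liminf_eq) ▸
      lintegral_liminf_le' fun k => (hF k).1.enorm
  have h2 : ∀ k, ∫⁻ x, ‖F k x‖ₑ ∂μ ≤ ENNReal.ofReal C := fun k => by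
    have h3 : ∫⁻ x, ‖F k x‖ₑ ∂μ = ENNReal.ofReal (∫ x, F k x ∂μ) := by
      rw [ofReal_integral_eq_lintegral_ofReal (hF k) (h0 k)]
      refine lintegral_congr_ae ?_
      filter_upwards [h0 k] with x hx
      exact Real.enorm_of_nonneg hx
    rw [h3]
    exact ENNReal.ofReal_le_ofReal (hC k)
  refine (h1.trans ?_).trans_lt (ENNReal.ofReal_lt_top (r := C))
  exact (liminf_le_liminf (Eventually.of_forall h2)).trans (by simp)

/-- Dominated convergence with a convergent family of dominating functions. -/
theorem tendsto_integral_of_dominated_by_convergent {ι : Type*} {l : Filter ι} [l.NeBot]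
    [l.IsCountablyGenerated] {F G : ι → X → ℝ} {f g : X → ℝ}
    (hF : ∀ᶠ i in l, AEStronglyMeasurable (F i) μ) (hG : ∀ᶠ i in l, Integrable (G i) μ)
    (hg : Integrable g μ) (hle : ∀ᶠ i in l, ∀ᵐ x ∂μ, |F i x| ≤ G i x)
    (hFf : ∀ᵐ x ∂μ, Tendsto (fun i => F i x) l (𝓝 (f x)))
    (hGg : ∀ᵐ x ∂μ, Tendsto (fun i => G i x) l (𝓝 (g x)))
    (hint : Tendsto (fun i => ∫ x, G i x ∂μ) l (𝓝 (∫ x, g x ∂μ))) :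
    Integrable f μ ∧ Tendsto (fun i => ∫ x, F i x ∂μ) l (𝓝 (∫ x, f x ∂μ)) := by
  obtain ⟨u, hu⟩ := exists_seq_tendsto l
  obtain ⟨N, hN⟩ := eventually_atTop.1 (hu.eventually (hF.and hle))
  have hv : Tendsto (fun k => u (k + N)) atTop l := hu.comp (tendsto_add_atTop_nat N)
  have hfg : ∀ᵐ x ∂μ, |f x| ≤ g x := by
    have h1 : ∀ᵐ x ∂μ, ∀ k, |F (u (k + N)) x| ≤ G (u (k + N)) x :=
      ae_all_iff.2 fun k => (hN _ (by omega)).2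
    filter_upwards [h1, hFf, hGg] with x h1 h2 h3
    exact le_of_tendsto_of_tendsto' (h2.comp hv).abs (h3.comp hv) h1
  have hfi : Integrable f μ := by
    refine hg.mono' (aestronglyMeasurable_of_tendsto_ae atTop
      (f := fun k => F (u (k + N))) (fun k => (hN _ (by omega)).1) ?_) hfg
    filter_upwards [hFf] with x hx using hx.comp hv
  refine ⟨hfi, ?_⟩
  -- Truncating at the limiting bound `g` makes ordinary dominated convergence available; the
  -- truncation error is at most the positive part of `G i - g`.
  set T : ι → X → ℝ := fun i x => max (-g x) (min (g x) (F i x)) with hT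
  have hg0 : ∀ᵐ x ∂μ, 0 ≤ g x := hfg.mono fun x hx => (abs_nonneg _).trans hx
  have hTm : ∀ᶠ i in l, AEStronglyMeasurable (T i) μ := by
    filter_upwards [hF] with i hi
    exact hg.1.neg.sup (hg.1.inf hi)
  have hTg : ∀ i, ∀ᵐ x ∂μ, ‖T i x‖ ≤ g x := fun i => by
    filter_upwards [hg0] with x hx
    rw [Real.norm_eq_abs, abs_le]
    exact ⟨le_max_left _ _, max_le (by linarith) (min_le_left _ _)⟩
  have hTlim : Tendsto (fun i => ∫ x, T i x ∂μ) l (𝓝 (∫ x, f x ∂μ)) := by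
    refine tendsto_integral_filter_of_dominated_convergence g hTm (Eventually.of_forall hTg) hg ?_
    filter_upwards [hFf, hfg] with x hx hxg
    have h2 : Tendsto (fun i => T i x) l (𝓝 (max (-g x) (min (g x) (f x)))) :=
      (tendsto_const_nhds.max (tendsto_const_nhds.min hx))
    rwa [min_eq_right (abs_le.1 hxg).2, max_eq_right (abs_le.1 hxg).1] at h2
  have hR : Tendsto (fun i => ∫ x, max (g x - G i x) 0 ∂μ) l (𝓝 0) := by
    have h3 : Tendsto (fun i => ∫ x, max (g x - G i x) 0 ∂μ) l (𝓝 (∫ x, (0 : ℝ) ∂μ)) := by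
      refine tendsto_integral_filter_of_dominated_convergence g ?_ ?_ hg ?_
      · filter_upwards [hG] with i hi
        exact (hg.1.sub hi.1).sup aestronglyMeasurable_const
      · filter_upwards [hle] with i hi
        filter_upwards [hi, hg0] with x hx hx0
        have := (abs_nonneg _).trans hx
        rw [Real.norm_eq_abs, abs_of_nonneg (le_max_right _ _)]
        exact max_le (by linarith) hx0
      · filter_upwards [hGg] with x hx
        have := (hx.const_sub (g x)).max (tendsto_const_nhds (x := (0 : ℝ)))
        simpa using this
    simpa using h3
  -- The positive part equals `G i - g` plus the negative part. The latter is dominated by `g`, and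
  -- the integral of `G i - g` tends to `0` by hypothesis.
  have hQ : Tendsto (fun i => ∫ x, max (G i x - g x) 0 ∂μ) l (𝓝 0) := by
    have h4 : Tendsto (fun i => (∫ x, G i x ∂μ) - (∫ x, g x ∂μ) + ∫ x, max (g x - G i x) 0 ∂μ) l
        (𝓝 0) := by
      simpa using (hint.sub_const (∫ x, g x ∂μ)).add hR
    refine h4.congr' ?_
    filter_upwards [hG] with i hi
    rw [← integral_sub hi hg]
    refine (integral_add (f := fun x => G i x - g x) (g := fun x => max (g x - G i x) 0)
      (hi.sub hg) ((hg.sub hi).sup (integrable_zero _ _ _))).symm.trans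
      (integral_congr_ae (Eventually.of_forall fun x => ?_))
    change G i x - g x + max (g x - G i x) 0 = max (G i x - g x) 0
    rcases le_total (g x) (G i x) with hx | hx
    · rw [max_eq_right (by linarith), max_eq_left (by linarith)]; ring
    · rw [max_eq_left (by linarith), max_eq_right (by linarith)]; ring
  have hD : Tendsto (fun i => (∫ x, F i x ∂μ) - ∫ x, T i x ∂μ) l (𝓝 0) := by
    refine squeeze_zero_norm' ?_ hQ
    filter_upwards [hG, hF, hle, hTm] with i hi hFi hlei hTi
    have hFint : Integrable (F i) μ := hi.mono' hFi hlei
    have hTint : Integrable (T i) μ := hg.mono' hTi (hTg i)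
    rw [← integral_sub hFint hTint]
    refine (norm_integral_le_integral_norm _).trans (integral_mono_ae (hFint.sub hTint).norm
      ((hi.sub hg).sup (integrable_zero _ _ _)) ?_)
    filter_upwards [hlei, hg0] with x hx hx0
    change |F i x - max (-g x) (min (g x) (F i x))| ≤ max (G i x - g x) 0
    obtain ⟨a1, a2⟩ := abs_le.1 hx
    rw [abs_le]
    rcases le_total (F i x) (g x) with c1 | c1
    · rw [min_eq_right c1]
      rcases le_total (-g x) (F i x) with c2 | c2
      · rw [max_eq_right c2]; simp
      · rw [max_eq_left c2]
        exact ⟨by linarith [le_max_left (G i x - g x) 0], by linarith [le_max_right (G i x - g x) 0]⟩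
    · rw [min_eq_left c1, max_eq_right (show -g x ≤ g x by linarith)]
      exact ⟨by linarith [le_max_right (G i x - g x) 0], by linarith [le_max_left (G i x - g x) 0]⟩
  simpa using hD.add hTlim

end Convergence

/-! ### Decay and integrability from coercivity. -/

section Coercive

variable {n : ℕ}

theorem Coercive.exists_le {φ : Euc n → EReal} (hφ : IsConv φ) (h0 : ∀ x, 0 ≤ φ x)
    (h : Coercive φ) :
    ∃ a > 0, ∃ b ≥ 0, ∀ x ∈ effDom φ, a * ‖x‖ - b ≤ (φ x).toReal := by
  obtain ⟨a, ha0, ha⟩ := EReal.lt_iff_exists_real_btwn.1 h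
  have ha0' : 0 < a := by exact_mod_cast ha0
  have h1 := eventually_lt_of_lt_liminf ha
  rw [← comap_norm_atTop, eventually_comap] at h1
  obtain ⟨R, hR⟩ := eventually_atTop.1 h1
  refine ⟨a, ha0', a * max R 1, by positivity, fun x hx => ?_⟩
  rcases le_total (max R 1) ‖x‖ with hx1 | hx1
  · have hx2 := hR ‖x‖ ((le_max_left _ _).trans hx1) x rfl
    have hx3 : 0 < ‖x‖ := lt_of_lt_of_le one_pos ((le_max_right _ _).trans hx1)
    rw [← hφ.coe_toReal hx, ← EReal.coe_div, EReal.coe_lt_coe_iff, lt_div_iff₀ hx3] at hx2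
    have : 0 ≤ a * max R 1 := by positivity
    linarith
  · have := EReal.toReal_nonneg (h0 x)
    nlinarith

theorem IsCPlusWithBase.exists_decay {α : ℝ} (hα : α < 0) {f : Euc n → ℝ} {φ : Euc n → EReal}
    (hf : IsCPlusWithBase α f φ) : ∃ C > 0, ∀ x, f x ≤ C * (1 + ‖x‖) ^ (1 / α) := by
  obtain ⟨a, ha, b, hb, hab⟩ := hf.coercive.exists_le hf.conv hf.nonneg
  set c := -α with hc
  have hc0 : 0 < c := by rw [hc]; linarith
  -- Only the fraction `l` of the growth of `φ` is used, so that the offset `b` costs at most half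
  -- of the constant `1` in `1 - αφ`.
  set l : ℝ := 1 / (1 + 2 * c * b) with hl
  have hden : 0 < 1 + 2 * c * b := by positivity
  have hl0 : 0 < l := by positivity
  have hl1 : l ≤ 1 := by
    rw [hl, div_le_one hden]
    have : 0 ≤ 2 * c * b := by positivity
    linarith
  have hlb : l * (c * b) ≤ 1 / 2 := by
    rw [hl, div_mul_eq_mul_div, div_le_iff₀ hden]; linarith
  set δ := min (1 / 2) (l * c * a) with hδ
  have hδ0 : 0 < δ := lt_min (by norm_num) (by positivity)
  refine ⟨δ ^ (1 / α), Real.rpow_pos_of_pos hδ0 _, fun x => ?_⟩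
  by_cases hx : x ∈ effDom φ
  · rw [hf.eq_generator, ← hf.conv.coe_toReal hx, generator_coe, realGen,
      ← Real.mul_rpow hδ0.le (by positivity)]
    refine Real.rpow_le_rpow_of_nonpos (by positivity) ?_ (one_div_neg.2 hα).le
    have h1 := hab x hx
    have h2 := EReal.toReal_nonneg (hf.nonneg x)
    have h3 : δ * (1 + ‖x‖) ≤ 1 / 2 + l * c * a * ‖x‖ := by
      have e1 : δ ≤ 1 / 2 := min_le_left _ _
      have e2 : δ * ‖x‖ ≤ l * c * a * ‖x‖ := by gcongr; exact min_le_right _ _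
      linarith
    have h4 : l * c * (a * ‖x‖ - b) ≤ l * c * (φ x).toReal := by gcongr
    have h5 : l * c * (φ x).toReal ≤ c * (φ x).toReal := by
      gcongr
      nlinarith
    have h6 : 1 - α * (φ x).toReal = 1 + c * (φ x).toReal := by rw [hc]; ring
    rw [h6]
    linarith
  · rw [hf.eq_generator, hf.conv.eq_top hx, generator_top]
    positivity

/-- The condition `-1/n < α < 0` says exactly that the decay exponent `-1/α` exceeds the dimension.
-/
theorem integrable_of_decay {α : ℝ} (hα : -(1 / (n : ℝ)) < α) (hn : 1 ≤ n) (hα0 : α < 0)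
    {f : Euc n → ℝ}
    (hm : Measurable f) (h0 : ∀ x, 0 ≤ f x) {C : ℝ} (hC : ∀ x, f x ≤ C * (1 + ‖x‖) ^ (1 / α)) :
    Integrable f := by
  have hn0 : (0 : ℝ) < n := by exact_mod_cast hn
  have hr : (Module.finrank ℝ (Euc n) : ℝ) < -(1 / α) := by
    rw [finrank_euclideanSpace_fin]
    rw [← div_neg, lt_div_iff₀ (by linarith)]
    have : 1 / (n : ℝ) * n = 1 := by field_simp
    nlinarith
  have h1 := (integrable_one_add_norm (μ := (volume : Measure (Euc n))) hr).const_mul C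
  refine h1.mono' hm.aestronglyMeasurable (Eventually.of_forall fun x => ?_)
  rw [Real.norm_of_nonneg (h0 x)]
  simpa using hC x

end Coercive

/-! ### Dilations of `f` along rays. -/

namespace PertData

variable {n : ℕ} {α : ℝ} {f : Euc n → ℝ} {φ ψ : Euc n → EReal} {β₁ β₂ m : ℝ}

/-- The derivative of the dilations `f (s⁻¹ • x)` at `s = 1`. -/
def radialDeriv (f : Euc n → ℝ) (φ : Euc n → EReal) (α : ℝ) (x : Euc n) : ℝ :=
  f x ^ (1 - α) * inner ℝ (grad φ x) x

section
variable (h : PertData α f φ ψ β₁ β₂ m)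
include h

theorem measurable_radialDeriv : Measurable (radialDeriv f φ α) := by
  have h1 : Measurable (grad φ) := measurable_gradient _
  have h2 := h.measurable_f
  unfold radialDeriv
  fun_prop

theorem ae_effDom_interior : ∀ᵐ x : Euc n, x ∈ effDom φ → gauge (effDom φ) x < 1 := by
  have h1 : ∀ᵐ x : Euc n, x ∉ frontier (effDom φ) := by
    rw [ae_iff]
    simpa using h.convex.addHaar_frontier volume
  filter_upwards [h1] with x hx hxD
  by_contra hcon
  rw [← h.mem_interior_iff] at hcon
  exact hx ⟨subset_closure hxD, hcon⟩

theorem ae_differentiableAt_interior : ∀ᵐ x : Euc n, gauge (effDom φ) x < 1 →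
    DifferentiableAt ℝ (fun z => (φ z).toReal) x := by
  filter_upwards [h.conv.convexOn.ae_differentiableAt volume] with x hx hx1
  exact hx (h.mem_interior_iff.2 hx1)

theorem radialDeriv_of_notMem {x : Euc n} (hx : x ∉ effDom φ) : radialDeriv f φ α x = 0 := by
  rw [radialDeriv, h.f_of_notMem hx, Real.zero_rpow (by linarith [h.neg]), zero_mul]

theorem zero_mem : (0 : Euc n) ∈ effDom φ := mem_of_mem_nhds h.mem_nhds

theorem smul_inv_mem {x : Euc n} (hx : gauge (effDom φ) x < 1) {s : ℝ} (hs : 1 ≤ s) :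
    s⁻¹ • x ∈ interior (effDom φ) := by
  rw [h.mem_interior_iff, gauge_smul_of_nonneg (by positivity), smul_eq_mul]
  have h1 : s⁻¹ ≤ 1 := inv_le_one_of_one_le₀ hs
  have h2 := gauge_nonneg (s := effDom φ) x
  nlinarith

theorem hasDerivAt_dilation {x : Euc n} {s : ℝ} (hs : 0 < s)
    (hx : gauge (effDom φ) (s⁻¹ • x) < 1)
    (hd : DifferentiableAt ℝ (fun z => (φ z).toReal) (s⁻¹ • x)) :
    HasDerivAt (fun s : ℝ => f (s⁻¹ • x)) (radialDeriv f φ α (s⁻¹ • x) / s) s := by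
  have hmem : s⁻¹ • x ∈ interior (effDom φ) := h.mem_interior_iff.2 hx
  have hpath : HasDerivAt (fun s : ℝ => s⁻¹ • x) (-(s ^ 2)⁻¹ • x) s :=
    (hasDerivAt_inv hs.ne').smul_const x
  have h1 : HasFDerivAt (fun z => (φ z).toReal)
      (InnerProductSpace.toDual ℝ (Euc n) (grad φ (s⁻¹ • x))) (s⁻¹ • x) :=
    hd.hasGradientAt.hasFDerivAt
  have h2 := h1.comp_hasDerivAt s hpath
  rw [InnerProductSpace.toDual_apply_apply] at h2
  have hpos : 0 < 1 - α * (φ (s⁻¹ • x)).toReal := by linarith [h.one_le (s⁻¹ • x)]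
  have h3 : HasDerivAt (realGen α) (-(realGen α (φ (s⁻¹ • x)).toReal ^ (1 - α)))
      (((fun z => (φ z).toReal) ∘ fun s : ℝ => s⁻¹ • x) s) := hasDerivAt_realGen h.neg hpos
  have h4 := h3.comp s h2
  have e : -(realGen α (φ (s⁻¹ • x)).toReal ^ (1 - α)) *
      inner ℝ (grad φ (s⁻¹ • x)) (-(s ^ 2)⁻¹ • x) = radialDeriv f φ α (s⁻¹ • x) / s := by
    rw [radialDeriv, h.f_of_mem (interior_subset hmem), inner_smul_right, inner_smul_right]
    field_simp
  rw [e] at h4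
  refine h4.congr_of_eventuallyEq ?_
  have : Tendsto (fun s : ℝ => s⁻¹ • x) (𝓝 s) (𝓝 (s⁻¹ • x)) := hpath.continuousAt
  filter_upwards [this.eventually (isOpen_interior.mem_nhds hmem)] with r hr
  exact h.f_of_mem (interior_subset hr)

/-- The segment from `x` to `x/l` is a compact subset of the interior, where `φ` is Lipschitz, and
the generator is 1-Lipschitz on `[0, ∞)`. The dilation is therefore absolutely continuous in `s`,
and differentiability for almost every `s` suffices. -/
theorem f_smul_inv_sub {x : Euc n} (hx : gauge (effDom φ) x < 1) {l : ℝ} (hl : 1 ≤ l)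
    (hd : ∀ᵐ s : ℝ, s ∈ Set.Ioc 1 l → DifferentiableAt ℝ (fun z => (φ z).toReal) (s⁻¹ • x)) :
    f (l⁻¹ • x) - f x = ∫ s in (1 : ℝ)..l, radialDeriv f φ α (s⁻¹ • x) / s := by
  have hcomp : IsCompact ((fun s : ℝ => s⁻¹ • x) '' Set.Icc 1 l) := by
    refine isCompact_Icc.image_of_continuousOn ?_
    refine ContinuousOn.smul (continuousOn_id.inv₀ fun s hs => ?_) continuousOn_const
    have := hs.1
    simp only [id]; positivity
  have hsub : (fun s : ℝ => s⁻¹ • x) '' Set.Icc 1 l ⊆ interior (effDom φ) := by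
    rintro _ ⟨s, hs, rfl⟩
    exact h.smul_inv_mem hx hs.1
  obtain ⟨C, hC⟩ := (h.conv.convexOn.locallyLipschitzOn_interior.mono
    hsub).exists_lipschitzOnWith_of_compact hcomp
  have hpath : LipschitzOnWith ‖x‖₊ (fun s : ℝ => s⁻¹ • x) (Set.Icc 1 l) :=
    LipschitzOnWith.of_dist_le_mul fun s hs r hr => by
      have h1 : (0 : ℝ) < s := by linarith [hs.1]
      have h2 : (0 : ℝ) < r := by linarith [hr.1]
      rw [dist_eq_norm, ← sub_smul, norm_smul, inv_sub_inv h1.ne' h2.ne', coe_nnnorm, mul_comm,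
        dist_eq_norm]
      gcongr
      rw [norm_div, norm_sub_rev, Real.norm_of_nonneg (mul_pos h1 h2).le]
      refine div_le_self (norm_nonneg _) ?_
      nlinarith [hs.1, hr.1]
  have hgen : LipschitzOnWith 1 (realGen α) (Set.Ici 0) := by
    refine (convex_Ici 0).lipschitzOnWith_of_nnnorm_hasDerivWithin_le
      (f' := fun s => -(realGen α s ^ (1 - α)))
      (fun s hs => (hasDerivAt_realGen h.neg
        (by linarith [one_le_of_nonneg h.neg hs])).hasDerivWithinAt) fun s hs => ?_
    have hs' : (0 : ℝ) ≤ s := hs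
    have hp := realGen_pos (α := α) (s := s) (by linarith [one_le_of_nonneg h.neg hs'])
    rw [← NNReal.coe_le_coe, coe_nnnorm, norm_neg,
      Real.norm_of_nonneg (Real.rpow_nonneg hp.le _)]
    exact Real.rpow_le_one hp.le (realGen_le_one h.neg hs') (by linarith [h.neg])
  have hlip : LipschitzOnWith (1 * (C * ‖x‖₊)) (fun s : ℝ => f (s⁻¹ • x)) (Set.uIcc 1 l) := by
    rw [Set.uIcc_of_le hl]
    have := hgen.comp (hC.comp hpath (Set.mapsTo_image _ _)) fun s hs => h.toReal_nonneg (s⁻¹ • x)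
    intro s hs r hr
    simp only [h.f_of_mem (interior_subset (h.smul_inv_mem hx hs.1)),
      h.f_of_mem (interior_subset (h.smul_inv_mem hx hr.1))]
    exact this hs hr
  have hftc := hlip.absolutelyContinuousOnInterval.integral_deriv_eq_sub
  simp only [inv_one, one_smul] at hftc
  rw [← hftc]
  refine intervalIntegral.integral_congr_ae ?_
  filter_upwards [hd] with s hs hs2
  rw [Set.uIoc_of_le hl] at hs2
  exact (h.hasDerivAt_dilation (by linarith [hs2.1])
    (h.mem_interior_iff.1 (h.smul_inv_mem hx hs2.1.le)) (hs hs2)).deriv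

/-- Since `x/(1 + t)` is a convex combination of `x` and `0`, one has `φ(x/(1 + t)) ≤ φ(x) + tφ(0)`.
The estimate controls how far a dilation quotient can be negative. -/
theorem le_f_smul_inv {x : Euc n} {t : ℝ} (ht : 0 ≤ t) :
    (1 - t * (φ 0).toReal) * f x ≤ f ((1 + t)⁻¹ • x) := by
  by_cases hx : x ∈ effDom φ
  · have hl : 0 < 1 + t := by linarith
    have e : (1 + t)⁻¹ • x + (t * (1 + t)⁻¹) • (0 : Euc n) = (1 + t)⁻¹ • x := by simp
    have hsum : (1 + t)⁻¹ + t * (1 + t)⁻¹ = 1 := by field_simp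
    have hmem := h.convex hx h.zero_mem (by positivity : 0 ≤ (1 + t)⁻¹)
      (by positivity : 0 ≤ t * (1 + t)⁻¹) hsum
    have hle : (φ ((1 + t)⁻¹ • x + (t * (1 + t)⁻¹) • (0 : Euc n))).toReal ≤
        (1 + t)⁻¹ • (φ x).toReal + (t * (1 + t)⁻¹) • (φ 0).toReal :=
      h.conv.convexOn.2 hx h.zero_mem (by positivity) (by positivity) hsum
    rw [e] at hmem hle
    rw [h.f_of_mem hx, h.f_of_mem hmem]
    have h1 := h.toReal_nonneg x
    have h0 := h.toReal_nonneg 0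
    refine (le_realGen_add h.neg h1 (mul_nonneg ht h0)).trans
      (realGen_anti h.neg (hle.trans ?_) (by linarith [h.one_le ((1 + t)⁻¹ • x)]))
    have hi : (1 + t)⁻¹ ≤ 1 := inv_le_one_of_one_le₀ (by linarith)
    rw [smul_eq_mul, smul_eq_mul]
    have h2 : (1 + t)⁻¹ * (φ x).toReal ≤ 1 * (φ x).toReal := by gcongr
    have h3 : t * (1 + t)⁻¹ * (φ 0).toReal ≤ t * 1 * (φ 0).toReal := by gcongr
    linarith
  · rw [h.f_of_notMem hx, mul_zero]
    exact h.f_nonneg _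

end

end PertData

/-! ### Integrability of the radial derivative and Fubini along rays. -/

namespace PertData

variable {n : ℕ} {α : ℝ} {f : Euc n → ℝ} {φ ψ : Euc n → EReal} {β₁ β₂ m : ℝ}

section
variable (h : PertData α f φ ψ β₁ β₂ m)
include h

theorem tendsto_dilation {x : Euc n} (hx : gauge (effDom φ) x < 1)
    (hd : DifferentiableAt ℝ (fun z => (φ z).toReal) x) (b : ℝ) :
    Tendsto (fun t : ℝ => (f ((1 + t * b)⁻¹ • x) - f x) / t) (𝓝[>] 0)
      (𝓝 (b * radialDeriv f φ α x)) := by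
  have h1 := h.hasDerivAt_dilation (x := x) one_pos (by simpa using hx) (by simpa using hd)
  rw [inv_one, one_smul, div_one] at h1
  have h2 : HasDerivAt (fun t : ℝ => 1 + t * b) b 0 := by
    simpa using ((hasDerivAt_id (0 : ℝ)).mul_const b).const_add 1
  have h3 : HasDerivAt (fun s : ℝ => f (s⁻¹ • x)) (radialDeriv f φ α x) (1 + 0 * b) := by
    simpa using h1
  have h4 := (h3.comp (0 : ℝ) h2).tendsto_slope_zero_right
  rw [mul_comm] at h4
  refine h4.congr fun t => ?_
  simp [div_eq_inv_mul]

theorem measurableSet_gauge_lt : MeasurableSet {x | gauge (effDom φ) x < 1} :=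
  measurableSet_lt (continuous_gauge h.convex h.mem_nhds).measurable measurable_const

theorem integrable_radialDeriv (hi : Integrable f) : Integrable (radialDeriv f φ α) := by
  set I := {x | gauge (effDom φ) x < 1} with hI
  have hIm : MeasurableSet I := h.measurableSet_gauge_lt
  set k0 := (φ 0).toReal with hk0
  have hk0n : 0 ≤ k0 := h.toReal_nonneg 0
  set u : ℕ → ℝ := fun j => 1 / ((j : ℝ) + 1) with hu
  have hupos : ∀ j, 0 < u j := fun j => by rw [hu]; positivity
  have hu1 : ∀ j, u j ≤ 1 := fun j => by
    rw [hu]; exact (div_le_one (by positivity)).2 (by linarith [(Nat.cast_nonneg j : (0 : ℝ) ≤ j)])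
  have hut : Tendsto u atTop (𝓝[>] 0) :=
    tendsto_nhdsWithin_iff.2 ⟨tendsto_one_div_add_atTop_nhds_zero_nat, Eventually.of_forall hupos⟩
  -- The added multiple of `f` makes the quotients nonnegative, as Fatou's lemma requires. By
  -- scaling, their total integrals involve only `((1 + u j)^n - 1)/u j`, which stays bounded.
  set F : ℕ → Euc n → ℝ := fun j x => (f ((1 + u j)⁻¹ • x) - f x) / u j + k0 * f x with hF
  have hFnn : ∀ j x, 0 ≤ F j x := fun j x => by
    have := h.le_f_smul_inv (x := x) (hupos j).le
    have h2 : -k0 * f x ≤ (f ((1 + u j)⁻¹ • x) - f x) / u j := by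
      rw [le_div_iff₀ (hupos j)]
      linarith
    simp only [hF]
    linarith
  have hFi : ∀ j, Integrable (F j) := fun j => by
    have h1 : Integrable (fun x => f ((1 + u j)⁻¹ • x)) :=
      hi.comp_smul (by have := hupos j; positivity)
    exact ((h1.sub hi).div_const _).add (hi.const_mul k0)
  have hd : Module.finrank ℝ (Euc n) = n := finrank_euclideanSpace_fin
  have hint : ∀ j, ∫ x, F j x ≤ (2 ^ n * n + k0) * ∫ x, f x := by
    intro j
    have h1 : Integrable (fun x => f ((1 + u j)⁻¹ • x)) :=
      hi.comp_smul (by have := hupos j; positivity)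
    have hf0 : 0 ≤ ∫ x, f x := integral_nonneg h.f_nonneg
    have e1 : ∫ x, F j x = ((1 + u j) ^ n - 1) / u j * (∫ x, f x) + k0 * ∫ x, f x := by
      simp only [hF]
      rw [integral_add (f := fun x => (f ((1 + u j)⁻¹ • x) - f x) / u j)
        (g := fun x => k0 * f x) ((h1.sub hi).div_const _) (hi.const_mul k0), integral_div,
        integral_sub h1 hi, Measure.integral_comp_inv_smul_of_nonneg _ _ (by linarith [hupos j]),
        hd, integral_const_mul, smul_eq_mul]
      ring
    rw [e1, add_mul]
    gcongr
    rw [div_le_iff₀ (hupos j)]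
    have h2 : (1 + u j) ^ n - 1 = u j * ∑ i ∈ Finset.range n, (1 + u j) ^ i := by
      have := mul_geom_sum (1 + u j) n
      rw [← this]; ring
    have h3 : ∑ i ∈ Finset.range n, (1 + u j) ^ i ≤ ∑ i ∈ Finset.range n, (2 : ℝ) ^ n := by
      refine Finset.sum_le_sum fun i hi => ?_
      calc (1 + u j) ^ i ≤ 2 ^ i := by
            have := hupos j
            gcongr
            linarith [hu1 j]
        _ ≤ 2 ^ n := pow_le_pow_right₀ (by norm_num) (Finset.mem_range.1 hi).le
    rw [Finset.sum_const, Finset.card_range, nsmul_eq_mul] at h3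
    rw [h2]
    nlinarith [hupos j]
  have hlim : ∀ᵐ x ∂(volume.restrict I), Tendsto (fun j => F j x) atTop
      (𝓝 (radialDeriv f φ α x + k0 * f x)) := by
    filter_upwards [ae_restrict_mem hIm, ae_restrict_of_ae h.ae_differentiableAt_interior]
      with x hx hx2
    have := (h.tendsto_dilation hx (hx2 hx) 1).comp hut
    simp only [mul_one, one_mul, Function.comp_def] at this
    exact this.add_const _
  have h1 : Integrable (fun x => radialDeriv f φ α x + k0 * f x) (volume.restrict I) := by
    refine integrable_of_tendsto_of_integral_le (fun j => (hFi j).restrict)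
      (fun j => Eventually.of_forall (hFnn j)) (fun j => ?_) hlim (C := (2 ^ n * n + k0) * ∫ x, f x)
    exact (setIntegral_le_integral (hFi j) (Eventually.of_forall (hFnn j))).trans (hint j)
  have h2 : IntegrableOn (radialDeriv f φ α) I := by
    have := h1.sub ((hi.const_mul k0).restrict (s := I))
    refine this.congr (Eventually.of_forall fun x => ?_)
    simp
  rw [← integrable_indicator_iff hIm] at h2
  refine h2.congr ?_
  filter_upwards [h.ae_effDom_interior] with x hx
  by_cases hxI : x ∈ I
  · rw [Set.indicator_of_mem hxI]
  · rw [Set.indicator_of_notMem hxI, h.radialDeriv_of_notMem fun hxD => hxI (hx hxD)]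

theorem setIntegral_f_smul_inv_sub (hi : Integrable f) {l : ℝ} (hl : 1 ≤ l) :
    ∫ x in {x | gauge (effDom φ) x < 1}, (f (l⁻¹ • x) - f x) =
      ∫ s in (1 : ℝ)..l, (∫ x in {x | gauge (effDom φ) x < 1}, radialDeriv f φ α (s⁻¹ • x)) / s := by
  set I := {x | gauge (effDom φ) x < 1} with hI
  have hIm : MeasurableSet I := h.measurableSet_gauge_lt
  have hV := h.integrable_radialDeriv hi
  have hVm := h.measurable_radialDeriv
  have hd : Module.finrank ℝ (Euc n) = n := finrank_euclideanSpace_fin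
  have hprodm : Measurable fun z : Euc n × ℝ => radialDeriv f φ α (z.2⁻¹ • z.1) / z.2 :=
    (hVm.comp (by fun_prop)).div (by fun_prop)
  have hprod : Integrable (Function.uncurry fun (s : ℝ) (x : Euc n) =>
      radialDeriv f φ α (s⁻¹ • x) / s) ((volume.restrict (Set.uIoc 1 l)).prod (volume.restrict I)) := by
    rw [Set.uIoc_of_le hl]
    have hm2 : Measurable (Function.uncurry fun (s : ℝ) (x : Euc n) =>
      radialDeriv f φ α (s⁻¹ • x) / s) := hprodm.comp measurable_swap
    have hs : ∀ s ∈ Set.Ioc 1 l, Integrable (fun x => radialDeriv f φ α (s⁻¹ • x) / s) := by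
      intro s hs
      have : s⁻¹ ≠ 0 := inv_ne_zero (by linarith [hs.1])
      exact (hV.comp_smul this).div_const s
    rw [integrable_prod_iff hm2.aestronglyMeasurable]
    constructor
    · filter_upwards [ae_restrict_mem measurableSet_Ioc] with s h1
      exact (hs s h1).restrict
    · refine Integrable.mono' (g := fun _ => l ^ n * ∫ x, |radialDeriv f φ α x|)
        (integrable_const _) ?_ ?_
      · exact (hm2.norm.stronglyMeasurable.integral_prod_right
          (ν := volume.restrict I)).aestronglyMeasurable
      · filter_upwards [ae_restrict_mem measurableSet_Ioc] with s h1
        have hs0 : 0 < s := by linarith [h1.1]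
        rw [Real.norm_of_nonneg (integral_nonneg fun x => norm_nonneg _)]
        calc ∫ x in I, ‖radialDeriv f φ α (s⁻¹ • x) / s‖
            ≤ ∫ x, ‖radialDeriv f φ α (s⁻¹ • x) / s‖ :=
              setIntegral_le_integral (hs s h1).norm (Eventually.of_forall fun x => norm_nonneg _)
          _ = s ^ n * (∫ x, |radialDeriv f φ α x|) / s := by
              have := Measure.integral_comp_inv_smul_of_nonneg (volume : Measure (Euc n))
                (fun x => |radialDeriv f φ α x| / s) hs0.le
              rw [hd, smul_eq_mul, integral_div (f := fun x => |radialDeriv f φ α x|)] at this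
              rw [mul_div_assoc, ← this]
              refine integral_congr_ae (Eventually.of_forall fun x => ?_)
              simp [abs_of_pos hs0]
          _ ≤ s ^ n * (∫ x, |radialDeriv f φ α x|) := by
              refine div_le_self ?_ h1.1.le
              have : 0 ≤ ∫ x, |radialDeriv f φ α x| := integral_nonneg fun x => abs_nonneg _
              positivity
          _ ≤ _ := by
              have : 0 ≤ ∫ x, |radialDeriv f φ α x| := integral_nonneg fun x => abs_nonneg _
              gcongr
              exact h1.2
  have hswap := intervalIntegral_integral_swap (μ := volume.restrict I) hprod
  -- For each fixed `s` the exceptional set is a dilate of a null set; exchanging the two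
  -- quantifiers gives the claim on almost every ray.
  have hae : ∀ᵐ x : Euc n, ∀ᵐ s : ℝ, s ∈ Set.Ioc 1 l → gauge (effDom φ) (s⁻¹ • x) < 1 →
      DifferentiableAt ℝ (fun z => (φ z).toReal) (s⁻¹ • x) := by
    have hsm : Measurable fun z : Euc n × ℝ => z.2⁻¹ • z.1 := by fun_prop
    have h1 : MeasurableSet {z : Euc n × ℝ | gauge (effDom φ) (z.2⁻¹ • z.1) < 1} := hsm hIm
    have h2 : MeasurableSet {z : Euc n × ℝ |
        DifferentiableAt ℝ (fun z => (φ z).toReal) (z.2⁻¹ • z.1)} :=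
      hsm (measurableSet_of_differentiableAt ℝ _)
    have h3 : MeasurableSet {z : Euc n × ℝ | z.2 ∈ Set.Ioc 1 l} := measurable_snd measurableSet_Ioc
    refine (Measure.ae_ae_comm (h3.imp (h1.imp h2))).2 (Eventually.of_forall fun s => ?_)
    by_cases hs : s ∈ Set.Ioc 1 l
    · have hs0 : s⁻¹ ≠ 0 := inv_ne_zero (by linarith [hs.1])
      have h4 := h.ae_differentiableAt_interior
      rw [ae_iff] at h4 ⊢
      have h5 := Measure.addHaar_preimage_smul (volume : Measure (Euc n)) hs0
        {x | ¬(gauge (effDom φ) x < 1 → DifferentiableAt ℝ (fun z => (φ z).toReal) x)}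
      rw [h4, mul_zero] at h5
      refine measure_mono_null (fun x hx => ?_) h5
      exact fun hx2 => hx fun _ => hx2
    · exact Eventually.of_forall fun x hx => absurd hx hs
  calc ∫ x in I, (f (l⁻¹ • x) - f x)
      = ∫ x in I, ∫ s in (1 : ℝ)..l, radialDeriv f φ α (s⁻¹ • x) / s := by
        refine setIntegral_congr_ae hIm ?_
        filter_upwards [hae] with x hx hxI
        refine h.f_smul_inv_sub hxI hl ?_
        filter_upwards [hx] with s hs hs1
        exact hs hs1 (h.mem_interior_iff.1 (h.smul_inv_mem hxI hs1.1.le))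
    _ = ∫ s in (1 : ℝ)..l, ∫ x in I, radialDeriv f φ α (s⁻¹ • x) / s := hswap.symm
    _ = _ := by simp_rw [integral_div]

end

end PertData

/-! ### The interior contribution. -/

namespace PertData

variable {n : ℕ} {α : ℝ} {f : Euc n → ℝ} {φ ψ : Euc n → EReal} {β₁ β₂ m : ℝ}

section
variable (h : PertData α f φ ψ β₁ β₂ m)
include h

theorem setIntegral_radialDeriv_smul_inv {s : ℝ} (hs : 0 < s) :
    ∫ x in {x | gauge (effDom φ) x < 1}, radialDeriv f φ α (s⁻¹ • x) =
      s ^ n * ∫ x, {x | gauge (effDom φ) (s • x) < 1}.indicator (radialDeriv f φ α) x := by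
  have hd : Module.finrank ℝ (Euc n) = n := finrank_euclideanSpace_fin
  have h1 := Measure.integral_comp_inv_smul_of_nonneg (volume : Measure (Euc n))
    ({x | gauge (effDom φ) (s • x) < 1}.indicator (radialDeriv f φ α)) hs.le
  rw [hd, smul_eq_mul] at h1
  rw [← h1, ← integral_indicator h.measurableSet_gauge_lt]
  refine integral_congr_ae (Eventually.of_forall fun x => ?_)
  simp [Set.indicator_apply, smul_inv_smul₀ hs.ne']

/-- After substitution the dilation acts on the region only, as `{g(s x) < 1}`. Its indicator is
eventually constant at each point as `s` decreases to `1`, so no continuity of the radial derivative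
is needed. -/
theorem continuousWithinAt_setIntegral_radialDeriv (hi : Integrable f) :
    ContinuousWithinAt (fun s : ℝ =>
      (∫ x in {x | gauge (effDom φ) x < 1}, radialDeriv f φ α (s⁻¹ • x)) / s)
      (Set.Ioi 1) 1 := by
  have hV := h.integrable_radialDeriv hi
  have hc := continuous_gauge h.convex h.mem_nhds
  have h1 : Tendsto (fun s : ℝ =>
      ∫ x, {x | gauge (effDom φ) (s • x) < 1}.indicator (radialDeriv f φ α) x) (𝓝[>] 1)
      (𝓝 (∫ x, {x | gauge (effDom φ) ((1 : ℝ) • x) < 1}.indicator (radialDeriv f φ α) x)) := by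
    refine tendsto_integral_filter_of_dominated_convergence (fun x => ‖radialDeriv f φ α x‖)
      (Eventually.of_forall fun s => ?_) (Eventually.of_forall fun s => ?_) hV.norm ?_
    · refine hV.1.indicator ?_
      exact measurableSet_lt (by fun_prop) measurable_const
    · exact Eventually.of_forall fun x => norm_indicator_le_norm_self _ _
    · refine Eventually.of_forall fun x => ?_
      refine Tendsto.congr' ?_ tendsto_const_nhds
      by_cases hx : gauge (effDom φ) x < 1
      · have : Tendsto (fun s : ℝ => gauge (effDom φ) (s • x)) (𝓝[>] 1)
            (𝓝 (gauge (effDom φ) ((1 : ℝ) • x))) :=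
          ((hc.comp (by fun_prop : Continuous fun s : ℝ => s • x)).tendsto 1).mono_left
            nhdsWithin_le_nhds
        rw [one_smul] at this
        filter_upwards [this.eventually_lt_const hx] with s hs
        simp [hs, hx]
      · filter_upwards [self_mem_nhdsWithin] with s hs
        have hs1 : (1 : ℝ) < s := hs
        have : ¬ gauge (effDom φ) (s • x) < 1 := by
          rw [gauge_smul_of_nonneg (by linarith), smul_eq_mul]
          have := not_lt.1 hx
          nlinarith
        simp [this, hx]
  have h2 : Tendsto (fun s : ℝ => s ^ n *
      (∫ x, {x | gauge (effDom φ) (s • x) < 1}.indicator (radialDeriv f φ α) x) / s) (𝓝[>] 1)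
      (𝓝 (1 ^ n * (∫ x, {x | gauge (effDom φ) ((1 : ℝ) • x) < 1}.indicator
        (radialDeriv f φ α) x) / 1)) := by
    have hid : Tendsto (fun s : ℝ => s) (𝓝[>] 1) (𝓝 1) := nhdsWithin_le_nhds
    exact ((hid.pow n).mul h1).div hid one_ne_zero
  rw [ContinuousWithinAt]
  beta_reduce
  rw [h.setIntegral_radialDeriv_smul_inv one_pos]
  refine h2.congr' ?_
  filter_upwards [self_mem_nhdsWithin] with s hs
  rw [h.setIntegral_radialDeriv_smul_inv (by linarith [Set.mem_Ioi.1 hs])]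

/-- Scaling alone would compute the integral over the whole space and so include the mass pushed
across the boundary. On the fixed region the limit is the right derivative of an integral over the
dilation factor. -/
theorem tendsto_setIntegral_dilation (hi : Integrable f) :
    Tendsto (fun t : ℝ =>
      ∫ x in {x | gauge (effDom φ) x < 1}, (f ((1 + t * β₁)⁻¹ • x) - f x) / t) (𝓝[>] 0)
      (𝓝 (β₁ * ∫ x in {x | gauge (effDom φ) x < 1}, radialDeriv f φ α x)) := by
  set J : ℝ → ℝ := fun s =>
    (∫ x in {x | gauge (effDom φ) x < 1}, radialDeriv f φ α (s⁻¹ • x)) / s with hJ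
  have hJm : Measurable J := by
    have : StronglyMeasurable (Function.uncurry fun (s : ℝ) (x : Euc n) =>
        radialDeriv f φ α (s⁻¹ • x)) :=
      (h.measurable_radialDeriv.comp (by fun_prop :
        Measurable fun z : ℝ × Euc n => z.1⁻¹ • z.2)).stronglyMeasurable
    exact (this.integral_prod_right (ν := volume.restrict _)).measurable.div measurable_id
  have h1 : HasDerivWithinAt (fun u => ∫ s in (1 : ℝ)..u, J s) (J 1) (Set.Ici (1 + 0 * β₁))
      (1 + 0 * β₁) := by
    rw [zero_mul, add_zero]
    exact intervalIntegral.integral_hasDerivWithinAt_right (IntervalIntegrable.refl)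
      (hJm.stronglyMeasurable.stronglyMeasurableAtFilter)
      (h.continuousWithinAt_setIntegral_radialDeriv hi)
  have h2 : HasDerivWithinAt (fun t : ℝ => 1 + t * β₁) β₁ (Set.Ici 0) 0 := by
    simpa using (((hasDerivAt_id (0 : ℝ)).mul_const β₁).const_add 1).hasDerivWithinAt
  have h3 := h1.comp (0 : ℝ) h2 (fun t ht => by
    have := h.pos₁
    have ht' : (0 : ℝ) ≤ t := ht
    simp only [Set.mem_Ici]
    nlinarith)
  rw [hasDerivWithinAt_iff_tendsto_slope, Set.Ici_sdiff_left] at h3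
  have h4 : J 1 * β₁ = β₁ * ∫ x in {x | gauge (effDom φ) x < 1}, radialDeriv f φ α x := by
    simp [hJ, mul_comm]
  rw [h4] at h3
  refine h3.congr' ?_
  filter_upwards [self_mem_nhdsWithin] with t ht
  have ht' : (0 : ℝ) < t := ht
  have := h.pos₁
  rw [integral_div, h.setIntegral_f_smul_inv_sub hi (by nlinarith)]
  simp [slope, hJ, div_eq_inv_mul]

/-- The contribution of the interior of the domain to the first variation. -/
theorem interior_variation (hi : Integrable f) :
    IntegrableOn (fun x => (legendre ψ (grad φ x)).toReal * f x ^ (1 - α))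
        {x | gauge (effDom φ) x < 1} ∧
      Tendsto (fun t : ℝ => ∫ x in {x | gauge (effDom φ) x < 1}, (pert α φ ψ t x - f x) / t)
        (𝓝[>] 0) (𝓝 (∫ x in {x | gauge (effDom φ) x < 1},
          (legendre ψ (grad φ x)).toReal * f x ^ (1 - α))) := by
  set I := {x | gauge (effDom φ) x < 1} with hI
  have hIm : MeasurableSet I := h.measurableSet_gauge_lt
  set k0 := (φ 0).toReal with hk0
  have hk0n : 0 ≤ k0 := h.toReal_nonneg 0
  have hV := h.integrable_radialDeriv hi
  set C : ℝ → ℝ := fun t => (1 + α * (t * β₂)) ^ (1 / α) with hC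
  have hC0 : C 0 = 1 := by simp [hC]
  have hCd : HasDerivAt C β₂ 0 := by
    have h1 : HasDerivAt (fun t : ℝ => 1 + α * (t * β₂)) (α * β₂) 0 := by
      simpa using (((hasDerivAt_id (0 : ℝ)).mul_const β₂).const_mul α).const_add 1
    have := h1.rpow_const (p := 1 / α) (Or.inl (by simp))
    have e : α * β₂ * (1 / α) * (1 + α * (0 * β₂)) ^ (1 / α - 1) = β₂ := by
      have := h.neg.ne
      simp
      field_simp
    rwa [e] at this
  have hClim : Tendsto C (𝓝[>] 0) (𝓝 1) :=
    hC0 ▸ (hCd.continuousAt.tendsto.mono_left nhdsWithin_le_nhds)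
  have hCslope : Tendsto (fun t => (C t - 1) / t) (𝓝[>] 0) (𝓝 β₂) := by
    refine hCd.tendsto_slope_zero_right.congr fun t => ?_
    simp [hC0, div_eq_inv_mul]
  set D : ℝ → Euc n → ℝ := fun t x => (f ((1 + t * β₁)⁻¹ • x) - f x) / t with hD
  have hDi : ∀ t, 0 < t → Integrable (D t) := fun t ht => by
    have := h.pos₁
    have h1 : Integrable (fun x => f ((1 + t * β₁)⁻¹ • x)) := hi.comp_smul (by positivity)
    exact (h1.sub hi).div_const _
  -- The three terms pay for the prefactor `C t`, for the possible negativity of the dilation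
  -- quotient, and for the lower bound on `f_t`.
  set a : ℝ → ℝ := fun t => (C t - 1) / t + C t * (β₁ * k0) + m with ha
  have halim : Tendsto a (𝓝[>] 0) (𝓝 (β₂ + 1 * (β₁ * k0) + m)) :=
    (hCslope.add (hClim.mul_const _)).add_const _
  refine tendsto_integral_of_dominated_by_convergent (μ := volume.restrict I)
    (F := fun t x => (pert α φ ψ t x - f x) / t) (G := fun t x => C t * D t x + a t * f x)
    (g := fun x => 1 * (β₁ * radialDeriv f φ α x) + (β₂ + 1 * (β₁ * k0) + m) * f x) ?_ ?_ ?_ ?_ ?_ ?_ ?_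
  · refine Eventually.of_forall fun t => ?_
    exact (((measurable_pert t).sub h.measurable_f).div_const t).aestronglyMeasurable
  · filter_upwards [self_mem_nhdsWithin] with t ht
    exact (((hDi t ht).const_mul _).add (hi.const_mul _)).restrict
  · exact (((hV.const_mul _).const_mul _).add (hi.const_mul _)).restrict
  · filter_upwards [eventually_pos α β₂] with t ht
    obtain ⟨ht, ht2⟩ := ht
    have hC1 : 1 ≤ C t := by
      refine Real.one_le_rpow_of_pos_of_le_one_of_nonpos ht2 ?_ ?_
      · have := mul_nonneg ht.le h.nonneg₂
        nlinarith [h.neg]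
      · exact (one_div_neg.2 h.neg).le
    filter_upwards [ae_restrict_mem hIm] with x hx
    have hx' : gauge (effDom φ) x < 1 := hx
    have hb : 0 ≤ t * β₁ := mul_nonneg ht.le h.pos₁.le
    have hup := h.pert_le ht ht2 (x := x) (by linarith)
    have hlo := h.le_pert ht ht2 x
    have hdil := h.le_f_smul_inv (x := x) hb
    have hf0 := h.f_nonneg x
    have hD1 : t * D t x = f ((1 + t * β₁)⁻¹ • x) - f x := by
      simp only [hD]; field_simp
    have e : t * (C t * D t x + a t * f x) = C t * (f ((1 + t * β₁)⁻¹ • x) - f x) +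
        (C t - 1 + t * (C t * (β₁ * k0)) + t * m) * f x := by
      rw [← hD1]
      simp only [ha]
      field_simp
    have h1 : 0 ≤ (C t - 1) * f x := mul_nonneg (by linarith) hf0
    have h2 : 0 ≤ t * (C t * (β₁ * k0)) * f x := by
      have := h.pos₁
      positivity
    have h3 : 0 ≤ t * m * f x := mul_nonneg (mul_nonneg ht.le h.nonneg_m) hf0
    have h4 : 0 ≤ C t * (f ((1 + t * β₁)⁻¹ • x) - (1 - t * β₁ * k0) * f x) :=
      mul_nonneg (by linarith) (by linarith)
    have hup' : pert α φ ψ t x ≤ C t * f ((1 + t * β₁)⁻¹ • x) := hup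
    rw [abs_div, abs_of_pos ht, div_le_iff₀ ht, mul_comm _ t, e, abs_le]
    constructor <;> linarith
  · filter_upwards [ae_restrict_mem hIm, ae_restrict_of_ae h.ae_differentiableAt_interior]
      with x hx hx2
    exact h.tendsto_interior hx (hx2 hx)
  · filter_upwards [ae_restrict_mem hIm, ae_restrict_of_ae h.ae_differentiableAt_interior]
      with x hx hx2
    exact (hClim.mul (h.tendsto_dilation hx (hx2 hx) β₁)).add (halim.mul_const _)
  · have h1 : Tendsto (fun t => C t * (∫ x in I, D t x) + a t * ∫ x in I, f x) (𝓝[>] 0)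
        (𝓝 (1 * (β₁ * ∫ x in I, radialDeriv f φ α x) +
          (β₂ + 1 * (β₁ * k0) + m) * ∫ x in I, f x)) :=
      (hClim.mul (h.tendsto_setIntegral_dilation hi)).add (halim.mul_const _)
    have e : ∫ x in I, (1 * (β₁ * radialDeriv f φ α x) + (β₂ + 1 * (β₁ * k0) + m) * f x) =
        1 * (β₁ * ∫ x in I, radialDeriv f φ α x) + (β₂ + 1 * (β₁ * k0) + m) * ∫ x in I, f x := by
      rw [integral_add ((hV.const_mul _).const_mul _).restrict (hi.const_mul _).restrict,
        integral_const_mul, integral_const_mul, integral_const_mul]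
    rw [e]
    refine h1.congr' ?_
    filter_upwards [self_mem_nhdsWithin] with t ht
    rw [integral_add ((hDi t ht).const_mul _).restrict (hi.const_mul _).restrict,
      integral_const_mul, integral_const_mul]

end

end PertData

/-! ### Coordinates outside a convex set. -/

section PolarExterior

variable {E : Type*} [NormedAddCommGroup E] [InnerProductSpace ℝ E] [FiniteDimensional ℝ E]
  [MeasurableSpace E] [BorelSpace E] {K : Set E}

theorem lintegral_Ioi_comp_affine {ρ t : ℝ} (hρ : 0 < ρ) (ht : 0 < t) (Φ : ℝ → ENNReal) :
    ∫⁻ r in Set.Ioi ρ, Φ r =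
      ∫⁻ κ in Set.Ioi (0 : ℝ), ENNReal.ofReal (t * ρ) * Φ ((1 + t * κ) * ρ) := by
  have himg : (fun κ : ℝ => (1 + t * κ) * ρ) '' Set.Ioi 0 = Set.Ioi ρ := by
    ext r
    constructor
    · rintro ⟨κ, hκ, rfl⟩
      have hκ' : 0 < κ := hκ
      have : 0 < t * κ * ρ := by positivity
      simp only [Set.mem_Ioi]
      linarith
    · intro hr
      have hr' : ρ < r := hr
      refine ⟨(r / ρ - 1) / t, ?_, ?_⟩
      · have : 1 < r / ρ := (one_lt_div hρ).2 hr'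
        exact div_pos (by linarith) ht
      · field_simp
        ring
  have hd : ∀ κ ∈ Set.Ioi (0 : ℝ),
      HasDerivWithinAt (fun κ : ℝ => (1 + t * κ) * ρ) (t * ρ) (Set.Ioi 0) κ := fun κ _ => by
    simpa using ((((hasDerivAt_id κ).const_mul t).const_add 1).mul_const ρ).hasDerivWithinAt
  have hinj : Set.InjOn (fun κ : ℝ => (1 + t * κ) * ρ) (Set.Ioi 0) := fun a _ b _ hab => by
    have h1 := mul_right_cancel₀ hρ.ne' hab
    exact mul_left_cancel₀ ht.ne' (by linarith)
  rw [← himg, lintegral_image_eq_lintegral_abs_deriv_mul measurableSet_Ioi hd hinj,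
    abs_of_pos (mul_pos ht hρ)]

/-- Integration over the complement of a convex body in coordinates adapted to its gauge. -/
theorem lintegral_one_lt_gauge [Nontrivial E] (hK : Convex ℝ K) (h0 : K ∈ 𝓝 0) {t : ℝ}
    (ht : 0 < t) {F : E → ENNReal} (hF : Measurable F) :
    ∫⁻ x in {x | 1 < gauge K x}, F x =
      ∫⁻ θ : Metric.sphere (0 : E) 1, (∫⁻ κ in Set.Ioi (0 : ℝ),
        ENNReal.ofReal (t * ((gauge K θ)⁻¹ ^ Module.finrank ℝ E *
          (1 + t * κ) ^ (Module.finrank ℝ E - 1))) *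
        F ((1 + t * κ) • (gauge K θ)⁻¹ • (θ : E))) ∂(volume : Measure E).toSphere := by
  obtain ⟨d, hd⟩ := Nat.exists_eq_succ_of_ne_zero (Module.finrank_pos (R := ℝ) (M := E)).ne'
  have hm : MeasurableSet {x | 1 < gauge K x} :=
    measurableSet_lt measurable_const (continuous_gauge hK h0).measurable
  rw [← lintegral_indicator hm, lintegral_polar (hF.indicator hm)]
  refine lintegral_congr fun θ => ?_
  rw [hd, Nat.succ_sub_one]
  -- A ray on which the gauge vanishes never leaves the set; both sides are then `0`, thanks to `0⁻¹
  -- = 0` and the positive dimension.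
  rcases (gauge_nonneg (s := K) (θ : E)).eq_or_lt with hc | hc
  · rw [← hc]
    simp only [inv_zero, Nat.succ_eq_add_one, ne_eq, Nat.add_eq_zero_iff, one_ne_zero, and_false,
      not_false_eq_true, zero_pow, zero_mul, mul_zero, ENNReal.ofReal_zero, lintegral_zero]
    refine setLIntegral_eq_zero measurableSet_Ioi fun r hr => ?_
    have hr' : (0 : ℝ) < r := hr
    simp [gauge_smul_of_nonneg hr'.le, ← hc]
  · set ρ := (gauge K (θ : E))⁻¹ with hρ
    have hρ0 : 0 < ρ := inv_pos.2 hc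
    have e1 : ∫⁻ r in Set.Ioi (0 : ℝ), ENNReal.ofReal (r ^ d) *
        {x | 1 < gauge K x}.indicator F (r • (θ : E)) =
        ∫⁻ r in Set.Ioi ρ, ENNReal.ofReal (r ^ d) * F (r • (θ : E)) := by
      rw [← lintegral_indicator measurableSet_Ioi, ← lintegral_indicator measurableSet_Ioi]
      refine lintegral_congr fun r => ?_
      by_cases hr : r ∈ Set.Ioi ρ
      · have hr0 : r ∈ Set.Ioi (0 : ℝ) := hρ0.trans hr
        have : r • (θ : E) ∈ {x | 1 < gauge K x} := by
          have hr1 : (gauge K (θ : E))⁻¹ < r := hr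
          rw [Set.mem_ofPred_eq, gauge_smul_of_nonneg (le_of_lt hr0), smul_eq_mul]
          rwa [inv_lt_iff_one_lt_mul₀ hc] at hr1
        rw [Set.indicator_of_mem hr, Set.indicator_of_mem hr0, Set.indicator_of_mem this]
      · rw [Set.indicator_of_notMem hr]
        by_cases hr0 : r ∈ Set.Ioi (0 : ℝ)
        · have : r • (θ : E) ∉ {x | 1 < gauge K x} := by
            intro hcon
            rw [Set.mem_ofPred_eq, gauge_smul_of_nonneg (le_of_lt hr0), smul_eq_mul,
              ← inv_lt_iff_one_lt_mul₀ hc] at hcon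
            exact hr hcon
          rw [Set.indicator_of_mem hr0, Set.indicator_of_notMem this, mul_zero]
        · rw [Set.indicator_of_notMem hr0]
    rw [e1, lintegral_Ioi_comp_affine hρ0 ht]
    refine setLIntegral_congr_fun measurableSet_Ioi fun κ hκ => ?_
    have hκ' : (0 : ℝ) < κ := hκ
    rw [← mul_assoc, ← ENNReal.ofReal_mul (by positivity), smul_smul]
    congr 2
    rw [Nat.succ_eq_add_one, mul_pow]
    ring

end PolarExterior

/-! ### Homogeneity and measurability of support functions. -/

section SupportFun

variable {n : ℕ} {A : Set (Euc n)}

theorem supportFun_smul_le {c : ℝ} (hc : 0 < c) (u : Euc n) :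
    supportFun A (c • u) ≤ (c : EReal) * supportFun A u := by
  refine iSup₂_le fun y hy => ?_
  rw [inner_smul_left, EReal.coe_mul]
  exact mul_le_mul_of_nonneg_left
    (le_iSup₂ (f := fun (y : Euc n) (_ : y ∈ A) => ((inner ℝ u y : ℝ) : EReal)) y hy)
    (by exact_mod_cast hc.le)

theorem supportFun_smul {c : ℝ} (hc : 0 < c) (u : Euc n) :
    supportFun A (c • u) = (c : EReal) * supportFun A u := by
  refine (supportFun_smul_le hc u).antisymm ?_
  have h1 := supportFun_smul_le (A := A) (inv_pos.2 hc) (c • u)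
  rw [inv_smul_smul₀ hc.ne'] at h1
  calc (c : EReal) * supportFun A u ≤ (c : EReal) * (((c⁻¹ : ℝ) : EReal) * supportFun A (c • u)) :=
        mul_le_mul_of_nonneg_left h1 (by exact_mod_cast hc.le)
    _ = supportFun A (c • u) := by
        rw [← mul_assoc, ← EReal.coe_mul, mul_inv_cancel₀ hc.ne', EReal.coe_one, one_mul]

theorem measurable_supportFun : Measurable (supportFun A) := by
  have : LowerSemicontinuous (supportFun A) := by
    refine lowerSemicontinuous_biSup fun y _ => Continuous.lowerSemicontinuous ?_
    exact continuous_coe_real_ereal.comp (by fun_prop)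
  exact this.measurable

end SupportFun

/-! ### The outer layer along a single ray. -/

namespace PertData

variable {n : ℕ} {α : ℝ} {f : Euc n → ℝ} {φ ψ : Euc n → EReal} {β₁ β₂ m : ℝ}

/-- The decay of `f` absorbs the Jacobian: `ρ ≤ 2(1 + sρ)`, while `f` is at most `C(1 + sρ)^(-n)`.
The bound is uniform in `ρ`, so unbounded domains are covered. -/
theorem pow_mul_le_of_decay {C : ℝ} (hf : ∀ x, 0 ≤ f x) (hα : 1 / α ≤ -(n : ℝ)) (hC0 : 0 ≤ C)
    (hC : ∀ x, f x ≤ C * (1 + ‖x‖) ^ (1 / α)) {ρ s : ℝ} (hρ : 0 ≤ ρ) (hs : 1 / 2 ≤ s)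
    {θ : Euc n} (hθ : ‖θ‖ = 1) : ρ ^ n * f (s • ρ • θ) ≤ C * 2 ^ n := by
  have hnorm : ‖s • ρ • θ‖ = s * ρ := by
    rw [norm_smul, norm_smul, hθ, mul_one, Real.norm_of_nonneg (by linarith),
      Real.norm_of_nonneg hρ]
  have h0 : 0 ≤ s * ρ := mul_nonneg (by linarith) hρ
  have h1 : f (s • ρ • θ) ≤ C * ((1 + s * ρ) ^ n)⁻¹ := by
    refine (hC _).trans ?_
    rw [hnorm, ← Real.rpow_natCast, ← Real.rpow_neg (by linarith)]
    gcongr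
    linarith
  have h2 : ρ ^ n ≤ 2 ^ n * (1 + s * ρ) ^ n := by
    rw [← mul_pow]
    gcongr
    nlinarith
  have h3 := hf (s • ρ • θ)
  calc ρ ^ n * f (s • ρ • θ) ≤ (2 ^ n * (1 + s * ρ) ^ n) * (C * ((1 + s * ρ) ^ n)⁻¹) := by
        gcongr
    _ = C * 2 ^ n := by
        have : (1 + s * ρ) ^ n ≠ 0 := by positivity
        field_simp

section
variable (h : PertData α f φ ψ β₁ β₂ m)
include h

omit h in
theorem gauge_inv_smul {θ : Euc n} (hθ : 0 < gauge (effDom φ) θ) :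
    gauge (effDom φ) ((gauge (effDom φ) θ)⁻¹ • θ) = 1 := by
  rw [gauge_smul_of_nonneg (by positivity), smul_eq_mul, inv_mul_cancel₀ hθ.ne']

/-- For `κ < β₁` the dilation bound on `f_t` meets the decay of `f`, the dilation ratio being at
least `1/2`. For `κ > β₁` the dilated argument lies outside the domain and the bound is `0`. -/
theorem pert_polar_le {C : ℝ} (hα : 1 / α ≤ -(n : ℝ)) (hC0 : 0 ≤ C)
    (hC : ∀ x, f x ≤ C * (1 + ‖x‖) ^ (1 / α)) (hn : n ≠ 0) {t κ : ℝ} (ht : 0 < t)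
    (ht2 : 0 < 1 + α * (t * β₂)) (hCt : (1 + α * (t * β₂)) ^ (1 / α) ≤ 2) (htβ : t * β₁ ≤ 1)
    (hκ : 0 < κ) (hκβ : κ ≠ β₁) {θ : Euc n} (hθ : ‖θ‖ = 1) :
    (gauge (effDom φ) θ)⁻¹ ^ n * (1 + t * κ) ^ (n - 1) *
      pert α φ ψ t ((1 + t * κ) • (gauge (effDom φ) θ)⁻¹ • θ) ≤
    (Set.Ioc 0 β₁).indicator (fun _ => 2 ^ (n - 1) * (2 * (C * 2 ^ n))) κ := by
  have hB : 0 ≤ (Set.Ioc 0 β₁).indicator (fun _ => 2 ^ (n - 1) * (2 * (C * 2 ^ n))) κ :=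
    Set.indicator_nonneg (fun _ _ => by positivity) _
  rcases (gauge_nonneg (s := effDom φ) θ).eq_or_lt with hc | hc
  · rw [← hc]
    simpa [hn] using hB
  set ρ := (gauge (effDom φ) θ)⁻¹ with hρ
  have hρ0 : 0 < ρ := inv_pos.2 hc
  have hg : gauge (effDom φ) (ρ • θ) = 1 := gauge_inv_smul hc
  have htκ : 0 < t * κ := mul_pos ht hκ
  have htb : 0 < t * β₁ := mul_pos ht h.pos₁
  have hg2 : ∀ s : ℝ, 0 ≤ s → gauge (effDom φ) (s • ρ • θ) = s := fun s hs => by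
    rw [gauge_smul_of_nonneg hs, hg, smul_eq_mul, mul_one]
  have hle := h.pert_le ht ht2 (x := (1 + t * κ) • ρ • θ) (by
    rw [hg2 _ (by linarith)]
    intro hcon
    exact hκβ (mul_left_cancel₀ ht.ne' (by linarith)))
  rw [smul_smul (1 + t * β₁)⁻¹] at hle
  rcases lt_or_gt_of_ne hκβ with hlt | hgt
  · rw [Set.indicator_of_mem (show κ ∈ Set.Ioc 0 β₁ from ⟨hκ, hlt.le⟩)]
    have hlt' : t * κ < t * β₁ := mul_lt_mul_of_pos_left hlt ht
    have hs : 1 / 2 ≤ (1 + t * β₁)⁻¹ * (1 + t * κ) := by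
      rw [inv_mul_eq_div, le_div_iff₀ (by linarith)]
      linarith
    have hdec := pow_mul_le_of_decay h.f_nonneg hα hC0 hC hρ0.le hs hθ
    have hf0 := h.f_nonneg (((1 + t * β₁)⁻¹ * (1 + t * κ)) • ρ • θ)
    have hp := h.pert_nonneg ht ht2 ((1 + t * κ) • ρ • θ)
    calc ρ ^ n * (1 + t * κ) ^ (n - 1) * pert α φ ψ t ((1 + t * κ) • ρ • θ)
        = (1 + t * κ) ^ (n - 1) * (ρ ^ n * pert α φ ψ t ((1 + t * κ) • ρ • θ)) := by ring
      _ ≤ 2 ^ (n - 1) * (ρ ^ n * (2 * f (((1 + t * β₁)⁻¹ * (1 + t * κ)) • ρ • θ))) := by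
          gcongr
          · linarith
          · exact hle.trans (by gcongr)
      _ = 2 ^ (n - 1) * (2 * (ρ ^ n * f (((1 + t * β₁)⁻¹ * (1 + t * κ)) • ρ • θ))) := by ring
      _ ≤ _ := by gcongr
  · have hgt' : t * β₁ < t * κ := mul_lt_mul_of_pos_left hgt ht
    have hz : f (((1 + t * β₁)⁻¹ * (1 + t * κ)) • ρ • θ) = 0 := by
      refine h.f_of_notMem fun hmem => ?_
      have h1 := gauge_le_one hmem
      rw [hg2 _ (by positivity), inv_mul_eq_div, div_le_one (by linarith)] at h1
      linarith
    rw [hz, mul_zero] at hle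
    refine le_trans ?_ hB
    have : 0 ≤ ρ ^ n * (1 + t * κ) ^ (n - 1) := by positivity
    exact mul_nonpos_of_nonneg_of_nonpos this hle

omit h in
theorem eventually_rpow_le_two (α β₁ β₂ : ℝ) :
    ∀ᶠ t in 𝓝[>] (0 : ℝ), (1 + α * (t * β₂)) ^ (1 / α) ≤ 2 ∧ t * β₁ ≤ 1 := by
  have h1 : Tendsto (fun t : ℝ => (1 + α * (t * β₂)) ^ (1 / α)) (𝓝[>] 0) (𝓝 1) := by
    have h2 : Tendsto (fun t : ℝ => 1 + α * (t * β₂)) (𝓝[>] 0) (𝓝 1) :=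
      (Continuous.tendsto' (by fun_prop) 0 1 (by simp)).mono_left nhdsWithin_le_nhds
    simpa using h2.rpow_const (p := 1 / α) (Or.inl one_ne_zero)
  have h3 : Tendsto (fun t : ℝ => t * β₁) (𝓝[>] 0) (𝓝 0) :=
    (Continuous.tendsto' (by fun_prop) 0 0 (by simp)).mono_left nhdsWithin_le_nhds
  exact (h1.eventually_le_const (by norm_num)).and (h3.eventually_le_const (by norm_num))

theorem measurable_pert_polar (t : ℝ) : Measurable fun z : Euc n × ℝ =>
    ENNReal.ofReal ((gauge (effDom φ) z.1)⁻¹ ^ n * (1 + t * z.2) ^ (n - 1) *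
      pert α φ ψ t ((1 + t * z.2) • (gauge (effDom φ) z.1)⁻¹ • z.1)) := by
  have hg := (continuous_gauge h.convex h.mem_nhds).measurable
  have hg1 : Measurable fun z : Euc n × ℝ => gauge (effDom φ) z.1 := hg.comp measurable_fst
  have hx : Measurable fun z : Euc n × ℝ =>
      (1 + t * z.2) • (gauge (effDom φ) z.1)⁻¹ • z.1 := by fun_prop
  have hp := (measurable_pert (α := α) (φ := φ) (ψ := ψ) t).comp hx
  have : Measurable fun z : Euc n × ℝ => (gauge (effDom φ) z.1)⁻¹ ^ n * (1 + t * z.2) ^ (n - 1) := by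
    fun_prop
  exact (this.mul hp).ennreal_ofReal

/-- The integrand converges to a constant on `(0, H)` and to `0` beyond `H`, where `H` is the
support function at the gauge gradient. The length `H` of the interval is how the support function
enters the formula. -/
theorem tendsto_lintegral_ray {C : ℝ} (hα : 1 / α ≤ -(n : ℝ)) (hC0 : 0 ≤ C)
    (hC : ∀ x, f x ≤ C * (1 + ‖x‖) ^ (1 / α)) (hn : n ≠ 0) {θ : Euc n} (hθ : ‖θ‖ = 1)
    (hd : 0 < gauge (effDom φ) θ → DifferentiableAt ℝ (gauge (effDom φ)) θ) :
    Tendsto (fun t : ℝ => ∫⁻ κ in Set.Ioi (0 : ℝ),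
        ENNReal.ofReal ((gauge (effDom φ) θ)⁻¹ ^ n * (1 + t * κ) ^ (n - 1) *
          pert α φ ψ t ((1 + t * κ) • (gauge (effDom φ) θ)⁻¹ • θ))) (𝓝[>] 0)
      (𝓝 (ENNReal.ofReal ((gauge (effDom φ) θ)⁻¹ ^ n * (f ((gauge (effDom φ) θ)⁻¹ • θ) *
        (supportFun (closure (effDom ψ))
          (gradient (gauge (effDom φ)) ((gauge (effDom φ) θ)⁻¹ • θ))).toReal)))) := by
  rcases (gauge_nonneg (s := effDom φ) θ).eq_or_lt with hc | hc
  · rw [← hc]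
    simp [hn]
  set ρ := (gauge (effDom φ) θ)⁻¹ with hρ
  have hρ0 : 0 < ρ := inv_pos.2 hc
  have hg : gauge (effDom φ) (ρ • θ) = 1 := gauge_inv_smul hc
  have hdiff : DifferentiableAt ℝ (gauge (effDom φ)) (ρ • θ) :=
    differentiableAt_gauge_of_smul (inv_pos.2 hρ0)
      (by rw [inv_smul_smul₀ hρ0.ne']; exact hd hc)
  set H := (supportFun (closure (effDom ψ)) (gradient (gauge (effDom φ)) (ρ • θ))).toReal with hH
  have hsub := isSubgradientOn_gauge_iff.1 (hdiff.isSubgradientOn_gauge h.convex h.mem_nhds)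
  rw [hg] at hsub
  have hH0 : 0 ≤ H := (h.toReal_supportFun_mem hsub.2).1
  have hlim : ∫⁻ κ in Set.Ioi (0 : ℝ), (Set.Ioo 0 H).indicator
      (fun _ => ENNReal.ofReal (ρ ^ n * f (ρ • θ))) κ =
      ENNReal.ofReal (ρ ^ n * (f (ρ • θ) * H)) := by
    rw [lintegral_indicator measurableSet_Ioo, lintegral_const, Measure.restrict_apply_univ,
      Measure.restrict_apply measurableSet_Ioo,
      Set.inter_eq_left.2 fun κ hκ => hκ.1, Real.volume_Ioo, sub_zero, ← ENNReal.ofReal_mul,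
      mul_assoc]
    have := h.f_nonneg (ρ • θ)
    positivity
  rw [← hlim]
  refine tendsto_lintegral_filter_of_dominated_convergence
    ((Set.Ioc 0 β₁).indicator fun _ => ENNReal.ofReal (2 ^ (n - 1) * (2 * (C * 2 ^ n))))
    ?_ ?_ ?_ ?_
  · refine Eventually.of_forall fun t => ?_
    have := (h.measurable_pert_polar t).comp (measurable_prodMk_left (x := θ))
    exact this
  · filter_upwards [eventually_pos α β₂, eventually_rpow_le_two α β₁ β₂] with t ht ht3
    filter_upwards [ae_restrict_mem measurableSet_Ioi,
      ae_restrict_of_ae (Measure.ae_ne volume β₁)] with κ hκ hκβ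
    refine (ENNReal.ofReal_le_ofReal (h.pert_polar_le hα hC0 hC hn ht.1 ht.2 ht3.1 ht3.2 hκ hκβ
      hθ)).trans (le_of_eq ?_)
    by_cases hmem : κ ∈ Set.Ioc 0 β₁
    · rw [Set.indicator_of_mem hmem, Set.indicator_of_mem hmem]
    · rw [Set.indicator_of_notMem hmem, Set.indicator_of_notMem hmem, ENNReal.ofReal_zero]
  · rw [lintegral_indicator measurableSet_Ioc, lintegral_const, Measure.restrict_apply_univ]
    refine ENNReal.mul_ne_top ENNReal.ofReal_ne_top (ne_of_lt ?_)
    exact (Measure.restrict_le_self _).trans_lt measure_Ioc_lt_top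
  · filter_upwards [ae_restrict_mem measurableSet_Ioi,
      ae_restrict_of_ae (Measure.ae_ne volume H)] with κ hκ hκH
    have hκ' : (0 : ℝ) < κ := hκ
    rcases lt_or_gt_of_ne hκH with hlt | hgt
    · rw [Set.indicator_of_mem (show κ ∈ Set.Ioo 0 H from ⟨hκ', hlt⟩)]
      refine ENNReal.tendsto_ofReal ?_
      have h1 := h.tendsto_exterior hg hdiff hκ' hlt
      have h2 : Tendsto (fun t : ℝ => ρ ^ n * (1 + t * κ) ^ (n - 1)) (𝓝[>] 0) (𝓝 (ρ ^ n)) :=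
        (Continuous.tendsto' (by fun_prop) 0 _ (by simp)).mono_left nhdsWithin_le_nhds
      exact h2.mul h1
    · rw [Set.indicator_of_notMem fun hmem => hgt.not_gt hmem.2]
      refine tendsto_const_nhds.congr' ?_
      filter_upwards [self_mem_nhdsWithin] with t ht
      rw [h.pert_eq_zero hsub.2 hsub.1 ht hgt, mul_zero, ENNReal.ofReal_zero]

end

end PertData

/-! ### The boundary contribution. -/

namespace PertData

variable {n : ℕ} {α : ℝ} {f : Euc n → ℝ} {φ ψ : Euc n → EReal} {β₁ β₂ m : ℝ}

section
variable (h : PertData α f φ ψ β₁ β₂ m)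
include h

omit h in
theorem measurable_toReal_supportFun_gradient (φ ψ : Euc n → EReal) :
    Measurable fun x => (supportFun (closure (effDom ψ)) (gradient (gauge (effDom φ)) x)).toReal :=
  measurable_ereal_toReal.comp (measurable_supportFun.comp (measurable_gradient _))

theorem toReal_supportFun_gradient_le (x : Euc n) :
    (supportFun (closure (effDom ψ)) (gradient (gauge (effDom φ)) x)).toReal ≤ β₁ := by
  refine (h.toReal_supportFun_mem fun y => ?_).2
  -- Without differentiability the gradient is `0` by default, and `0` also lies below the gauge.
  by_cases hd : DifferentiableAt ℝ (gauge (effDom φ)) x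
  · exact (isSubgradientOn_gauge_iff.1 (hd.isSubgradientOn_gauge h.convex h.mem_nhds)).2 y
  · rw [gradient, fderiv_zero_of_not_differentiableAt hd, map_zero, inner_zero_left]
    exact gauge_nonneg y

theorem tendsto_lintegral_exterior {C : ℝ} (hα : 1 / α ≤ -(n : ℝ)) (hC0 : 0 ≤ C)
    (hC : ∀ x, f x ≤ C * (1 + ‖x‖) ^ (1 / α)) (hn : n ≠ 0) :
    Tendsto (fun t : ℝ => ∫⁻ x in {x | 1 < gauge (effDom φ) x},
        ENNReal.ofReal (pert α φ ψ t x / t)) (𝓝[>] 0)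
      (𝓝 (∫⁻ x in {x | gauge (effDom φ) x = 1}, ENNReal.ofReal
        ((supportFun (closure (effDom ψ)) (‖gradient (gauge (effDom φ)) x‖⁻¹ •
          gradient (gauge (effDom φ)) x)).toReal * f x) ∂μHE[n - 1])) ∧
    ∫⁻ x in {x | gauge (effDom φ) x = 1}, ENNReal.ofReal
        ((supportFun (closure (effDom ψ)) (‖gradient (gauge (effDom φ)) x‖⁻¹ •
          gradient (gauge (effDom φ)) x)).toReal * f x) ∂μHE[n - 1] < ⊤ := by
  have hd : Module.finrank ℝ (Euc n) = n := finrank_euclideanSpace_fin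
  have : Nontrivial (Euc n) := Module.nontrivial_of_finrank_pos (R := ℝ) (by omega)
  set N := gradient (gauge (effDom φ)) with hN
  set H : Euc n → ℝ := fun x => (supportFun (closure (effDom ψ)) (N x)).toReal with hH
  have hHm : Measurable H := measurable_toReal_supportFun_gradient φ ψ
  have hH0 : ∀ x, 0 ≤ H x := fun x => EReal.toReal_nonneg (h.supportFun_nonneg _)
  have hgm := (continuous_gauge h.convex h.mem_nhds).measurable
  set ρ : Metric.sphere (0 : Euc n) 1 → ℝ := fun θ => (gauge (effDom φ) (θ : Euc n))⁻¹ with hρ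
  have hρm : Measurable ρ := (hgm.comp measurable_subtype_coe).inv
  have hρ0 : ∀ θ, 0 ≤ ρ θ := fun θ => inv_nonneg.2 (gauge_nonneg _)
  set B : ℝ := 2 ^ (n - 1) * (2 * (C * 2 ^ n)) with hB
  have hdiff : ∀ᵐ θ : Metric.sphere (0 : Euc n) 1 ∂(volume : Measure (Euc n)).toSphere,
      DifferentiableAt ℝ (gauge (effDom φ)) (θ : Euc n) := by
    refine ae_toSphere_of_ae ?_ fun x s hs hx => differentiableAt_gauge_of_smul hs hx
    filter_upwards [(convexOn_gauge h.convex h.mem_nhds).ae_differentiableAt volume] with x hx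
    exact hx (by simp)
  -- the limit as an integral over the sphere
  set L := ∫⁻ θ, ENNReal.ofReal (ρ θ ^ n * (f (ρ θ • (θ : Euc n)) * H (ρ θ • (θ : Euc n))))
    ∂(volume : Measure (Euc n)).toSphere with hL
  have hLim : Tendsto (fun t : ℝ => ∫⁻ x in {x | 1 < gauge (effDom φ) x},
      ENNReal.ofReal (pert α φ ψ t x / t)) (𝓝[>] 0) (𝓝 L) := by
    have h1 : Tendsto (fun t : ℝ => ∫⁻ θ : Metric.sphere (0 : Euc n) 1,
        (∫⁻ κ in Set.Ioi (0 : ℝ), ENNReal.ofReal (ρ θ ^ n * (1 + t * κ) ^ (n - 1) *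
          pert α φ ψ t ((1 + t * κ) • ρ θ • (θ : Euc n)))) ∂(volume : Measure (Euc n)).toSphere)
        (𝓝[>] 0) (𝓝 L) := by
      refine tendsto_lintegral_filter_of_dominated_convergence
        (fun _ => ENNReal.ofReal B * ENNReal.ofReal β₁) ?_ ?_ ?_ ?_
      · refine Eventually.of_forall fun t => ?_
        have h2 := (h.measurable_pert_polar t).lintegral_prod_right'
          (ν := volume.restrict (Set.Ioi (0 : ℝ)))
        exact h2.comp measurable_subtype_coe
      · filter_upwards [eventually_pos α β₂, eventually_rpow_le_two α β₁ β₂] with t ht ht3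
        refine Eventually.of_forall fun θ => ?_
        have hθ : ‖(θ : Euc n)‖ = 1 := by simp
        calc _ ≤ ∫⁻ κ in Set.Ioi (0 : ℝ),
              (Set.Ioc 0 β₁).indicator (fun _ => ENNReal.ofReal B) κ := by
              refine lintegral_mono_ae ?_
              filter_upwards [ae_restrict_mem measurableSet_Ioi,
                ae_restrict_of_ae (Measure.ae_ne volume β₁)] with κ hκ hκβ
              refine (ENNReal.ofReal_le_ofReal (h.pert_polar_le hα hC0 hC hn ht.1 ht.2 ht3.1 ht3.2
                hκ hκβ hθ)).trans (le_of_eq ?_)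
              by_cases hmem : κ ∈ Set.Ioc 0 β₁
              · rw [Set.indicator_of_mem hmem, Set.indicator_of_mem hmem]
              · rw [Set.indicator_of_notMem hmem, Set.indicator_of_notMem hmem,
                  ENNReal.ofReal_zero]
          _ ≤ ∫⁻ κ : ℝ, (Set.Ioc 0 β₁).indicator (fun _ => ENNReal.ofReal B) κ :=
              setLIntegral_le_lintegral _ _
          _ = _ := by
              rw [lintegral_indicator measurableSet_Ioc, setLIntegral_const, Real.volume_Ioc,
                sub_zero]
      · rw [lintegral_const]
        exact ENNReal.mul_ne_top (ENNReal.mul_ne_top ENNReal.ofReal_ne_top ENNReal.ofReal_ne_top)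
          (measure_ne_top _ _)
      · filter_upwards [hdiff] with θ hθ
        exact h.tendsto_lintegral_ray hα hC0 hC hn (by simp) fun _ => hθ
    refine h1.congr' ?_
    filter_upwards [self_mem_nhdsWithin] with t ht
    have ht' : (0 : ℝ) < t := ht
    rw [lintegral_one_lt_gauge h.convex h.mem_nhds ht'
      ((measurable_pert t).div_const t).ennreal_ofReal, hd]
    refine lintegral_congr fun θ => setLIntegral_congr_fun measurableSet_Ioi fun κ hκ => ?_
    have hκ' : (0 : ℝ) < κ := hκ
    have := hρ0 θ
    rw [← ENNReal.ofReal_mul (by positivity)]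
    congr 1
    change _ = t * (ρ θ ^ n * (1 + t * κ) ^ (n - 1)) *
      (pert α φ ψ t ((1 + t * κ) • ρ θ • (θ : Euc n)) / t)
    field_simp
  have hLfin : L < ⊤ := by
    refine lt_of_le_of_lt (lintegral_mono (g := fun _ => ENNReal.ofReal (C * 2 ^ n * β₁)) ?_) ?_
    · intro θ
      refine ENNReal.ofReal_le_ofReal ?_
      have h1 := pow_mul_le_of_decay h.f_nonneg hα hC0 hC (hρ0 θ) (s := 1) (by norm_num)
        (θ := (θ : Euc n)) (by simp)
      rw [one_smul] at h1
      have h2 := h.f_nonneg (ρ θ • (θ : Euc n))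
      have h3 : 0 ≤ ρ θ ^ n * f (ρ θ • (θ : Euc n)) := mul_nonneg (pow_nonneg (hρ0 θ) n) h2
      rw [← mul_assoc]
      exact mul_le_mul h1 (h.toReal_supportFun_gradient_le _) (hH0 _) (h3.trans h1)
    · rw [lintegral_const]
      exact ENNReal.mul_lt_top ENNReal.ofReal_lt_top (measure_lt_top _ _)
  -- The weight `ρ^n` on the sphere is the cone measure on the boundary; its density `1/‖N‖` then
  -- normalizes the argument of the support function by homogeneity.
  have hLeq : L = ∫⁻ x in {x | gauge (effDom φ) x = 1}, ENNReal.ofReal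
      ((supportFun (closure (effDom ψ)) (‖N x‖⁻¹ • N x)).toReal * f x) ∂μHE[n - 1] := by
    have hQ : Measurable fun x => ENNReal.ofReal (f x * H x) :=
      (h.measurable_f.mul hHm).ennreal_ofReal
    have h1 : L = ∫⁻ x, ENNReal.ofReal (f x * H x) ∂coneMeasure (effDom φ) := by
      rw [coneMeasure_eq_map_toSphere h.convex h.mem_nhds, hd,
        lintegral_map hQ (by exact hρm.smul measurable_subtype_coe),
        lintegral_withDensity_eq_lintegral_mul _ (by exact (hρm.pow_const n).ennreal_ofReal)
          (by exact hQ.comp (hρm.smul measurable_subtype_coe))]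
      refine lintegral_congr fun θ => ?_
      have := hρ0 θ
      rw [ENNReal.ofReal_mul (by positivity)]
      rfl
    rw [h1, coneMeasure_eq h.convex h.mem_nhds, hd,
      lintegral_withDensity_eq_lintegral_mul _
        (by exact (measurable_gradient _).norm.inv.ennreal_ofReal) hQ]
    have hS : MeasurableSet {x | gauge (effDom φ) x = 1} := hgm (measurableSet_singleton 1)
    refine lintegral_congr_ae ?_
    have h2 := euclideanHausdorffMeasure_not_differentiableAt_gauge h.convex h.mem_nhds
    rw [hd] at h2
    filter_upwards [ae_restrict_mem hS, ae_restrict_of_ae (measure_eq_zero_iff_ae_notMem.1 h2)]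
      with x hx hx2
    have hx3 : DifferentiableAt ℝ (gauge (effDom φ)) x := by
      by_contra hcon
      exact hx2 ⟨hx, hcon⟩
    have hN0 : 0 < ‖N x‖ := norm_pos_iff.2 (gradient_gauge_ne_zero h.convex h.mem_nhds hx hx3)
    rw [Pi.mul_apply, ← ENNReal.ofReal_mul (by positivity), supportFun_smul (inv_pos.2 hN0),
      EReal.toReal_mul, EReal.toReal_coe]
    congr 1
    ring
  rw [← hLeq]
  exact ⟨hLim, hLfin⟩

/-- The contribution of the boundary of the domain to the first variation. -/
theorem exterior_variation {C : ℝ} (hα : 1 / α ≤ -(n : ℝ)) (hC0 : 0 ≤ C)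
    (hC : ∀ x, f x ≤ C * (1 + ‖x‖) ^ (1 / α)) (hn : n ≠ 0) :
    IntegrableOn (fun x => (supportFun (closure (effDom ψ)) (‖gradient (gauge (effDom φ)) x‖⁻¹ •
          gradient (gauge (effDom φ)) x)).toReal * f x) {x | gauge (effDom φ) x = 1} μHE[n - 1] ∧
      Tendsto (fun t : ℝ => ∫ x in {x | 1 < gauge (effDom φ) x}, pert α φ ψ t x / t) (𝓝[>] 0)
        (𝓝 (∫ x in {x | gauge (effDom φ) x = 1},
          (supportFun (closure (effDom ψ)) (‖gradient (gauge (effDom φ)) x‖⁻¹ •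
          gradient (gauge (effDom φ)) x)).toReal * f x ∂μHE[n - 1])) := by
  obtain ⟨h1, h2⟩ := h.tendsto_lintegral_exterior hα hC0 hC hn
  have hm : Measurable fun x => (supportFun (closure (effDom ψ))
      (‖gradient (gauge (effDom φ)) x‖⁻¹ • gradient (gauge (effDom φ)) x)).toReal * f x := by
    refine (measurable_ereal_toReal.comp (measurable_supportFun.comp ?_)).mul h.measurable_f
    exact (measurable_gradient _).norm.inv.smul (measurable_gradient _)
  have h0 : ∀ x, 0 ≤ (supportFun (closure (effDom ψ))
      (‖gradient (gauge (effDom φ)) x‖⁻¹ • gradient (gauge (effDom φ)) x)).toReal * f x :=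
    fun x => mul_nonneg (EReal.toReal_nonneg (h.supportFun_nonneg _)) (h.f_nonneg x)
  constructor
  · exact (lintegral_ofReal_ne_top_iff_integrable hm.aestronglyMeasurable
      (Eventually.of_forall h0)).1 h2.ne
  · rw [integral_eq_lintegral_of_nonneg_ae (Eventually.of_forall h0) hm.aestronglyMeasurable]
    refine ((ENNReal.tendsto_toReal h2.ne).comp h1).congr' ?_
    filter_upwards [eventually_pos α β₂] with t ht
    rw [integral_eq_lintegral_of_nonneg_ae (Eventually.of_forall fun x =>
      div_nonneg (h.pert_nonneg ht.1 ht.2 x) ht.1.le)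
      ((measurable_pert t).div_const t).aestronglyMeasurable]
    rfl

end

end PertData

/-! ### Outer normals and the Gauss map in terms of the gauge. -/

section Normal

variable {n : ℕ} {K : Set (Euc n)}

/-- A convex set and its closure have the same affine hull, so if the closure has interior points
the set has them too, and the two interiors coincide. -/
theorem mem_nhds_of_mem_interior_closure {x : Euc n} (hK : Convex ℝ K)
    (hx : x ∈ interior (closure K)) : K ∈ 𝓝 x := by
  have h1 : affineSpan ℝ (closure K) = ⊤ :=
    hK.closure.interior_nonempty_iff_affineSpan_eq_top.1 ⟨x, hx⟩
  have h2 : closure K ⊆ affineSpan ℝ K :=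
    closure_minimal (subset_affineSpan ℝ K) (AffineSubspace.closed_of_finiteDimensional _)
  have h3 : affineSpan ℝ K = ⊤ := top_le_iff.1 (h1 ▸ affineSpan_le.2 h2)
  rw [hK.interior_closure_eq_interior_of_nonempty_interior
    (hK.interior_nonempty_iff_affineSpan_eq_top.2 h3)] at hx
  exact mem_interior_iff_mem_nhds.1 hx

theorem frontier_closure_eq_gauge (hK : Convex ℝ K) (h0 : K ∈ 𝓝 0) :
    frontier (closure K) = {x | gauge K x = 1} := by
  have h1 : frontier (closure K) = frontier K := by
    rw [frontier, frontier, closure_closure, hK.interior_closure_eq_interior_of_nonempty_interior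
      ⟨0, mem_interior_iff_mem_nhds.2 h0⟩]
  ext x
  rw [h1, ← gauge_eq_one_iff_mem_frontier hK h0, Set.mem_ofPred_eq]

/-- Dividing an outer normal `u` by `⟨u, x⟩` yields a subgradient of the gauge at `x`, and
differentiability leaves only one. The divisor is positive because `K` contains a small positive
multiple of `u`. -/
theorem isOuterUnitNormal_iff (hK : Convex ℝ K) (h0 : K ∈ 𝓝 0) {x : Euc n} (hx : gauge K x = 1)
    (hd : DifferentiableAt ℝ (gauge K) x) (u : Euc n) :
    IsOuterUnitNormal (closure K) x u ↔
      u = ‖gradient (gauge K) x‖⁻¹ • gradient (gauge K) x := by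
  set N := gradient (gauge K) x with hN
  have hN0 : N ≠ 0 := gradient_gauge_ne_zero hK h0 hx hd
  have hNn : 0 < ‖N‖ := norm_pos_iff.2 hN0
  have hsub := isSubgradientOn_gauge_iff.1 (hd.isSubgradientOn_gauge hK h0)
  rw [← hN, hx] at hsub
  constructor
  · rintro ⟨hu1, hu2⟩
    set a : ℝ := inner ℝ u x with ha
    have hle : ∀ y ∈ closure K, inner ℝ u y ≤ a := fun y hy => by
      have := hu2 y hy
      rw [inner_sub_right] at this
      linarith
    have ha0 : 0 < a := by
      have hc : Tendsto (fun ε : ℝ => ε • u) (𝓝[>] 0) (𝓝 0) :=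
        (Continuous.tendsto' (by fun_prop) 0 0 (by simp)).mono_left nhdsWithin_le_nhds
      obtain ⟨ε, hε, hε0⟩ := ((hc.eventually h0).and self_mem_nhdsWithin).exists
      have hε0' : (0 : ℝ) < ε := hε0
      have := hle _ (subset_closure hε)
      rw [inner_smul_right, real_inner_self_eq_norm_sq, hu1] at this
      linarith
    have hp : IsSubgradientOn (gauge K) Set.univ x (a⁻¹ • u) := by
      rw [isSubgradientOn_gauge_iff, hx, inner_smul_left]
      refine ⟨by simpa [← ha] using inv_mul_cancel₀ ha0.ne', fun y => ?_⟩
      refine le_of_forall_gt_imp_ge_of_dense fun r hr => ?_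
      have hr0 : 0 < r := (gauge_nonneg y).trans_lt hr
      have hmem : r⁻¹ • y ∈ closure K := by
        rw [← gauge_le_one_iff_mem_closure hK h0, gauge_smul_of_nonneg (by positivity), smul_eq_mul,
          inv_mul_le_iff₀ hr0, mul_one]
        exact hr.le
      have := hle _ hmem
      rw [inner_smul_right, inv_mul_le_iff₀ hr0] at this
      rw [inner_smul_left]
      simp only [map_inv₀, conj_trivial]
      rw [inv_mul_le_iff₀ ha0]
      linarith
    have heq : a⁻¹ • u = N := hp.eq_of_hasGradientAt univ_mem hd.hasGradientAt
    have h1 : ‖N‖ = a⁻¹ := by rw [← heq, norm_smul, hu1, mul_one, Real.norm_of_nonneg (by positivity)]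
    rw [h1, inv_inv, ← heq, smul_inv_smul₀ ha0.ne']
  · rintro rfl
    refine ⟨norm_smul_inv_norm hN0, fun y hy => ?_⟩
    have h1 : inner ℝ N (y - x) ≤ 0 := by
      rw [inner_sub_right, hsub.1]
      linarith [hsub.2 y, (gauge_le_one_iff_mem_closure hK h0).2 hy]
    rw [inner_smul_left]
    exact mul_nonpos_of_nonneg_of_nonpos (by simp) h1

theorem existsUnique_isOuterUnitNormal (hK : Convex ℝ K) (h0 : K ∈ 𝓝 0) {x : Euc n}
    (hx : gauge K x = 1) (hd : DifferentiableAt ℝ (gauge K) x) :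
    ∃! u, IsOuterUnitNormal (closure K) x u :=
  ⟨_, (isOuterUnitNormal_iff hK h0 hx hd _).2 rfl,
    fun u hu => (isOuterUnitNormal_iff hK h0 hx hd u).1 hu⟩

theorem gaussMap_closure (hK : Convex ℝ K) (h0 : K ∈ 𝓝 0) {x : Euc n} (hx : gauge K x = 1)
    (hd : DifferentiableAt ℝ (gauge K) x) :
    gaussMap (closure K) x = ‖gradient (gauge K) x‖⁻¹ • gradient (gauge K) x := by
  have hex := existsUnique_isOuterUnitNormal hK h0 hx hd
  rw [gaussMap, dif_pos hex]
  exact (isOuterUnitNormal_iff hK h0 hx hd _).1 hex.choose_spec.1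

theorem ae_gauge_ne (hK : Convex ℝ K) (h0 : K ∈ 𝓝 0) {l : ℝ} (hl : 0 < l) :
    ∀ᵐ x : Euc n, gauge K x ≠ l := by
  have h1 := Measure.addHaar_preimage_smul (volume : Measure (Euc n)) (inv_ne_zero hl.ne')
    (frontier K)
  rw [hK.addHaar_frontier volume, mul_zero] at h1
  filter_upwards [measure_eq_zero_iff_ae_notMem.1 h1] with x hx hxl
  refine hx ?_
  rw [Set.mem_preimage, ← gauge_eq_one_iff_mem_frontier hK h0, gauge_smul_of_nonneg (by positivity),
    smul_eq_mul, hxl, inv_mul_cancel₀ hl.ne']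

end Normal

/-! ### Assembling the variational formula. -/

namespace PertData

variable {n : ℕ} {α : ℝ} {f : Euc n → ℝ} {φ ψ : Euc n → EReal} {β₁ β₂ m : ℝ}

section
variable (h : PertData α f φ ψ β₁ β₂ m)
include h

theorem integrable_pert (hi : Integrable f) {t : ℝ} (ht : 0 < t) (ht2 : 0 < 1 + α * (t * β₂)) :
    Integrable (pert α φ ψ t) := by
  have hl : 0 < 1 + t * β₁ := by have := h.pos₁; positivity
  have h1 : Integrable fun x => (1 + α * (t * β₂)) ^ (1 / α) * f ((1 + t * β₁)⁻¹ • x) :=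
    (hi.comp_smul (inv_ne_zero hl.ne')).const_mul _
  refine h1.mono' (measurable_pert t).aestronglyMeasurable ?_
  filter_upwards [ae_gauge_ne h.convex h.mem_nhds hl] with x hx
  rw [Real.norm_of_nonneg (h.pert_nonneg ht ht2 x)]
  exact h.pert_le ht ht2 hx

theorem integral_pert_sub (hi : Integrable f) {t : ℝ} (ht : 0 < t)
    (ht2 : 0 < 1 + α * (t * β₂)) :
    ∫ x, (pert α φ ψ t x - f x) / t =
      (∫ x in {x | gauge (effDom φ) x < 1}, (pert α φ ψ t x - f x) / t) +
        ∫ x in {x | 1 < gauge (effDom φ) x}, pert α φ ψ t x / t := by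
  have hm : MeasurableSet {x | 1 < gauge (effDom φ) x} :=
    measurableSet_lt measurable_const (continuous_gauge h.convex h.mem_nhds).measurable
  have hint : Integrable fun x => (pert α φ ψ t x - f x) / t :=
    ((h.integrable_pert hi ht ht2).sub hi).div_const t
  rw [← integral_add_compl h.measurableSet_gauge_lt hint]
  congr 1
  rw [setIntegral_congr_set (t := {x | 1 < gauge (effDom φ) x})]
  · refine setIntegral_congr_fun hm fun x hx => ?_
    have hx' : 1 < gauge (effDom φ) x := hx
    simp only [h.f_of_notMem fun hmem => (gauge_le_one hmem).not_gt hx', sub_zero]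
  · filter_upwards [ae_gauge_ne h.convex h.mem_nhds one_pos] with x hx
    refine propext ⟨fun h1 => ?_, fun h1 => ?_⟩
    · have h1' : ¬ gauge (effDom φ) x < 1 := h1
      exact lt_of_le_of_ne (not_lt.1 h1') hx.symm
    · have h1' : 1 < gauge (effDom φ) x := h1
      exact h1'.not_gt

theorem interior_integrand_eq_zero : ∀ᵐ x : Euc n, ¬ gauge (effDom φ) x < 1 →
    (legendre ψ (grad φ x)).toReal * f x ^ (1 - α) = 0 := by
  filter_upwards [h.ae_effDom_interior] with x hx hxI
  have := h.neg
  rw [h.f_of_notMem fun hxD => hxI (hx hxD), Real.zero_rpow (by linarith), mul_zero]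

theorem ae_frontier : ∀ᵐ x ∂(μHE[n - 1] : Measure (Euc n)).restrict (frontier (closure (effDom φ))),
    gauge (effDom φ) x = 1 ∧ DifferentiableAt ℝ (gauge (effDom φ)) x := by
  rw [frontier_closure_eq_gauge h.convex h.mem_nhds]
  have hS : MeasurableSet {x | gauge (effDom φ) x = 1} :=
    (continuous_gauge h.convex h.mem_nhds).measurable (measurableSet_singleton 1)
  have h2 := euclideanHausdorffMeasure_not_differentiableAt_gauge h.convex h.mem_nhds
  rw [finrank_euclideanSpace_fin] at h2
  filter_upwards [ae_restrict_mem hS, ae_restrict_of_ae (measure_eq_zero_iff_ae_notMem.1 h2)]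
    with x hx hx2
  refine ⟨hx, ?_⟩
  by_contra hcon
  exact hx2 ⟨hx, hcon⟩

theorem supportFun_gaussMap_ne_top {x : Euc n} (hx : gauge (effDom φ) x = 1)
    (hd : DifferentiableAt ℝ (gauge (effDom φ)) x) :
    supportFun (closure (effDom ψ)) (gaussMap (closure (effDom φ)) x) ≠ ⊤ := by
  have hN : 0 < ‖gradient (gauge (effDom φ)) x‖ :=
    norm_pos_iff.2 (gradient_gauge_ne_zero h.convex h.mem_nhds hx hd)
  have hsub := isSubgradientOn_gauge_iff.1 (hd.isSubgradientOn_gauge h.convex h.mem_nhds)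
  rw [gaussMap_closure h.convex h.mem_nhds hx hd, supportFun_smul (inv_pos.2 hN),
    ← h.coe_toReal_supportFun hsub.2, ← EReal.coe_mul]
  exact EReal.coe_ne_top _

end

end PertData

theorem IsCPlusWithBase.support_eq {n : ℕ} {α : ℝ} (hα : α < 0) {f : Euc n → ℝ}
    {φ : Euc n → EReal} (hf : IsCPlusWithBase α f φ) : Function.support f = effDom φ := by
  ext x
  rw [Function.mem_support, hf.eq_generator]
  by_cases hx : x ∈ effDom φ
  · rw [← hf.conv.coe_toReal hx, generator_coe]
    have := one_le_of_nonneg hα (EReal.toReal_nonneg (hf.nonneg x))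
    exact iff_of_true (realGen_pos (by linarith)).ne' hx
  · rw [hf.conv.eq_top hx, generator_top]
    exact iff_of_false (by simp) hx

end AlphaConcave

end

open AlphaConcave in
theorem mainTheorem2 (n : ℕ) (hn : 1 ≤ n) (α : ℝ) (hα : -(1 / (n : ℝ)) < α) (hα0 : α < 0)
    (f : Euc n → ℝ) (φ ψ : Euc n → EReal)
    (hf : IsCPlusWithBase α f φ)
    (ho : (0 : Euc n) ∈ interior (tsupport f))
    (hψ : IsConv ψ)
    (β₁ β₂ : ℝ) (hβ₁ : 0 < β₁)
    (hinf : ⊥ < ⨅ y, legendre ψ y)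
    (hle : ∀ y, legendre ψ y ≤ (β₁ : EReal) * legendre φ y + (β₂ : EReal)) :
    -- `f` is integrable, and for small `t > 0` the function `f_t` is well defined and integrable
    Integrable f volume ∧
    (∀ᶠ t in 𝓝[>] (0 : ℝ), (∀ x, ((1 / α : ℝ) : EReal) < pertBase φ ψ t x) ∧
      Integrable (pert α φ ψ t) volume) ∧
    -- both integrands on the right are defined almost everywhere, and both integrals are finite
    (∀ᵐ x ∂(volume : Measure (Euc n)), x ∈ effDom φ →
      x ∈ interior (effDom φ) ∧ DifferentiableAt ℝ (fun z => (φ z).toReal) x ∧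
      legendre ψ (grad φ x) ≠ ⊤) ∧
    Integrable (fun x => (legendre ψ (grad φ x)).toReal * f x ^ (1 - α)) volume ∧
    (∀ᵐ x ∂(μHE[n - 1] : Measure (Euc n)).restrict (frontier (tsupport f)),
      (∃! u, IsOuterUnitNormal (tsupport f) x u) ∧
      supportFun (closure (effDom ψ)) (gaussMap (tsupport f) x) ≠ ⊤) ∧
    IntegrableOn
      (fun x => (supportFun (closure (effDom ψ)) (gaussMap (tsupport f) x)).toReal * f x)
      (frontier (tsupport f)) μHE[n - 1] ∧
    -- the variational formula
    Tendsto (fun t : ℝ => ∫ x, (pert α φ ψ t x - f x) / t) (𝓝[>] 0)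
      (𝓝 ((∫ x, (legendre ψ (grad φ x)).toReal * f x ^ (1 - α)) +
        ∫ x in frontier (tsupport f),
          (supportFun (closure (effDom ψ)) (gaussMap (tsupport f) x)).toReal * f x
          ∂μHE[n - 1])) := by
  have hn0 : (0 : ℝ) < n := by exact_mod_cast hn
  have hα' : 1 / α ≤ -(n : ℝ) := by
    rw [div_le_iff_of_neg hα0]
    have : 1 / (n : ℝ) * n = 1 := by field_simp
    nlinarith
  have hsupp : tsupport f = closure (effDom φ) := by rw [tsupport, hf.support_eq hα0]
  rw [hsupp] at ho ⊢
  obtain ⟨c, -, hc⟩ := EReal.lt_iff_exists_real_btwn.1 hinf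
  -- Both constants may be enlarged to be nonnegative without affecting the bounds on `ψ*`.
  have h : PertData α f φ ψ β₁ (max β₂ 0) (max (-c) 0) :=
    { neg := hα0
      eq_generator := hf.eq_generator
      conv := hf.conv
      nonneg := hf.nonneg
      conv' := hψ
      mem_nhds := mem_nhds_of_mem_interior_closure hf.conv.convexOn.1 ho
      pos₁ := hβ₁
      nonneg₂ := le_max_right _ _
      nonneg_m := le_max_right _ _
      le := fun y => (hle y).trans
        (add_le_add le_rfl (EReal.coe_le_coe_iff.2 (le_max_left _ _)))
      ge := fun y => le_trans
        (EReal.coe_le_coe_iff.2 (by linarith [le_max_left (-c) 0])) (hc.le.trans (iInf_le _ y)) }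
  obtain ⟨C, hC0, hC⟩ := hf.exists_decay hα0
  have hi : Integrable f := integrable_of_decay hα hn hα0 h.measurable_f h.f_nonneg hC
  obtain ⟨hint, hintlim⟩ := h.interior_variation hi
  obtain ⟨hext, hextlim⟩ := h.exterior_variation hα' hC0.le hC (by omega)
  have hfront := frontier_closure_eq_gauge h.convex h.mem_nhds
  have hcongr : (fun x => (supportFun (closure (effDom ψ))
      (gaussMap (closure (effDom φ)) x)).toReal * f x)
      =ᵐ[(μHE[n - 1] : Measure (Euc n)).restrict (frontier (closure (effDom φ)))]
      fun x => (supportFun (closure (effDom ψ)) (‖gradient (gauge (effDom φ)) x‖⁻¹ •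
        gradient (gauge (effDom φ)) x)).toReal * f x := by
    filter_upwards [h.ae_frontier] with x hx
    rw [gaussMap_closure h.convex h.mem_nhds hx.1 hx.2]
  refine ⟨hi, ?_, ?_, ?_, ?_, ?_, ?_⟩
  · filter_upwards [PertData.eventually_pos α (max β₂ 0)] with t ht
    exact ⟨h.lt_pertBase ht.1 ht.2, h.integrable_pert hi ht.1 ht.2⟩
  · filter_upwards [h.ae_effDom_interior, h.ae_differentiableAt_interior] with x hx1 hx2 hx
    exact ⟨h.mem_interior_iff.2 (hx1 hx), hx2 (hx1 hx),
      h.legendre_grad_ne_top hx (hx2 (hx1 hx))⟩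
  · exact hint.integrable_of_ae_notMem_eq_zero h.interior_integrand_eq_zero
  · filter_upwards [h.ae_frontier] with x hx
    exact ⟨existsUnique_isOuterUnitNormal h.convex h.mem_nhds hx.1 hx.2,
      h.supportFun_gaussMap_ne_top hx.1 hx.2⟩
  · rw [← hfront] at hext
    exact Integrable.congr hext hcongr.symm
  · rw [integral_congr_ae hcongr, hfront,
      ← setIntegral_eq_integral_of_ae_compl_eq_zero h.interior_integrand_eq_zero]
    refine (hintlim.add hextlim).congr' ?_
    filter_upwards [PertData.eventually_pos α (max β₂ 0)] with t ht
    exact (h.integral_pert_sub hi ht.1 ht.2).symm
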